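/- **Setting.** $\kappa$ is the security parameter; "efficient" means computed by polynomial-size families of probabilistic Boolean circuits (non-uniform PPT), and computational statements are against such adversaries. All objects are bit strings of polynomial length. **SPHFwG.** A Smooth Projective Hash Function with Grey Zone consists of efficient samplers $\sigma\leftarrow S_0$; $(\sigma,\mathsf{td}_\sigma)\leftarrow S_1$; and, given $\sigma$, $\rho\leftarrow R_0$; $(\rho,(x,x',w,w'))\leftarrow R_1$; $(\rho,(x,x'))\leftarrow R_1'$; of a deterministic $\mathsf{param}\leftarrow\mathsf{Setup}(\sigma,\rho)$, which determines an efficiently recognizable set $\mathcal X$ and disjoint $\mathcal L,\mathcal L'\subseteq\mathcal X$, where $\mathcal L$ is given by a witness relation; and of efficient algorithms $\mathsf{HashKG}(\mathsf{param})\to\mathsf{hk}$, $\mathsf{ProjKG}(\mathsf{hk},x)\to\mathsf{hp}$, $\mathsf{Hash}(\mathsf{hk},x)$ and $\mathsf{ProjHash}(\mathsf{hp},x,w)$ with values in $\mathcal V=\{0,1\}^{\ell(\kappa)}$ (all of them may also use $\mathsf{param}$), $\mathsf{WordGen}_L(\mathsf{param})\to(x,w)$ with $w$ a witness of $x\in\mathcal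 L$, $\mathsf{WordGen}_X(\mathsf{param})$ (uniform on $\mathcal X\neq\emptyset$ up to negligible statistical distance), and deterministic $\mathsf{WordTest}$ and $\mathsf{Comp}(\mathsf{param},\rho,\cdot)$, such that: - *Correctness*: for all $\sigma\in S_0\cup S_1$, $\rho\in R_0\cup R_1\cup R_1'$, $x\in\mathcal L$ with witness $w$: $\mathsf{Hash}(\mathsf{hk},x)=\mathsf{ProjHash}(\mathsf{hp},x,w)$ except with (uniformly) negligible probability. - *Smoothness*: for all such $\sigma,\rho$ and $x\in\mathcal L'$, $(\mathsf{hp},\mathsf{Hash}(\mathsf{hk},x))$ and $(\mathsf{hp},v)$, $v$ uniform in $\mathcal V$, are at (uniformly) negligible statistical distance. - *Word trapdoor*: for $(\sigma,\mathsf{td}_\sigma)\leftarrow S_1$, $\mathsf{WordTest}(\mathsf{td}_\sigma,\cdot)$ decides membership in $\mathcal L'$ for words of $\mathcal X$. - *Word indistinguishability*: for $(\sigma,\rho)\leftarrow S_0\times R_0$, $(\sigma,\rho,x)$ with $x\leftarrow\mathsf{WordGen}_L$ and with $x\leftarrow\mathsf{WordGen}_X$ are computationally indistinguishable. - *Complement*: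 for $\sigma\in S_0\cup S_1$, $\rho\in R_0$, $\mathsf{Comp}(\mathsf{param},\rho,\cdot)$ is an involution of $\mathcal X$. - *Decomposition intractability*: for $(\sigma,\rho)\leftarrow S_1\times R_0$, no efficient adversary given $\sigma,\mathsf{td}_\sigma,\rho$ finds, with non-negligible probability, $x,y\in\mathcal X\setminus\mathcal L'$ with $y=\mathsf{Comp}(\mathsf{param},\rho,x)$. - *CRS indistinguishability*: the pairs $(\sigma,\rho)$ from $S_0\times R_0$, $S_1\times R_0$, $S_0\times R_1$ and $S_0\times R_1'$ (without trapdoors) are computationally indistinguishable. - *Trapdoors of $\rho$*: the output of $R_1$ satisfies $x,x'\in\mathcal L$ with witnesses $w,w'$ and $x'=\mathsf{Comp}(\mathsf{param},\rho,x)$, and, for $\sigma\leftarrow S_0$, each of $(x,w)$ and $(x',w')$ is, given $(\sigma,\rho)$, computationally indistinguishable from a fresh output of $\mathsf{WordGen}_L(\mathsf{param})$; the output of $R_1'$ satisfies $x,x'\in\mathcal L'$ and $x'=\mathsf{Comp}(\mathsf{param},\rho,x)$. **Protocol** (with $\mathsf{crs}=(\sigma,\rho)\leftarrow S_0\times R_0$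 from $\mathcal F_{CRS}$). The receiver, on input $b\in\{0,1\}$, draws $(x_b,w)\leftarrow\mathsf{WordGen}_L(\mathsf{param})$, sets $x_{1-b}=\mathsf{Comp}(\mathsf{param},\rho,x_b)$ and sends $x_0$. The sender, on input $m_0,m_1\in\{0,1\}^{\ell(\kappa)}$ and once a word $x_0\in\mathcal X$ has arrived (other strings are ignored), sets $x_1=\mathsf{Comp}(\mathsf{param},\rho,x_0)$, draws, for $i=0,1$, $\mathsf{hk}_i\leftarrow\mathsf{HashKG}(\mathsf{param})$, $\mathsf{hp}_i\leftarrow\mathsf{ProjKG}(\mathsf{hk}_i,x_i)$, $H_i\leftarrow\mathsf{Hash}(\mathsf{hk}_i,x_i)$, and sends $c_i=(H_i\oplus m_i,\mathsf{hp}_i)$, $i=0,1$. The receiver outputs $\mathsf{ProjHash}(c_{b,1},x_b,w)\oplus c_{b,0}$. **Ideal functionality $\mathcal F_{OT}$.** It stores $(m_0,m_1)$ from the sender and $b$ from the receiver (the adversary sees that a record was made, not its content). On $(\mathsf{answer})$ from the adversary, if both records exist, it sends $m_b$ to the receiver, informs the adversary and halts; otherwise it does nothing. **Executions.** One session is executed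 with an efficient environment and an efficient adversary; the set of corrupted parties is fixed in advance, and the adversary acts for the corrupted parties. The environment gives inputs to honest parties, gets their outputs, and exchanges messages with the adversary, in polynomially many activations; in the end it outputs a bit. After an honest party has processed its input the environment is activated again. The adversary sees $\mathsf{crs}$ and all flows of honest parties and decides when (and whether) flows are delivered; links between honest parties are authenticated. In the ideal execution honest parties forward inputs to and outputs from $\mathcal F_{OT}$, and there is no CRS. **Theorem.** For every SPHFwG the protocol UC-realizes $\mathcal F_{OT}$ in the $\mathcal F_{CRS}$-hybrid model with static corruptions: for every set of corrupted parties and every efficient adversary $\mathcal A$ there is an efficient simulator $\mathcal S$ such that for every efficient environment $\mathcal E$ the probabilities that $\mathcal E$ outputs $1$ in the execution of the protocol with $\mathcal A$ and in the ideal execution of $\mathcal F_{OT}$ with $\mathcal S$ differ by a negligible function of $\kappa$. -/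

import Mathlib

open Filter Asymptotics

noncomputable section

namespace GreyOT

/-! ## Probabilistic circuits and polynomial time -/

/-- Bit strings of length `n`. -/
abbrev Bits (n : ℕ) : Type := Fin n → Bool

/-- Bitwise exclusive or. -/
def xorBits {n : ℕ} (a b : Bits n) : Bits n := fun i => xor (a i) (b i)

/-- Probabilistic Boolean circuits with input wires `α` and output wires `β`, as straight-line
programs: `nand i j C` puts the NAND of the wires `i` and `j` on a new wire `none` and goes on
with `C`; `coin C` puts a fresh fair coin on a new wire `none` and goes on with `C`;
`out f` stops, and the output wire `j` carries the value of the wire `f j`. -/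
inductive Circ (β : Type) : Type → Type 1
  | out {α : Type} (f : β → α) : Circ β α
  | nand {α : Type} (i j : α) (C : Circ β (Option α)) : Circ β α
  | coin {α : Type} (C : Circ β (Option α)) : Circ β α

/-- The number of gates. -/
def Circ.size {β : Type} : {α : Type} → Circ β α → ℕ
  | _, .out _ => 0
  | _, .nand _ _ C => C.size + 1
  | _, .coin C => C.size + 1

/-- The distribution of the output of a circuit on a given input. -/
def Circ.eval {β : Type} : {α : Type} → Circ β α → (α → Bool) → PMF (β → Bool)
  | _, .out f, v => PMF.pure (fun j => v (f j))
  | _, .nand i j C, v => C.eval (fun o => o.elim (!(v i && v j)) v)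
  | _, .coin C, v => (PMF.uniformOfFintype Bool).bind fun c => C.eval (fun o => o.elim c v)

/-- An injective fixed-length binary encoding of a type, with bit positions `Ix`. -/
class BitCode (A : Type) : Type 1 where
  Ix : Type
  fin : Fintype Ix
  enc : A → Ix → Bool
  inj : Function.Injective enc

/-- The length of the encoding. -/
def codeLen (A : Type) [BitCode A] : ℕ := @Fintype.card (BitCode.Ix A) BitCode.fin

instance : BitCode Bool where
  Ix := Unit
  fin := inferInstance
  enc b := fun _ => b
  inj := fun _ _ h => congrFun h ()

instance (n : ℕ) : BitCode (Bits n) where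
  Ix := Fin n
  fin := inferInstance
  enc v := v
  inj := fun _ _ h => h

instance (A B : Type) [BitCode A] [BitCode B] : BitCode (A × B) where
  Ix := BitCode.Ix A ⊕ BitCode.Ix B
  fin := @instFintypeSum _ _ BitCode.fin BitCode.fin
  enc p := Sum.elim (BitCode.enc p.1) (BitCode.enc p.2)
  inj := by
    intro p q h
    refine Prod.ext (BitCode.inj ?_) (BitCode.inj ?_)
    · funext i; exact congrFun h (Sum.inl i)
    · funext i; exact congrFun h (Sum.inr i)

instance (A : Type) [BitCode A] : BitCode (Option A) where
  Ix := Option (BitCode.Ix A)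
  fin := @instFintypeOption _ BitCode.fin
  enc
    | none => fun _ => false
    | some a => fun o => o.elim true (BitCode.enc a)
  inj := by
    rintro (_ | a) (_ | b) h
    · rfl
    · simpa using congrFun h none
    · simpa using congrFun h none
    · refine congrArg some (BitCode.inj ?_)
      funext i; exact congrFun h (some i)

instance (A B : Type) [BitCode A] [BitCode B] : BitCode (A ⊕ B) where
  Ix := Option (BitCode.Ix A ⊕ BitCode.Ix B)
  fin := @instFintypeOption _ (@instFintypeSum _ _ BitCode.fin BitCode.fin)
  enc
    | .inl a => fun o => o.elim false (Sum.elim (BitCode.enc a) (fun _ => false))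
    | .inr b => fun o => o.elim true (Sum.elim (fun _ => false) (BitCode.enc b))
  inj := by
    rintro (a | a) (b | b) h
    · refine congrArg Sum.inl (BitCode.inj ?_)
      funext i; exact congrFun h (some (Sum.inl i))
    · simpa using congrFun h none
    · simpa using congrFun h none
    · refine congrArg Sum.inr (BitCode.inj ?_)
      funext i; exact congrFun h (some (Sum.inr i))

/-- Polynomially bounded functions of the security parameter. -/
def PolyBdd (f : ℕ → ℕ) : Prop := ∃ p : Polynomial ℕ, ∀ κ, f κ ≤ p.eval κ

/-- `f` is computed in (non-uniform) probabilistic polynomial time: by a family of probabilistic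
circuits whose size (gates, input wires and output wires) is polynomial in `κ`. -/
def PolyTime {A B : ℕ → Type} [∀ κ, BitCode (A κ)] [∀ κ, BitCode (B κ)]
    (f : ∀ κ, A κ → PMF (B κ)) : Prop :=
  ∃ p : Polynomial ℕ, ∀ κ, ∃ C : Circ (BitCode.Ix (B κ)) (BitCode.Ix (A κ)),
    C.size + codeLen (A κ) + codeLen (B κ) ≤ p.eval κ ∧
    ∀ a, C.eval (BitCode.enc a) = (f κ a).map BitCode.enc

/-- A negligible function of the security parameter. -/
def Negl (ε : ℕ → ℝ) : Prop := SuperpolynomialDecay atTop (fun κ : ℕ => (κ : ℝ)) ε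

/-- The probability of an event. -/
def prob {A : Type} (p : PMF A) (s : Set A) : ℝ := (p.toOuterMeasure s).toReal

/-- The statistical (total variation) distance. -/
def statDist {A : Type} [Fintype A] (p q : PMF A) : ℝ :=
  (1 / 2) * ∑ a, |(p a).toReal - (q a).toReal|

/-- Computational indistinguishability against non-uniform polynomial-time distinguishers. -/
def CompIndist {A : ℕ → Type} [∀ κ, BitCode (A κ)] (p q : ∀ κ, PMF (A κ)) : Prop :=
  ∀ D : ∀ κ, A κ → PMF Bool, PolyTime D →
    Negl fun κ => |prob ((p κ).bind (D κ)) {true} - prob ((q κ).bind (D κ)) {true}|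

/-! ## Smooth projective hash functions with grey zone -/

/-- The algorithms and languages of a smooth projective hash function with grey zone. A set that
is only sampled from is given by its sampler; a CRS component that comes with a trapdoor is
sampled together with the trapdoor. The choice of `ρ` may depend on `σ`. -/
structure SPHFwG where
  /-- lengths of `σ`, `ρ`, `param`, words, witnesses, hashing keys, projection keys,
  hash values, and of the trapdoor of `σ` -/
  nS : ℕ → ℕ
  nR : ℕ → ℕ
  nPar : ℕ → ℕ
  nX : ℕ → ℕ
  nW : ℕ → ℕ
  nHk : ℕ → ℕ
  nHp : ℕ → ℕ
  nV : ℕ → ℕ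
  nTd : ℕ → ℕ
  /-- `σ ← S₀` -/
  sampS0 : ∀ κ, PMF (Bits (nS κ))
  /-- `σ ← S₁` with its trapdoor -/
  sampS1 : ∀ κ, PMF (Bits (nS κ) × Bits (nTd κ))
  /-- `ρ ← R₀` -/
  sampR0 : ∀ κ, Bits (nS κ) → PMF (Bits (nR κ))
  /-- `ρ ← R₁` with its trapdoor `((x, w), (x', w'))` -/
  sampR1 : ∀ κ, Bits (nS κ) →
    PMF (Bits (nR κ) × (Bits (nX κ) × Bits (nW κ)) × (Bits (nX κ) × Bits (nW κ)))
  /-- `ρ ← R₁'` with its trapdoor `(x, x')` -/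
  sampR1' : ∀ κ, Bits (nS κ) → PMF (Bits (nR κ) × Bits (nX κ) × Bits (nX κ))
  /-- `param` from the explicit random tape `(σ, ρ)` -/
  setup : ∀ κ, Bits (nS κ) → Bits (nR κ) → Bits (nPar κ)
  /-- the membership test for the set of words `𝒳` -/
  isWord : ∀ κ, Bits (nPar κ) → Bits (nX κ) → Bool
  /-- `Rel κ param x w`: `w` is a witness of `x ∈ ℒ` -/
  Rel : ∀ κ, Bits (nPar κ) → Bits (nX κ) → Bits (nW κ) → Prop
  /-- the language `ℒ'` -/
  L' : ∀ κ, Bits (nPar κ) → Set (Bits (nX κ))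
  hashKG : ∀ κ, Bits (nPar κ) → PMF (Bits (nHk κ))
  projKG : ∀ κ, Bits (nPar κ) → Bits (nHk κ) → Bits (nX κ) → PMF (Bits (nHp κ))
  hash : ∀ κ, Bits (nPar κ) → Bits (nHk κ) → Bits (nX κ) → PMF (Bits (nV κ))
  projHash : ∀ κ, Bits (nPar κ) → Bits (nHp κ) → Bits (nX κ) → Bits (nW κ) → PMF (Bits (nV κ))
  /-- a random word of `ℒ` with a witness -/
  wordGenL : ∀ κ, Bits (nPar κ) → PMF (Bits (nX κ) × Bits (nW κ))
  /-- a random word of `𝒳` -/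
  wordGenX : ∀ κ, Bits (nPar κ) → PMF (Bits (nX κ))
  /-- tests membership in `ℒ'`, with the trapdoor of `σ` -/
  wordTest : ∀ κ, Bits (nTd κ) → Bits (nX κ) → Bool
  complement : ∀ κ, Bits (nPar κ) → Bits (nR κ) → Bits (nX κ) → Bits (nX κ)

namespace SPHFwG

variable (P : SPHFwG)

/-- The set of words `𝒳`. -/
def X (κ : ℕ) (par : Bits (P.nPar κ)) : Finset (Bits (P.nX κ)) :=
  Finset.univ.filter fun x => P.isWord κ par x = true

/-- The language `ℒ` of the words that have a witness. -/
def L (κ : ℕ) (par : Bits (P.nPar κ)) : Set (Bits (P.nX κ)) :=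
  {x | x ∈ P.X κ par ∧ ∃ w, P.Rel κ par x w}

/-- `σ ∈ S₀ ∪ S₁` -/
def InS (κ : ℕ) (σ : Bits (P.nS κ)) : Prop :=
  σ ∈ (P.sampS0 κ).support ∨ ∃ td, (σ, td) ∈ (P.sampS1 κ).support

/-- `ρ ∈ R₀ ∪ R₁ ∪ R₁'` -/
def InR (κ : ℕ) (σ : Bits (P.nS κ)) (ρ : Bits (P.nR κ)) : Prop :=
  ρ ∈ (P.sampR0 κ σ).support ∨ (∃ td, (ρ, td) ∈ (P.sampR1 κ σ).support) ∨
    ∃ td, (ρ, td) ∈ (P.sampR1' κ σ).support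

/-- The common reference string of the normal use, `(σ, ρ) ← S₀ × R₀`. -/
def crs00 (κ : ℕ) : PMF (Bits (P.nS κ) × Bits (P.nR κ)) := do
  let σ ← P.sampS0 κ
  let ρ ← P.sampR0 κ σ
  return (σ, ρ)

/-- `(σ, ρ) ← S₁ × R₀`, without trapdoor -/
def crs10 (κ : ℕ) : PMF (Bits (P.nS κ) × Bits (P.nR κ)) := do
  let s ← P.sampS1 κ
  let ρ ← P.sampR0 κ s.1
  return (s.1, ρ)

/-- `(σ, ρ) ← S₀ × R₁`, without trapdoor -/
def crs01 (κ : ℕ) : PMF (Bits (P.nS κ) × Bits (P.nR κ)) := do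
  let σ ← P.sampS0 κ
  let r ← P.sampR1 κ σ
  return (σ, r.1)

/-- `(σ, ρ) ← S₀ × R₁'`, without trapdoor -/
def crs01' (κ : ℕ) : PMF (Bits (P.nS κ) × Bits (P.nR κ)) := do
  let σ ← P.sampS0 κ
  let r ← P.sampR1' κ σ
  return (σ, r.1)

/-- All algorithms run in probabilistic polynomial time. -/
structure Efficient : Prop where
  sampS0 : PolyTime (A := fun _ => Bits 0) fun κ _ => P.sampS0 κ
  sampS1 : PolyTime (A := fun _ => Bits 0) fun κ _ => P.sampS1 κ
  sampR0 : PolyTime P.sampR0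
  sampR1 : PolyTime P.sampR1
  sampR1' : PolyTime P.sampR1'
  setup : PolyTime fun κ (a : Bits (P.nS κ) × Bits (P.nR κ)) => PMF.pure (P.setup κ a.1 a.2)
  isWord : PolyTime fun κ (a : Bits (P.nPar κ) × Bits (P.nX κ)) => PMF.pure (P.isWord κ a.1 a.2)
  hashKG : PolyTime P.hashKG
  projKG : PolyTime fun κ (a : Bits (P.nPar κ) × Bits (P.nHk κ) × Bits (P.nX κ)) =>
    P.projKG κ a.1 a.2.1 a.2.2
  hash : PolyTime fun κ (a : Bits (P.nPar κ) × Bits (P.nHk κ) × Bits (P.nX κ)) =>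
    P.hash κ a.1 a.2.1 a.2.2
  projHash : PolyTime fun κ
      (a : Bits (P.nPar κ) × Bits (P.nHp κ) × Bits (P.nX κ) × Bits (P.nW κ)) =>
    P.projHash κ a.1 a.2.1 a.2.2.1 a.2.2.2
  wordGenL : PolyTime P.wordGenL
  wordGenX : PolyTime P.wordGenX
  wordTest : PolyTime fun κ (a : Bits (P.nTd κ) × Bits (P.nX κ)) =>
    PMF.pure (P.wordTest κ a.1 a.2)
  complement : PolyTime fun κ (a : Bits (P.nPar κ) × Bits (P.nR κ) × Bits (P.nX κ)) =>
    PMF.pure (P.complement κ a.1 a.2.1 a.2.2)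

/-- For every outcome of the setup, `ℒ, ℒ' ⊆ 𝒳` are disjoint. -/
def Languages : Prop :=
  ∀ κ σ ρ, P.InS κ σ → P.InR κ σ ρ → ∀ x, x ∈ P.L' κ (P.setup κ σ ρ) →
    x ∈ P.X κ (P.setup κ σ ρ) ∧ x ∉ P.L κ (P.setup κ σ ρ)

/-- `wordGenL` returns words of `ℒ` with witnesses, and `wordGenX` is uniform on `𝒳`,
up to a negligible statistical distance. -/
def WordGen : Prop :=
  (∀ κ σ ρ, P.InS κ σ → P.InR κ σ ρ → ∀ xw ∈ (P.wordGenL κ (P.setup κ σ ρ)).support,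
    xw.1 ∈ P.X κ (P.setup κ σ ρ) ∧ P.Rel κ (P.setup κ σ ρ) xw.1 xw.2) ∧
  ∃ ε, Negl ε ∧ ∀ κ σ ρ, P.InS κ σ → P.InR κ σ ρ →
    ∃ h : (P.X κ (P.setup κ σ ρ)).Nonempty,
      statDist (P.wordGenX κ (P.setup κ σ ρ)) (PMF.uniformOfFinset _ h) ≤ ε κ

/-- The hash value of `x`, and its recomputation from the projection key and a witness. -/
def bothHashes (κ : ℕ) (par : Bits (P.nPar κ)) (x : Bits (P.nX κ)) (w : Bits (P.nW κ)) :
    PMF (Bits (P.nV κ) × Bits (P.nV κ)) := do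
  let hk ← P.hashKG κ par
  let hp ← P.projKG κ par hk x
  let H ← P.hash κ par hk x
  let H' ← P.projHash κ par hp x w
  return (H, H')

def Correctness : Prop :=
  ∃ ε, Negl ε ∧ ∀ κ σ ρ, P.InS κ σ → P.InR κ σ ρ →
    ∀ x w, x ∈ P.X κ (P.setup κ σ ρ) → P.Rel κ (P.setup κ σ ρ) x w →
      prob (P.bothHashes κ (P.setup κ σ ρ) x w) {H | H.1 ≠ H.2} ≤ ε κ

/-- The projection key with the hash value of `x`. -/
def keyAndHash (κ : ℕ) (par : Bits (P.nPar κ)) (x : Bits (P.nX κ)) :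
    PMF (Bits (P.nHp κ) × Bits (P.nV κ)) := do
  let hk ← P.hashKG κ par
  let hp ← P.projKG κ par hk x
  let H ← P.hash κ par hk x
  return (hp, H)

/-- The projection key with an independent uniform value. -/
def keyAndRandom (κ : ℕ) (par : Bits (P.nPar κ)) (x : Bits (P.nX κ)) :
    PMF (Bits (P.nHp κ) × Bits (P.nV κ)) := do
  let hk ← P.hashKG κ par
  let hp ← P.projKG κ par hk x
  let v ← PMF.uniformOfFintype (Bits (P.nV κ))
  return (hp, v)

def Smoothness : Prop :=
  ∃ ε, Negl ε ∧ ∀ κ σ ρ, P.InS κ σ → P.InR κ σ ρ → ∀ x ∈ P.L' κ (P.setup κ σ ρ),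
    statDist (P.keyAndHash κ (P.setup κ σ ρ) x) (P.keyAndRandom κ (P.setup κ σ ρ) x) ≤ ε κ

/-- With the trapdoor of `σ ∈ S₁`, `wordTest` decides `ℒ'`. -/
def TrapdoorTest : Prop :=
  ∀ κ σ td ρ, (σ, td) ∈ (P.sampS1 κ).support → P.InR κ σ ρ →
    ∀ x ∈ P.X κ (P.setup κ σ ρ), P.wordTest κ td x = true ↔ x ∈ P.L' κ (P.setup κ σ ρ)

/-- A common reference string of the normal use, with a random word of `ℒ` and its witness. -/
def crsWithL (κ : ℕ) :
    PMF ((Bits (P.nS κ) × Bits (P.nR κ)) × Bits (P.nX κ)) := do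
  let crs ← P.crs00 κ
  let xw ← P.wordGenL κ (P.setup κ crs.1 crs.2)
  return (crs, xw.1)

/-- A common reference string of the normal use, with a random word of `𝒳`. -/
def crsWithX (κ : ℕ) :
    PMF ((Bits (P.nS κ) × Bits (P.nR κ)) × Bits (P.nX κ)) := do
  let crs ← P.crs00 κ
  let x ← P.wordGenX κ (P.setup κ crs.1 crs.2)
  return (crs, x)

def WordIndistinguishability : Prop := CompIndist P.crsWithL P.crsWithX

/-- For `ρ ∈ R₀`, `complement` is an involution of `𝒳`. -/
def Complement : Prop :=
  ∀ κ σ ρ, P.InS κ σ → ρ ∈ (P.sampR0 κ σ).support → ∀ x ∈ P.X κ (P.setup κ σ ρ),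
    P.complement κ (P.setup κ σ ρ) ρ x ∈ P.X κ (P.setup κ σ ρ) ∧
    P.complement κ (P.setup κ σ ρ) ρ (P.complement κ (P.setup κ σ ρ) ρ x) = x

/-- The attempt of `D`, knowing the trapdoor of `σ`, to find two complementary words. -/
def decompose (D : ∀ κ, Bits (P.nS κ) × Bits (P.nTd κ) × Bits (P.nR κ) →
      PMF (Bits (P.nX κ) × Bits (P.nX κ))) (κ : ℕ) :
    PMF ((Bits (P.nS κ) × Bits (P.nR κ)) × Bits (P.nX κ) × Bits (P.nX κ)) := do
  let s ← P.sampS1 κ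
  let ρ ← P.sampR0 κ s.1
  let xy ← D κ (s.1, s.2, ρ)
  return ((s.1, ρ), xy)

def DecompositionIntractability : Prop :=
  ∀ D : ∀ κ, Bits (P.nS κ) × Bits (P.nTd κ) × Bits (P.nR κ) →
      PMF (Bits (P.nX κ) × Bits (P.nX κ)),
    PolyTime D →
    Negl fun κ => prob (P.decompose D κ)
      {t | let par := P.setup κ t.1.1 t.1.2
           (t.2.1 ∈ P.X κ par ∧ t.2.1 ∉ P.L' κ par) ∧
           (t.2.2 ∈ P.X κ par ∧ t.2.2 ∉ P.L' κ par) ∧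
           t.2.2 = P.complement κ par t.1.2 t.2.1}

def CRSIndistinguishability : Prop :=
  CompIndist P.crs00 P.crs10 ∧ CompIndist P.crs00 P.crs01 ∧ CompIndist P.crs00 P.crs01'

/-- `(σ, ρ) ← S₀ × R₁` with the part `(x, w)` of the trapdoor of `ρ`. -/
def crsTrapFst (κ : ℕ) :
    PMF ((Bits (P.nS κ) × Bits (P.nR κ)) × Bits (P.nX κ) × Bits (P.nW κ)) := do
  let σ ← P.sampS0 κ
  let r ← P.sampR1 κ σ
  return ((σ, r.1), r.2.1)

/-- `(σ, ρ) ← S₀ × R₁` with the part `(x', w')` of the trapdoor of `ρ`. -/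
def crsTrapSnd (κ : ℕ) :
    PMF ((Bits (P.nS κ) × Bits (P.nR κ)) × Bits (P.nX κ) × Bits (P.nW κ)) := do
  let σ ← P.sampS0 κ
  let r ← P.sampR1 κ σ
  return ((σ, r.1), r.2.2)

/-- `(σ, ρ) ← S₀ × R₁` with an independent random word of `ℒ` and its witness. -/
def crsFresh (κ : ℕ) :
    PMF ((Bits (P.nS κ) × Bits (P.nR κ)) × Bits (P.nX κ) × Bits (P.nW κ)) := do
  let crs ← P.crs01 κ
  let xw ← P.wordGenL κ (P.setup κ crs.1 crs.2)
  return (crs, xw)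

/-- The trapdoor of `ρ ∈ R₁` consists of complementary words `x, x'` of `ℒ` with witnesses, each
of them random in `ℒ` even when the common reference string is known. (Computational
indistinguishability from a random word is enough.) -/
def TrapdoorR1 : Prop :=
  (∀ κ σ, P.InS κ σ → ∀ r ∈ (P.sampR1 κ σ).support,
    let par := P.setup κ σ r.1
    (r.2.1.1 ∈ P.X κ par ∧ P.Rel κ par r.2.1.1 r.2.1.2) ∧
    (r.2.2.1 ∈ P.X κ par ∧ P.Rel κ par r.2.2.1 r.2.2.2) ∧
    r.2.2.1 = P.complement κ par r.1 r.2.1.1) ∧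
  CompIndist P.crsTrapFst P.crsFresh ∧ CompIndist P.crsTrapSnd P.crsFresh

/-- The trapdoor of `ρ ∈ R₁'` consists of complementary words of `ℒ'`. -/
def TrapdoorR1' : Prop :=
  ∀ κ σ, P.InS κ σ → ∀ r ∈ (P.sampR1' κ σ).support,
    let par := P.setup κ σ r.1
    r.2.1 ∈ P.L' κ par ∧ r.2.2 ∈ P.L' κ par ∧ r.2.2 = P.complement κ par r.1 r.2.1

/-- The properties required of a smooth projective hash function with grey zone. -/
structure IsSPHFwG : Prop where
  efficient : P.Efficient
  languages : P.Languages
  wordGen : P.WordGen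
  correctness : P.Correctness
  smoothness : P.Smoothness
  trapdoorTest : P.TrapdoorTest
  wordIndistinguishability : P.WordIndistinguishability
  complement : P.Complement
  decompositionIntractability : P.DecompositionIntractability
  crsIndistinguishability : P.CRSIndistinguishability
  trapdoorR1 : P.TrapdoorR1
  trapdoorR1' : P.TrapdoorR1'

end SPHFwG

/-! ## Universal composability -/

inductive Party
  | receiver
  | sender

/-- Everything in an execution but the environment and the adversary: the honest parties, the
ideal functionality and the network, for an oblivious transfer of strings of length `ℓ κ`.
The environment hands inputs to the parties and gets the outputs of the receiver. At each
activation the adversary sees `view` of the current state. It can then interfere by `act`, in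
reaction to which an honest receiver may give an output to the environment. -/
structure System (ℓ : ℕ → ℕ) where
  St : ℕ → Type
  View : ℕ → Type
  Act : ℕ → Type
  viewCode : ∀ κ, BitCode (View κ)
  actCode : ∀ κ, BitCode (Act κ)
  start : ∀ κ, PMF (St κ)
  receiverInput : ∀ κ, Bool → St κ → PMF (St κ)
  senderInput : ∀ κ, Bits (ℓ κ) × Bits (ℓ κ) → St κ → PMF (St κ)
  view : ∀ κ, St κ → View κ
  act : ∀ κ, Act κ → St κ → PMF (St κ × Option (Bits (ℓ κ)))

attribute [instance] System.viewCode System.actCode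

/-- A polynomial-time adversary (or simulator) that attacks the system `W` and exchanges messages
of length `n κ` with the environment. An activation starts with a message `some z` from the
environment, or with `none` if the adversary has just acted on the system. It ends with
`some (inl z)`, a message to the environment, with `some (inr a)`, an action on the system, or
with `none`, which returns the control to the environment without a message. -/
structure Adversary {ℓ : ℕ → ℕ} (W : System ℓ) (n : ℕ → ℕ) where
  St : ℕ → Type
  code : ∀ κ, BitCode (St κ)
  start : ∀ κ, St κ
  step : ∀ κ, St κ × Option (Bits (n κ)) × W.View κ →
    PMF (St κ × Option (Bits (n κ) ⊕ W.Act κ))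
  step_poly : PolyTime step
  /-- the largest number of activations in reaction to one message of the environment -/
  fuel : ℕ → ℕ
  fuel_poly : PolyBdd fuel

/-- A polynomial-time environment. When activated, it gets an output of the receiver (`inl`), a
message of the adversary (`inr`), or nothing. It then hands an input to the receiver or to the
sender, or a message to the adversary. After `rounds κ` activations it outputs a bit. -/
structure Environment (ℓ n : ℕ → ℕ) where
  St : ℕ → Type
  code : ∀ κ, BitCode (St κ)
  start : ∀ κ, St κ
  step : ∀ κ, St κ × Option (Bits (ℓ κ) ⊕ Bits (n κ)) →
    PMF (St κ × (Bool ⊕ (Bits (ℓ κ) × Bits (ℓ κ)) ⊕ Bits (n κ)))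
  step_poly : PolyTime step
  guess : ∀ κ, St κ × Option (Bits (ℓ κ) ⊕ Bits (n κ)) → PMF Bool
  guess_poly : PolyTime guess
  rounds : ℕ → ℕ
  rounds_poly : PolyBdd rounds

section Execution

variable {ℓ n : ℕ → ℕ} {W : System ℓ}

/-- The adversary acts on the system, until it returns the control to the environment, an
honest receiver gives an output to the environment, or the fuel is used up. -/
def advPhase (A : Adversary W n) (κ : ℕ) :
    ℕ → A.St κ → W.St κ → Option (Bits (n κ)) →
      PMF (A.St κ × W.St κ × Option (Bits (ℓ κ) ⊕ Bits (n κ)))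
  | 0, a, s, _ => PMF.pure (a, s, none)
  | t + 1, a, s, z =>
    (A.step κ (a, z, W.view κ s)).bind fun r =>
      match r.2 with
      | none => PMF.pure (r.1, s, none)
      | some (.inl z') => PMF.pure (r.1, s, some (.inr z'))
      | some (.inr q) =>
        (W.act κ q s).bind fun u =>
          match u.2 with
          | some m => PMF.pure (r.1, u.1, some (.inl m))
          | none => advPhase A κ t r.1 u.1 none

/-- `t` more activations of the environment, and its output. -/
def execLoop (A : Adversary W n) (E : Environment ℓ n) (κ : ℕ) :
    ℕ → E.St κ → A.St κ → W.St κ → Option (Bits (ℓ κ) ⊕ Bits (n κ)) → PMF Bool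
  | 0, e, _, _, i => E.guess κ (e, i)
  | t + 1, e, a, s, i =>
    (E.step κ (e, i)).bind fun r =>
      match r.2 with
      | .inl b => (W.receiverInput κ b s).bind fun s' => execLoop A E κ t r.1 a s' none
      | .inr (.inl m) => (W.senderInput κ m s).bind fun s' => execLoop A E κ t r.1 a s' none
      | .inr (.inr z) =>
        (advPhase A κ (A.fuel κ) a s (some z)).bind fun u =>
          execLoop A E κ t r.1 u.1 u.2.1 u.2.2

/-- The output of the environment `E` in an execution of the system `W` with adversary `A`. -/
def exec (W : System ℓ) (A : Adversary W n) (E : Environment ℓ n) (κ : ℕ) : PMF Bool :=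
  (W.start κ).bind fun s => execLoop A E κ (E.rounds κ) (E.start κ) (A.start κ) s none

end Execution

/-- For every adversary against `W` there is a simulator against `I` such that no environment
can tell the execution of `W` with the adversary from that of `I` with the simulator. -/
def UCEmulates {ℓ : ℕ → ℕ} (W I : System ℓ) : Prop :=
  ∀ (n : ℕ → ℕ) (A : Adversary W n), ∃ S : Adversary I n, ∀ E : Environment ℓ n,
    Negl fun κ => |prob (exec W A E κ) {true} - prob (exec I S E κ) {true}|

/-! ## The ideal functionality for oblivious transfer -/

/-- The state of the functionality: the records of the receiver and of the sender, whether it has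
halted, and the message sent to the receiver, if the latter is corrupted. -/
structure OTState (ℓ : ℕ) where
  choice : Option Bool
  messages : Option (Bits ℓ × Bits ℓ)
  halted : Bool
  leaked : Option (Bits ℓ)

/-- What the adversary can send: `(receiver, b)` on behalf of a corrupted receiver,
`(sender, m₀, m₁)` on behalf of a corrupted sender, and `(answer)`. -/
inductive OTAct (ℓ : ℕ)
  | receiver (b : Bool)
  | sender (m : Bits ℓ × Bits ℓ)
  | answer

def OTAct.toSum {ℓ : ℕ} : OTAct ℓ → Option (Bool ⊕ (Bits ℓ × Bits ℓ))
  | .receiver b => some (.inl b)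
  | .sender m => some (.inr m)
  | .answer => none

instance (ℓ : ℕ) : BitCode (OTAct ℓ) where
  Ix := BitCode.Ix (Option (Bool ⊕ (Bits ℓ × Bits ℓ)))
  fin := BitCode.fin
  enc q := BitCode.enc q.toSum
  inj := by
    intro p q h
    have h' := BitCode.inj h
    cases p <;> cases q <;> simp_all [OTAct.toSum]

def OTState.setChoice {ℓ : ℕ} (b : Bool) (s : OTState ℓ) : OTState ℓ :=
  match s.choice with
  | none => { s with choice := some b }
  | some _ => s

def OTState.setMessages {ℓ : ℕ} (m : Bits ℓ × Bits ℓ) (s : OTState ℓ) : OTState ℓ :=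
  match s.messages with
  | none => { s with messages := some m }
  | some _ => s

/-- On `(answer)`, if both records exist, `m_b` is sent to the receiver (hence to the adversary,
if the receiver is corrupted, and otherwise to the environment), and the functionality halts. -/
def OTState.answer {ℓ : ℕ} (corrupted : Party → Bool) (s : OTState ℓ) :
    OTState ℓ × Option (Bits ℓ) :=
  match s.halted, s.choice, s.messages with
  | false, some b, some m =>
    let mb := if b then m.2 else m.1
    if corrupted .receiver then ({ s with halted := true, leaked := some mb }, none)
    else ({ s with halted := true }, some mb)
  | _, _, _ => (s, none)

/-- The functionality with dummy honest parties, which forward their inputs and outputs. The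
adversary sees which of the two records exist, but not their contents, and whether the
functionality has halted. -/
def idealOT (ℓ : ℕ → ℕ) (corrupted : Party → Bool) : System ℓ where
  St κ := OTState (ℓ κ)
  View κ := Bool × Bool × Bool × Option (Bits (ℓ κ))
  Act κ := OTAct (ℓ κ)
  viewCode _ := inferInstance
  actCode _ := inferInstance
  start _ := PMF.pure ⟨none, none, false, none⟩
  receiverInput _ b s := PMF.pure (if corrupted .receiver then s else s.setChoice b)
  senderInput _ m s := PMF.pure (if corrupted .sender then s else s.setMessages m)
  view _ s := (s.choice.isSome, s.messages.isSome, s.halted, s.leaked)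
  act _ q s :=
    match q with
    | .receiver b => PMF.pure (if corrupted .receiver then s.setChoice b else s, none)
    | .sender m => PMF.pure (if corrupted .sender then s.setMessages m else s, none)
    | .answer => PMF.pure (s.answer corrupted)

/-! ## The protocol -/

namespace SPHFwG

variable (P : SPHFwG)

/-- One of the two components `(H ⊕ m, hp)` of the message of the sender. -/
abbrev Cipher (κ : ℕ) : Type := Bits (P.nV κ) × Bits (P.nHp κ)

/-- The state of the protocol execution: the reference string; the receiver's choice bit `b` with
`x_b` and its witness; the flow `x₀` sent by an honest receiver; whether the receiver has
finished; the input of the sender; the word `x₀` that has reached the sender; the flow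
`(c₀, c₁)` sent by an honest sender. -/
structure ProtState (κ : ℕ) where
  crs : Bits (P.nS κ) × Bits (P.nR κ)
  chosen : Option (Bool × Bits (P.nX κ) × Bits (P.nW κ))
  flow1 : Option (Bits (P.nX κ))
  finished : Bool
  messages : Option (Bits (P.nV κ) × Bits (P.nV κ))
  received : Option (Bits (P.nX κ))
  flow2 : Option (P.Cipher κ × P.Cipher κ)

/-- `param` -/
def ProtState.par {P : SPHFwG} {κ : ℕ} (s : P.ProtState κ) : Bits (P.nPar κ) :=
  P.setup κ s.crs.1 s.crs.2

/-- The adversary delivers a first flow to the sender, or a second flow to the receiver. Links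
between honest parties are authenticated: there the content is that of the flow which was really
sent, and the argument is ignored. -/
inductive ProtAct (κ : ℕ)
  | deliver1 (x : Bits (P.nX κ))
  | deliver2 (c : P.Cipher κ × P.Cipher κ)

def ProtAct.toSum {P : SPHFwG} {κ : ℕ} :
    P.ProtAct κ → Bits (P.nX κ) ⊕ (P.Cipher κ × P.Cipher κ)
  | .deliver1 x => .inl x
  | .deliver2 c => .inr c

instance (κ : ℕ) : BitCode (P.ProtAct κ) where
  Ix := BitCode.Ix (Bits (P.nX κ) ⊕ (P.Cipher κ × P.Cipher κ))
  fin := BitCode.fin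
  enc q := BitCode.enc q.toSum
  inj := by
    intro p q h
    have h' := BitCode.inj h
    cases p <;> cases q <;> simp_all [ProtAct.toSum]

/-- `hk ← HashKG(param)`, `hp ← ProjKG(hk, x)`, `H ← Hash(hk, x)`; return `(H ⊕ m, hp)`. -/
def encrypt (κ : ℕ) (par : Bits (P.nPar κ)) (x : Bits (P.nX κ)) (m : Bits (P.nV κ)) :
    PMF (P.Cipher κ) := do
  let hk ← P.hashKG κ par
  let hp ← P.projKG κ par hk x
  let H ← P.hash κ par hk x
  return (xorBits H m, hp)

/-- `H' ← ProjHash(c.2, x, w)`; return `H' ⊕ c.1`. -/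
def decrypt (κ : ℕ) (par : Bits (P.nPar κ)) (x : Bits (P.nX κ)) (w : Bits (P.nW κ))
    (c : P.Cipher κ) : PMF (Bits (P.nV κ)) := do
  let H' ← P.projHash κ par c.2 x w
  return xorBits H' c.1

/-- The honest receiver gets its input `b` (only the first one counts), and sends `x₀`. -/
def receiverStart (κ : ℕ) (b : Bool) (s : P.ProtState κ) : PMF (P.ProtState κ) :=
  match s.chosen with
  | some _ => PMF.pure s
  | none => do
    let xw ← P.wordGenL κ s.par
    let x0 := if b then P.complement κ s.par s.crs.2 xw.1 else xw.1
    return { s with chosen := some (b, xw), flow1 := some x0 }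

/-- The honest sender sends `(c₀, c₁)` once, as soon as it has its input and `x₀`. -/
def senderReply (κ : ℕ) (s : P.ProtState κ) : PMF (P.ProtState κ) :=
  match s.messages, s.received, s.flow2 with
  | some m, some x0, none => do
    let c0 ← P.encrypt κ s.par x0 m.1
    let c1 ← P.encrypt κ s.par (P.complement κ s.par s.crs.2 x0) m.2
    return { s with flow2 := some (c0, c1) }
  | _, _, _ => PMF.pure s

/-- The honest sender gets its input (only the first one counts). -/
def senderStart (κ : ℕ) (m : Bits (P.nV κ) × Bits (P.nV κ)) (s : P.ProtState κ) :
    PMF (P.ProtState κ) :=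
  match s.messages with
  | some _ => PMF.pure s
  | none => P.senderReply κ { s with messages := some m }

/-- The honest sender gets the first flow. Only the first word that arrives counts; strings that
are not words are ignored. -/
def senderReceive (κ : ℕ) (x : Bits (P.nX κ)) (s : P.ProtState κ) : PMF (P.ProtState κ) :=
  match s.received, P.isWord κ s.par x with
  | none, true => P.senderReply κ { s with received := some x }
  | _, _ => PMF.pure s

/-- The honest receiver gets the second flow. It ignores it before its own flow is sent;
otherwise it outputs a message and is finished. -/
def receiverFinish (κ : ℕ) (c : P.Cipher κ × P.Cipher κ) (s : P.ProtState κ) :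
    PMF (P.ProtState κ × Option (Bits (P.nV κ))) :=
  match s.chosen, s.finished with
  | some (b, x, w), false => do
    let m ← P.decrypt κ s.par x w (if b then c.2 else c.1)
    return ({ s with finished := true }, some m)
  | _, _ => PMF.pure (s, none)

/-- The oblivious transfer protocol in the hybrid model with a common reference string
`(σ, ρ) ← S₀ × R₀`, which the functionality gives to both parties and to the adversary. The
adversary sees the flows sent by honest parties, and decides when they are delivered. -/
def protocolOT (corrupted : Party → Bool) : System P.nV where
  St κ := P.ProtState κ
  View κ := (Bits (P.nS κ) × Bits (P.nR κ)) × Option (Bits (P.nX κ)) ×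
    Option (P.Cipher κ × P.Cipher κ)
  Act κ := P.ProtAct κ
  viewCode _ := inferInstance
  actCode _ := inferInstance
  start κ := (P.crs00 κ).map fun crs => ⟨crs, none, none, false, none, none, none⟩
  receiverInput κ b s := if corrupted .receiver then PMF.pure s else P.receiverStart κ b s
  senderInput κ m s := if corrupted .sender then PMF.pure s else P.senderStart κ m s
  view _ s := (s.crs, s.flow1, s.flow2)
  act κ q s :=
    match q with
    | .deliver1 x =>
      if corrupted .sender then PMF.pure (s, none)
      else match (if corrupted .receiver then some x else s.flow1) with
        | some x' => (P.senderReceive κ x' s).map fun s' => (s', none)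
        | none => PMF.pure (s, none)
    | .deliver2 c =>
      if corrupted .receiver then PMF.pure (s, none)
      else match (if corrupted .sender then some c else s.flow2) with
        | some c' => P.receiverFinish κ c' s
        | none => PMF.pure (s, none)

/-- The protocol UC-realizes the oblivious transfer functionality, with static corruptions: for
each set of corrupted parties, fixed in advance. -/
def RealizesOT : Prop :=
  ∀ corrupted : Party → Bool, UCEmulates (P.protocolOT corrupted) (idealOT P.nV corrupted)

end SPHFwG

end GreyOT

end

/-!
The choice of simulator depends on the corrupted parties; in each case the argument has three
ingredients.

* *Perfect simulation.* An execution is a Markov chain on the states of the environment, the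
  adversary and a system (`exec_eq`). A randomized map between the states of two systems that
  is compatible with all operations gives executions with the same outcome (`Intertwines.bit`), and
  likewise for a simulator that runs the adversary internally (`Simulates.bit`). The map samples the
  randomness that one side has fixed already and the other side has not, so
  values can be sampled earlier or later without effect.
* *Statistical steps.* If the operations of two systems are close outside of an absorbing set of bad
  states, then executions are close up to the probability of a bad state (`run_near`).
* *Reductions.* Whole executions are efficient (`eff_bit`, `eff_run`), hence they can be used as
  distinguishers or searchers.

*Both parties corrupted*: the simulator only has to sample the reference string.

*Receiver corrupted.* The simulator takes `σ` from `S₁`, and uses `WordTest` to see whether the word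
`x₀` sent by the adversary is in `ℒ'`. If so, it asks for `m₁` and sends a uniform value in place of
the masked `m₀`; otherwise it asks for `m₀` and sends a uniform value in place of the masked `m₁`.
By smoothness this is close to the honest reply, unless neither `x₀` nor its complement is in `ℒ'`
(`near_rcReply`); and an execution in which that happens breaks decomposition intractability
(`negl_rcBad`).

*Sender corrupted.* The simulator takes `ρ` from `R₁`, so that it has witnesses for both words and
can decrypt both messages. The two trapdoor words are indistinguishable from fresh ones separately
but not jointly. This suffices: if the values that the receiver needs are sampled in advance for both
choice bits, only one of them is used, so that the probability of an outcome is a function of the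
first value plus a function of the second one (`ChoiceSys.bit_add`, `choice_indist`). The first
trapdoor word is the complement of the second one up to negligible probability, since
`Comp` is an involution for `ρ ∈ R₀`, which is efficiently testable (`negl_compl`).

*Both parties honest.* By correctness the receiver computes the hash value of the sender
(`near_projHash`). Words of `ℒ`, uniform words, and hence complements of words of `ℒ` are
indistinguishable (`crsFlow_true_false`), so the flow of the receiver hides its bit. When `σ` is taken
from `S₁`, complements of words of `ℒ` are in `ℒ'` with overwhelming probability by decomposition
intractability (`negl_compl_L'`), and smoothness makes the hash value of such a complement uniform.
Since word and complement are interchangeable, both hash values can be replaced in turn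
(`crsFlow_keys`), after which the flow of the sender does not depend on the messages.
-/

noncomputable section

namespace GreyOT

open scoped ENNReal

/-! ### Circuits -/

/-- Renaming of the input wires. -/
def Circ.relabel {β : Type} : {α α' : Type} → Circ β α → (α → α') → Circ β α'
  | _, _, .out f, g => .out fun j => g (f j)
  | _, _, .nand i j C, g => .nand (g i) (g j) (C.relabel (Option.map g))
  | _, _, .coin C, g => .coin (C.relabel (Option.map g))

theorem Circ.size_relabel {β α α' : Type} (C : Circ β α) (g : α → α') :
    (C.relabel g).size = C.size := by
  induction C generalizing α' with
  | out f => rfl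
  | nand i j C ih => simp [relabel, size, ih]
  | coin C ih => simp [relabel, size, ih]

theorem Circ.eval_relabel {β α α' : Type} (C : Circ β α) (g : α → α') (v : α' → Bool) :
    (C.relabel g).eval v = C.eval fun i => v (g i) := by
  induction C generalizing α' with
  | out f => rfl
  | nand i j C ih =>
    simp only [relabel, eval, ih]
    congr 1; funext o; cases o <;> rfl
  | coin C ih =>
    simp only [relabel, eval, ih]
    congr 1; funext c; congr 1; funext o; cases o <;> rfl

/-- Sequential composition: `D` runs after `C`, and `h` says which of its inputs are outputs of
`C` and which are inputs of `C`. -/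
def Circ.seq {β γ δ : Type} : {α : Type} → Circ β α → Circ γ δ → (δ → β ⊕ α) → Circ γ α
  | _, .out f, D, h => D.relabel fun d => Sum.elim f id (h d)
  | _, .nand i j C, D, h => .nand i j (C.seq D fun d => (h d).map id some)
  | _, .coin C, D, h => .coin (C.seq D fun d => (h d).map id some)

theorem Circ.size_seq {β γ δ α : Type} (C : Circ β α) (D : Circ γ δ) (h : δ → β ⊕ α) :
    (C.seq D h).size = C.size + D.size := by
  induction C with
  | out f => simp [seq, size, size_relabel]
  | nand i j C ih => simp [seq, size, ih]; omega
  | coin C ih => simp [seq, size, ih]; omega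

theorem Circ.eval_seq {β γ δ α : Type} (C : Circ β α) (D : Circ γ δ) (h : δ → β ⊕ α)
    (v : α → Bool) :
    (C.seq D h).eval v = (C.eval v).bind fun u => D.eval fun d => Sum.elim u v (h d) := by
  induction C with
  | out f =>
    simp only [seq, eval, eval_relabel, PMF.pure_bind]
    congr 1; funext d; cases h d <;> rfl
  | nand i j C ih =>
    simp only [seq, eval, ih]
    congr 1; funext u; congr 1; funext d; cases h d <;> rfl
  | coin C ih =>
    simp only [seq, eval, ih, PMF.bind_bind]
    congr 1; funext c; congr 1; funext u; congr 1; funext d; cases h d <;> rfl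

/-- Boolean formulas over NAND. -/
inductive Form (α : Type) : Type
  | var (i : α) : Form α
  | const (b : Bool) : Form α
  | nand (F G : Form α) : Form α

namespace Form

/-- The value of a formula under an assignment `v`. -/
def eval {α : Type} (v : α → Bool) : Form α → Bool
  | var i => v i
  | const b => b
  | nand F G => !(F.eval v && G.eval v)

/-- The number of gates of the circuit `Form.circ`, in which a constant takes a coin and three
NAND gates. -/
def size {α : Type} : Form α → ℕ
  | var _ => 0
  | const _ => 4
  | nand F G => F.size + G.size + 1

/-- The circuit that evaluates a formula. The circuit model has no constant wires: a constant is
computed from a coin `c` as `NAND (c, NAND (c, c))`, which is true for both values of `c`. -/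
def circ {α : Type} : Form α → Circ Unit α
  | var i => .out fun _ => i
  | const b => .coin (.nand none none (.nand none (some none) (.nand none none
      (.out fun _ => if b then some none else none))))
  | nand F G => F.circ.seq ((G.circ.relabel Sum.inr).seq
      (.nand (Sum.inl ()) (Sum.inr ()) (.out fun _ => none) : Circ Unit (Unit ⊕ Unit))
      (Sum.map id fun _ => Sum.inl ())) id

theorem size_circ {α : Type} (F : Form α) : F.circ.size = F.size := by
  induction F with
  | var i => rfl
  | const b => rfl
  | nand F G hF hG => simp [circ, size, Circ.size_seq, Circ.size_relabel, Circ.size, hF, hG]; omega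

theorem eval_circ {α : Type} (F : Form α) (v : α → Bool) :
    F.circ.eval v = PMF.pure fun _ => F.eval v := by
  induction F with
  | var i => rfl
  | const b =>
    simp only [circ, Circ.eval, eval]
    rw [← PMF.bind_const (PMF.uniformOfFintype Bool) (PMF.pure fun _ : Unit => b)]
    congr 1; funext c; congr 1; funext _
    cases b <;> cases c <;> rfl
  | nand F G hF hG =>
    simp only [circ, Circ.eval_seq, Circ.eval_relabel, hF, hG, PMF.pure_bind, Circ.eval, eval,
      id, Sum.elim_inr]
    rw [← Bool.and_comm]
    rfl

/-- Conjunction. -/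
def and {α : Type} (F G : Form α) : Form α := nand (nand F G) (const true)

@[simp] theorem eval_and {α : Type} (F G : Form α) (v : α → Bool) :
    (F.and G).eval v = (F.eval v && G.eval v) := by simp [and, eval]

/-- Equality. -/
def beq {α : Type} (F G : Form α) : Form α :=
  nand (nand F G) (nand (nand F (const true)) (nand G (const true)))

@[simp] theorem eval_beq {α : Type} (F G : Form α) (v : α → Bool) :
    (F.beq G).eval v = (F.eval v == G.eval v) := by
  simp only [beq, eval]; cases F.eval v <;> cases G.eval v <;> rfl

/-- Exclusive or. -/
def xor {α : Type} (F G : Form α) : Form α :=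
  nand (nand F (nand G (const true))) (nand (nand F (const true)) G)

@[simp] theorem eval_xor {α : Type} (F G : Form α) (v : α → Bool) :
    (F.xor G).eval v = Bool.xor (F.eval v) (G.eval v) := by
  simp only [xor, eval]; cases F.eval v <;> cases G.eval v <;> rfl

/-- If `S` then `F` else `G`. -/
def mux {α : Type} (S F G : Form α) : Form α :=
  nand (nand S F) (nand (nand S (const true)) G)

@[simp] theorem eval_mux {α : Type} (S F G : Form α) (v : α → Bool) :
    (S.mux F G).eval v = if S.eval v then F.eval v else G.eval v := by
  simp only [mux, eval]; cases S.eval v <;> cases F.eval v <;> cases G.eval v <;> rfl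

end Form

/-- The circuit that evaluates `n` formulas. -/
def Form.tuple {α : Type} : {n : ℕ} → (Fin n → Form α) → Circ (Fin n) α
  | 0, _ => .out Fin.elim0
  | n + 1, F => (F 0).circ.seq (((Form.tuple fun i => F i.succ).relabel Sum.inr).seq
      (.out id : Circ (Fin (n + 1)) (Fin (n + 1)))
      (Fin.cons (Sum.inr (Sum.inl ())) Sum.inl)) id

theorem Form.size_tuple {α : Type} {n : ℕ} (F : Fin n → Form α) :
    (Form.tuple F).size = ∑ i, (F i).size := by
  induction n with
  | zero => rfl
  | succ n ih =>
    simp [tuple, Circ.size_seq, Circ.size_relabel, Circ.size, size_circ, ih, Fin.sum_univ_succ]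

theorem Form.eval_tuple {α : Type} {n : ℕ} (F : Fin n → Form α) (v : α → Bool) :
    (Form.tuple F).eval v = PMF.pure fun i => (F i).eval v := by
  induction n with
  | zero => simp only [tuple, Circ.eval]; congr 1; funext i; exact i.elim0
  | succ n ih =>
    simp only [tuple, Circ.eval_seq, Circ.eval_relabel, eval_circ, PMF.pure_bind, Circ.eval, ih,
      id, Sum.elim_inr]
    congr 1; funext i
    refine Fin.cases rfl (fun i => rfl) i

/-- `n` coins. -/
def Circ.coins (α : Type) : (n : ℕ) → Circ (Fin n) α
  | 0 => .out Fin.elim0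
  | n + 1 => (Circ.coin (.out fun _ : Unit => none)).seq (((Circ.coins α n).relabel Sum.inr).seq
      (.out id : Circ (Fin (n + 1)) (Fin (n + 1)))
      (Fin.cons (Sum.inr (Sum.inl ())) Sum.inl)) id

theorem Circ.size_coins (α : Type) (n : ℕ) : (Circ.coins α n).size = n := by
  induction n with
  | zero => rfl
  | succ n ih => simp [coins, size_seq, size_relabel, size, ih]; omega

theorem Circ.eval_coins (α : Type) (n : ℕ) (v : α → Bool) :
    (Circ.coins α n).eval v = PMF.uniformOfFintype (Fin n → Bool) := by
  induction n with
  | zero =>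
    ext u
    simp only [coins, eval, PMF.pure_apply, PMF.uniformOfFintype_apply]
    rw [if_pos (Subsingleton.elim _ _)]; simp
  | succ n ih =>
    simp only [coins, eval_seq, eval_relabel, eval, PMF.bind_bind, PMF.pure_bind, id, Sum.elim_inr,
      ih]
    ext u
    simp only [PMF.bind_apply, PMF.uniformOfFintype_apply, PMF.pure_apply, tsum_fintype,
      Fintype.card_bool, Fintype.card_pi, Finset.prod_const, Finset.card_univ, Fintype.card_fin]
    have key : ∀ (b : Bool) (w : Fin n → Bool),
        (u = fun j => Sum.elim w (Sum.elim (fun _ : Unit => b) v)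
          ((Fin.cons (Sum.inr (Sum.inl ())) Sum.inl : Fin (n+1) → Fin n ⊕ Unit ⊕ α) j)) ↔
        (b = u 0 ∧ w = fun i => u i.succ) := by
      intro b w
      constructor
      · rintro rfl; exact ⟨rfl, rfl⟩
      · rintro ⟨rfl, rfl⟩; funext j; refine Fin.cases rfl (fun i => rfl) j
    simp only [Option.elim] at key ⊢
    simp only [key]
    rw [Finset.sum_eq_single (u 0), Finset.sum_eq_single (fun i => u i.succ)]
    · simp [pow_succ, ENNReal.mul_inv, mul_comm]
    · intro w _ hw; simp [hw]
    · simp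
    · intro b _ hb; simp [hb]
    · simp

/-! ### Polynomial bounds -/

theorem PolyBdd.of_le {f g : ℕ → ℕ} (hg : PolyBdd g) (h : ∀ κ, f κ ≤ g κ) : PolyBdd f :=
  hg.imp fun _ hp κ => (h κ).trans (hp κ)

theorem PolyBdd.const (c : ℕ) : PolyBdd fun _ => c := ⟨Polynomial.C c, fun κ => by simp⟩

theorem PolyBdd.add {f g : ℕ → ℕ} (hf : PolyBdd f) (hg : PolyBdd g) :
    PolyBdd fun κ => f κ + g κ := by
  obtain ⟨p, hp⟩ := hf
  obtain ⟨q, hq⟩ := hg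
  exact ⟨p + q, fun κ => by simpa using Nat.add_le_add (hp κ) (hq κ)⟩

theorem PolyBdd.mul {f g : ℕ → ℕ} (hf : PolyBdd f) (hg : PolyBdd g) :
    PolyBdd fun κ => f κ * g κ := by
  obtain ⟨p, hp⟩ := hf
  obtain ⟨q, hq⟩ := hg
  exact ⟨p * q, fun κ => by simpa using Nat.mul_le_mul (hp κ) (hq κ)⟩

/-- The encodings of a family of types have polynomial length. -/
class PolyLen (A : ℕ → Type) [∀ κ, BitCode (A κ)] : Prop where
  bdd : PolyBdd fun κ => codeLen (A κ)

theorem codeLen_prod (A B : Type) [BitCode A] [BitCode B] :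
    codeLen (A × B) = codeLen A + codeLen B := by
  let _ := BitCode.fin (A := A); let _ := BitCode.fin (A := B)
  exact Fintype.card_sum (α := BitCode.Ix A) (β := BitCode.Ix B)

theorem codeLen_option (A : Type) [BitCode A] : codeLen (Option A) = codeLen A + 1 := by
  let _ := BitCode.fin (A := A)
  exact Fintype.card_option (α := BitCode.Ix A)

theorem codeLen_sum (A B : Type) [BitCode A] [BitCode B] :
    codeLen (A ⊕ B) = codeLen A + codeLen B + 1 := by
  let _ := BitCode.fin (A := A); let _ := BitCode.fin (A := B)
  exact (Fintype.card_option (α := BitCode.Ix A ⊕ BitCode.Ix B)).trans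
    (congrArg (· + 1) (Fintype.card_sum (α := BitCode.Ix A) (β := BitCode.Ix B)))

theorem codeLen_bits (n : ℕ) : codeLen (Bits n) = n := Fintype.card_fin n

section

variable {A B : ℕ → Type} [∀ κ, BitCode (A κ)] [∀ κ, BitCode (B κ)]

instance [PolyLen A] [PolyLen B] : PolyLen fun κ => A κ × B κ :=
  ⟨by simpa only [codeLen_prod] using (PolyLen.bdd (A := A)).add (PolyLen.bdd (A := B))⟩

instance [PolyLen A] : PolyLen fun κ => Option (A κ) :=
  ⟨by simpa only [codeLen_option] using (PolyLen.bdd (A := A)).add (PolyBdd.const 1)⟩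

instance [PolyLen A] [PolyLen B] : PolyLen fun κ => A κ ⊕ B κ :=
  ⟨by simpa only [codeLen_sum] using
    ((PolyLen.bdd (A := A)).add (PolyLen.bdd (A := B))).add (PolyBdd.const 1)⟩

instance : PolyLen fun _ => Bool := ⟨(PolyBdd.const 1).of_le fun _ => (Fintype.card_unit).le⟩

theorem PolyLen.fst (h : PolyLen fun κ => A κ × B κ) : PolyLen A :=
  ⟨h.bdd.of_le fun κ => by rw [codeLen_prod]; omega⟩

theorem PolyLen.snd (h : PolyLen fun κ => A κ × B κ) : PolyLen B :=
  ⟨h.bdd.of_le fun κ => by rw [codeLen_prod]; omega⟩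

theorem PolyLen.some (h : PolyLen fun κ => Option (A κ)) : PolyLen A :=
  ⟨h.bdd.of_le fun κ => by rw [codeLen_option]; omega⟩

theorem PolyLen.left (h : PolyLen fun κ => A κ ⊕ B κ) : PolyLen A :=
  ⟨h.bdd.of_le fun κ => by rw [codeLen_sum]; omega⟩

theorem PolyLen.bits {n : ℕ → ℕ} (h : PolyBdd n) : PolyLen fun κ => Bits (n κ) :=
  ⟨by simpa only [codeLen_bits] using h⟩

instance (k : ℕ) : PolyLen fun _ => Bits k := PolyLen.bits (PolyBdd.const k)

theorem PolyLen.polyBdd {n : ℕ → ℕ} (h : PolyLen fun κ => Bits (n κ)) : PolyBdd n := by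
  simpa only [codeLen_bits] using h.bdd

end

/-! ### Efficient families of randomized functions -/

/-- Families of randomized functions on bit vectors that are computed by circuits with
polynomially many gates. -/
def RawEff {I J : ℕ → Type} (F : ∀ κ, (I κ → Bool) → PMF (J κ → Bool)) : Prop :=
  ∃ p : ℕ → ℕ, PolyBdd p ∧ ∀ κ, ∃ C : Circ (J κ) (I κ), C.size ≤ p κ ∧ ∀ v, C.eval v = F κ v

section Raw

variable {I J K : ℕ → Type}

theorem RawEff.wire (r : ∀ κ, J κ → I κ) : RawEff fun κ v => PMF.pure fun j => v (r κ j) :=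
  ⟨fun _ => 0, PolyBdd.const 0, fun κ => ⟨.out (r κ), le_rfl, fun _ => rfl⟩⟩

theorem RawEff.bind {F : ∀ κ, (I κ → Bool) → PMF (J κ → Bool)}
    {G : ∀ κ, (J κ ⊕ I κ → Bool) → PMF (K κ → Bool)} (hF : RawEff F) (hG : RawEff G) :
    RawEff fun κ v => (F κ v).bind fun u => G κ (Sum.elim u v) := by
  obtain ⟨p, hp, hF⟩ := hF
  obtain ⟨q, hq, hG⟩ := hG
  refine ⟨_, hp.add hq, fun κ => ?_⟩
  obtain ⟨C, hC, hC'⟩ := hF κ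
  obtain ⟨D, hD, hD'⟩ := hG κ
  refine ⟨C.seq D id, ?_, fun v => ?_⟩
  · rw [Circ.size_seq]; omega
  · rw [Circ.eval_seq, hC']; congr 1; funext u; exact hD' _

theorem RawEff.relabel {F : ∀ κ, (I κ → Bool) → PMF (J κ → Bool)} (hF : RawEff F)
    (r : ∀ κ, I κ → K κ) : RawEff fun κ (v : K κ → Bool) => F κ fun i => v (r κ i) := by
  obtain ⟨p, hp, hF⟩ := hF
  refine ⟨p, hp, fun κ => ?_⟩
  obtain ⟨C, hC, hC'⟩ := hF κ
  exact ⟨C.relabel (r κ), by rwa [Circ.size_relabel], fun v => by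
    rw [Circ.eval_relabel, hC']⟩

theorem RawEff.form (fin : ∀ κ, Fintype (J κ)) (hJ : PolyBdd fun κ => @Fintype.card _ (fin κ))
    (Φ : ∀ κ, J κ → Form (I κ)) (p : ℕ → ℕ) (hp : PolyBdd p) (hΦ : ∀ κ j, (Φ κ j).size ≤ p κ) :
    RawEff fun κ v => PMF.pure fun j => (Φ κ j).eval v := by
  refine ⟨_, hJ.mul hp, fun κ => ?_⟩
  let e := Fintype.equivFin (J κ)
  refine ⟨(Form.tuple fun i => Φ κ (e.symm i)).seq
    (.out id : Circ (J κ) (J κ)) (fun j => Sum.inl (e j)), ?_, fun v => ?_⟩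
  · rw [Circ.size_seq, Form.size_tuple]
    refine (Nat.add_le_add_right (Finset.sum_le_card_nsmul _ _ (p κ) fun i _ => hΦ κ _) _).trans ?_
    simp [Circ.size]
  · simp [Circ.eval_seq, Form.eval_tuple, Circ.eval]

end Raw

section Eff

variable {A B D E : ℕ → Type} [∀ κ, BitCode (A κ)] [∀ κ, BitCode (B κ)] [∀ κ, BitCode (D κ)]
  [∀ κ, BitCode (E κ)]

/-- `f` is computed by circuits with polynomially many gates; the number of wires is not
counted. -/
def Eff (f : ∀ κ, A κ → PMF (B κ)) : Prop :=
  ∃ F : ∀ κ, (BitCode.Ix (A κ) → Bool) → PMF (BitCode.Ix (B κ) → Bool),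
    RawEff F ∧ ∀ κ a, F κ (BitCode.enc a) = (f κ a).map BitCode.enc

/-- Efficient families of deterministic functions. -/
abbrev EffD (g : ∀ κ, A κ → B κ) : Prop := Eff fun κ a => PMF.pure (g κ a)

theorem PolyTime.eff {f : ∀ κ, A κ → PMF (B κ)} (hf : PolyTime f) : Eff f := by
  obtain ⟨p, hp⟩ := hf
  choose C hC hC' using hp
  exact ⟨fun κ v => (C κ).eval v, ⟨fun κ => p.eval κ, ⟨p, fun _ => le_rfl⟩,
    fun κ => ⟨C κ, by have := hC κ; dsimp only; omega, fun _ => rfl⟩⟩, hC'⟩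

theorem PolyTime.polyLen_left {f : ∀ κ, A κ → PMF (B κ)} (hf : PolyTime f) : PolyLen A := by
  obtain ⟨p, hp⟩ := hf
  choose C hC hC' using hp
  exact ⟨⟨p, fun κ => by have := hC κ; dsimp only; omega⟩⟩

theorem PolyTime.polyLen_right {f : ∀ κ, A κ → PMF (B κ)} (hf : PolyTime f) : PolyLen B := by
  obtain ⟨p, hp⟩ := hf
  choose C hC hC' using hp
  exact ⟨⟨p, fun κ => by have := hC κ; dsimp only; omega⟩⟩

theorem Eff.polyTime [hA : PolyLen A] [hB : PolyLen B] {f : ∀ κ, A κ → PMF (B κ)} (hf : Eff f) :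
    PolyTime f := by
  obtain ⟨F, ⟨p, hp, hF⟩, hF'⟩ := hf
  obtain ⟨P, hP⟩ := (hp.add hA.bdd).add hB.bdd
  refine ⟨P, fun κ => ?_⟩
  obtain ⟨C, hC, hC'⟩ := hF κ
  exact ⟨C, le_trans (by dsimp only; omega) (hP κ), fun a => by rw [hC', hF']⟩

theorem Eff.comp {f : ∀ κ, B κ → PMF (D κ)} {g : ∀ κ, A κ → B κ} (hf : Eff f) (hg : EffD g) :
    Eff fun κ a => f κ (g κ a) := by
  obtain ⟨F, hF, hF'⟩ := hf
  obtain ⟨G, hG, hG'⟩ := hg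
  refine ⟨_, hG.bind (hF.relabel fun κ => Sum.inl), fun κ a => ?_⟩
  simp only [hG', PMF.pure_map, PMF.pure_bind, Sum.elim_inl]
  exact hF' κ _

/-- The second function gets the input and the output of the first one. -/
theorem Eff.bind {f : ∀ κ, A κ → PMF (B κ)} {g : ∀ κ, A κ → B κ → PMF (D κ)} (hf : Eff f)
    (hg : Eff fun κ (p : A κ × B κ) => g κ p.1 p.2) :
    Eff fun κ a => (f κ a).bind fun b => g κ a b := by
  obtain ⟨F, hF, hF'⟩ := hf
  obtain ⟨G, hG, hG'⟩ := hg
  refine ⟨_, hF.bind (hG.relabel fun κ => Sum.swap), fun κ a => ?_⟩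
  simp only [hF', PMF.map, PMF.bind_bind, PMF.pure_bind, Function.comp_def]
  congr 1; funext b
  refine Eq.trans (congrArg (G κ) ?_) (hG' κ (a, b))
  funext i; cases i <;> rfl

/-- Functions that permute, duplicate and forget bits, and output constants. -/
theorem EffD.wire [PolyLen B] {g : ∀ κ, A κ → B κ}
    (r : ∀ κ, BitCode.Ix (B κ) → BitCode.Ix (A κ) ⊕ Bool)
    (h : ∀ κ a j, BitCode.enc (g κ a) j = Sum.elim (BitCode.enc a) id (r κ j)) : EffD g := by
  refine ⟨_, RawEff.form (fun κ => BitCode.fin) PolyLen.bdd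
    (fun κ j => Sum.elim Form.var Form.const (r κ j)) _ (PolyBdd.const 4) (fun κ j => ?_),
    fun κ a => ?_⟩
  · cases r κ j <;> simp [Form.size]
  · rw [PMF.pure_map]; congr 1; funext j; rw [h]; cases r κ j <;> rfl

theorem EffD.wire' {g : ∀ κ, A κ → B κ} (r : ∀ κ, BitCode.Ix (B κ) → BitCode.Ix (A κ))
    (h : ∀ κ a j, BitCode.enc (g κ a) j = BitCode.enc a (r κ j)) : EffD g :=
  ⟨_, RawEff.wire r, fun κ a => by rw [PMF.pure_map]; congr 1; funext j; rw [h]⟩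

theorem EffD.id : EffD fun κ (a : A κ) => a := EffD.wire' (fun _ j => j) fun _ _ _ => rfl

theorem EffD.const [PolyLen B] (b : ∀ κ, B κ) : EffD fun κ (_ : A κ) => b κ :=
  EffD.wire (fun κ j => Sum.inr (BitCode.enc (b κ) j)) fun _ _ _ => rfl

theorem EffD.fst {g : ∀ κ, A κ → B κ × D κ} (hg : EffD g) : EffD fun κ a => (g κ a).1 :=
  Eff.comp (f := fun κ (p : B κ × D κ) => PMF.pure p.1)
    (EffD.wire' (fun _ j => Sum.inl j) fun _ _ _ => rfl) hg

theorem EffD.snd {g : ∀ κ, A κ → B κ × D κ} (hg : EffD g) : EffD fun κ a => (g κ a).2 :=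
  Eff.comp (f := fun κ (p : B κ × D κ) => PMF.pure p.2)
    (EffD.wire' (fun _ j => Sum.inr j) fun _ _ _ => rfl) hg

theorem EffD.mk {g : ∀ κ, A κ → B κ} {h : ∀ κ, A κ → D κ} (hg : EffD g) (hh : EffD h) :
    EffD fun κ a => (g κ a, h κ a) := by
  have h1 : Eff fun κ (p : (A κ × B κ) × D κ) => PMF.pure (p.1.2, p.2) :=
    EffD.wire' (fun κ j => j.elim (fun j => Sum.inl (Sum.inr j)) Sum.inr) fun κ a j => by
      cases j <;> rfl
  have h2 := Eff.bind hg (g := fun κ a b => (PMF.pure (h κ a)).bind fun d => PMF.pure (b, d))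
    (Eff.bind (hh.comp EffD.id.fst) h1)
  simpa only [PMF.pure_bind] using h2

theorem EffD.some {g : ∀ κ, A κ → B κ} [PolyLen B] (hg : EffD g) :
    EffD fun κ a => Option.some (g κ a) :=
  Eff.comp (f := fun κ (b : B κ) => PMF.pure (Option.some b))
    (EffD.wire (fun κ j => j.elim (Sum.inr true) Sum.inl) fun κ a j => by cases j <;> rfl) hg

theorem EffD.isSome {g : ∀ κ, A κ → Option (B κ)} (hg : EffD g) :
    EffD fun κ a => (g κ a).isSome :=
  Eff.comp (f := fun κ (b : Option (B κ)) => PMF.pure b.isSome)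
    (EffD.wire' (fun κ j => none) fun κ a j => by cases a <;> rfl) hg

theorem EffD.inl {g : ∀ κ, A κ → B κ} [PolyLen B] [PolyLen D] (hg : EffD g) :
    EffD fun κ a => (Sum.inl (g κ a) : B κ ⊕ D κ) :=
  Eff.comp (f := fun κ (b : B κ) => PMF.pure (Sum.inl b : B κ ⊕ D κ))
    (EffD.wire (fun κ j => j.elim (Sum.inr false) fun j => j.elim Sum.inl fun _ => Sum.inr false)
      fun κ a j => by rcases j with _ | j | j <;> rfl) hg

theorem EffD.inr {g : ∀ κ, A κ → D κ} [PolyLen B] [PolyLen D] (hg : EffD g) :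
    EffD fun κ a => (Sum.inr (g κ a) : B κ ⊕ D κ) :=
  Eff.comp (f := fun κ (b : D κ) => PMF.pure (Sum.inr b : B κ ⊕ D κ))
    (EffD.wire (fun κ j => j.elim (Sum.inr true) fun j => j.elim (fun _ => Sum.inr false) Sum.inl)
      fun κ a j => by rcases j with _ | j | j <;> rfl) hg

theorem EffD.xor {n : ℕ → ℕ} [h : PolyLen fun κ => Bits (n κ)] {g g' : ∀ κ, A κ → Bits (n κ)}
    (hg : EffD g) (hg' : EffD g') : EffD fun κ a => xorBits (g κ a) (g' κ a) :=
  Eff.comp (f := fun κ (p : Bits (n κ) × Bits (n κ)) => PMF.pure (xorBits p.1 p.2))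
    (by
      refine ⟨_, RawEff.form (fun κ => BitCode.fin) h.bdd
        (fun κ j => (Form.var (Sum.inl j)).xor (Form.var (Sum.inr j))) _ (PolyBdd.const 13)
        (fun κ j => by simp [Form.xor, Form.size]), fun κ a => ?_⟩
      rw [PMF.pure_map]; congr 1; funext j; rw [Form.eval_xor]; rfl) (hg.mk hg')

/-- The multiplexer of a bit and two bit vectors. -/
theorem RawEff.mux [PolyLen B] :
    RawEff fun κ (v : (BitCode.Ix (B κ) ⊕ BitCode.Ix (B κ)) ⊕ Unit → Bool) =>
      PMF.pure fun j : BitCode.Ix (B κ) =>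
        if v (Sum.inr ()) then v (Sum.inl (Sum.inl j)) else v (Sum.inl (Sum.inr j)) := by
  have := RawEff.form (fun κ => BitCode.fin (A := B κ)) PolyLen.bdd
    (fun κ j => (Form.var (Sum.inr ())).mux (Form.var (Sum.inl (Sum.inl j)))
      (Form.var (Sum.inl (Sum.inr j)) : Form ((BitCode.Ix (B κ) ⊕ BitCode.Ix (B κ)) ⊕ Unit)))
    _ (PolyBdd.const 8) (fun κ j => by simp [Form.mux, Form.size])
  convert this using 3 with κ v
  refine congrArg PMF.pure (funext fun j => ?_)
  rw [Form.eval_mux]; rfl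

/-- Choice between two circuits, both of which are run. -/
theorem RawEff.choice [PolyLen B] {I : ℕ → Type} (s : ∀ κ, I κ)
    {F G : ∀ κ, (I κ → Bool) → PMF (BitCode.Ix (B κ) → Bool)} (hF : RawEff F) (hG : RawEff G) :
    RawEff fun κ v => if v (s κ) then F κ v else G κ v := by
  have h1 := (RawEff.mux (B := B)).relabel (K := fun κ => BitCode.Ix (B κ) ⊕ BitCode.Ix (B κ) ⊕ I κ)
    fun κ => Sum.elim (Sum.elim (fun j => Sum.inr (Sum.inl j)) Sum.inl)
      (fun _ => Sum.inr (Sum.inr (s κ)))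
  have h2 := hF.bind ((hG.relabel (K := fun κ => BitCode.Ix (B κ) ⊕ I κ) fun κ => Sum.inr).bind h1)
  convert h2 using 3 with κ v
  simp only [Sum.elim_inr, Sum.elim_inl]
  by_cases h : v (s κ) = true
  · simp only [h, if_true, PMF.bind_const]
    exact (PMF.bind_pure _).symm
  · simp only [h, if_false, Bool.false_eq_true]
    rw [PMF.bind_const]
    exact (PMF.bind_pure _).symm

theorem Eff.cond [PolyLen B] {s : ∀ κ, A κ → Bool} {f g : ∀ κ, A κ → PMF (B κ)} (hs : EffD s)
    (hf : Eff f) (hg : Eff g) : Eff fun κ a => bif s κ a then f κ a else g κ a := by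
  obtain ⟨S, hS, hS'⟩ := hs
  obtain ⟨F, hF, hF'⟩ := hf
  obtain ⟨G, hG, hG'⟩ := hg
  refine ⟨_, hS.bind (RawEff.choice (B := B) (I := fun κ => BitCode.Ix Bool ⊕ BitCode.Ix (A κ))
    (fun κ => Sum.inl ()) (hF.relabel fun κ => Sum.inr) (hG.relabel fun κ => Sum.inr)),
    fun κ a => ?_⟩
  simp only [hS', PMF.pure_map, PMF.pure_bind, Sum.elim_inl, Sum.elim_inr]
  cases h : s κ a
  · refine (if_neg ?_).trans (hG' κ a)
    exact Bool.eq_false_iff.1 rfl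
  · exact (if_pos rfl).trans (hF' κ a)

theorem Eff.optionElim [PolyLen D] {o : ∀ κ, A κ → Option (B κ)} {g : ∀ κ, A κ → PMF (D κ)}
    {f : ∀ κ, A κ → B κ → PMF (D κ)} (ho : EffD o) (hg : Eff g)
    (hf : Eff fun κ (p : A κ × B κ) => f κ p.1 p.2) :
    Eff fun κ a => (o κ a).elim (g κ a) fun b => f κ a b := by
  obtain ⟨O, hO, hO'⟩ := ho
  obtain ⟨G, hG, hG'⟩ := hg
  obtain ⟨F, hF, hF'⟩ := hf
  refine ⟨_, hO.bind (RawEff.choice (B := D)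
    (I := fun κ => BitCode.Ix (Option (B κ)) ⊕ BitCode.Ix (A κ)) (fun κ => Sum.inl none)
    (hF.relabel fun κ => Sum.elim Sum.inr fun j => Sum.inl (Option.some j))
    (hG.relabel fun κ => Sum.inr)),
    fun κ a => ?_⟩
  simp only [hO', PMF.pure_map, PMF.pure_bind, Sum.elim_inl, Sum.elim_inr]
  cases o κ a with
  | none => exact hG' κ a
  | some b =>
    refine Eq.trans ?_ (hF' κ (a, b))
    refine (if_pos rfl).trans (congrArg _ ?_)
    funext i; cases i <;> rfl

theorem Eff.sumElim [PolyLen E] {o : ∀ κ, A κ → B κ ⊕ D κ}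
    {f : ∀ κ, A κ → B κ → PMF (E κ)} {g : ∀ κ, A κ → D κ → PMF (E κ)} (ho : EffD o)
    (hf : Eff fun κ (p : A κ × B κ) => f κ p.1 p.2)
    (hg : Eff fun κ (p : A κ × D κ) => g κ p.1 p.2) :
    Eff fun κ a => (o κ a).elim (fun b => f κ a b) fun d => g κ a d := by
  obtain ⟨O, hO, hO'⟩ := ho
  obtain ⟨G, hG, hG'⟩ := hg
  obtain ⟨F, hF, hF'⟩ := hf
  refine ⟨_, hO.bind (RawEff.choice (B := E)
    (I := fun κ => BitCode.Ix (B κ ⊕ D κ) ⊕ BitCode.Ix (A κ)) (fun κ => Sum.inl none)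
    (hG.relabel fun κ => Sum.elim Sum.inr fun j => Sum.inl (Option.some (Sum.inr j)))
    (hF.relabel fun κ => Sum.elim Sum.inr fun j => Sum.inl (Option.some (Sum.inl j)))),
    fun κ a => ?_⟩
  simp only [hO', PMF.pure_map, PMF.pure_bind, Sum.elim_inl]
  cases o κ a with
  | inl b =>
    refine Eq.trans ?_ (hF' κ (a, b))
    refine (if_neg Bool.false_ne_true).trans (congrArg _ ?_)
    funext i; cases i <;> rfl
  | inr b =>
    refine Eq.trans ?_ (hG' κ (a, b))
    refine (if_pos rfl).trans (congrArg _ ?_)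
    funext i; cases i <;> rfl

theorem EffD.cond [PolyLen B] {s : ∀ κ, A κ → Bool} {f g : ∀ κ, A κ → B κ} (hs : EffD s)
    (hf : EffD f) (hg : EffD g) : EffD fun κ a => bif s κ a then f κ a else g κ a := by
  have := Eff.cond hs hf hg
  convert this using 3 with κ a
  dsimp only
  cases s κ a <;> rfl

theorem EffD.optionElim [PolyLen D] {o : ∀ κ, A κ → Option (B κ)} {g : ∀ κ, A κ → D κ}
    {f : ∀ κ, A κ → B κ → D κ} (ho : EffD o) (hg : EffD g)
    (hf : EffD fun κ (p : A κ × B κ) => f κ p.1 p.2) :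
    EffD fun κ a => (o κ a).elim (g κ a) fun b => f κ a b := by
  have := Eff.optionElim (f := fun κ a b => PMF.pure (f κ a b)) ho hg hf
  convert this using 3 with κ a
  dsimp only
  cases o κ a <;> rfl

theorem EffD.sumElim {A B D E : ℕ → Type} [∀ κ, BitCode (A κ)] [∀ κ, BitCode (B κ)]
    [∀ κ, BitCode (D κ)] [∀ κ, BitCode (E κ)] [PolyLen E] {o : ∀ κ, A κ → B κ ⊕ D κ}
    {f : ∀ κ, A κ → B κ → E κ} {g : ∀ κ, A κ → D κ → E κ} (ho : EffD o)
    (hf : EffD fun κ (p : A κ × B κ) => f κ p.1 p.2)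
    (hg : EffD fun κ (p : A κ × D κ) => g κ p.1 p.2) :
    EffD fun κ a => (o κ a).elim (fun b => f κ a b) fun d => g κ a d := by
  have := Eff.sumElim (f := fun κ a b => PMF.pure (f κ a b))
    (g := fun κ a b => PMF.pure (g κ a b)) ho hf hg
  convert this using 3 with κ a
  dsimp only
  cases o κ a <;> rfl

/-- Equality of bit strings. -/
theorem EffD.beq {n : ℕ → ℕ} [h : PolyLen fun κ => Bits (n κ)] {g g' : ∀ κ, A κ → Bits (n κ)}
    (hg : EffD g) (hg' : EffD g') : EffD fun κ a => decide (g κ a = g' κ a) :=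
  Eff.comp (f := fun κ (p : Bits (n κ) × Bits (n κ)) => PMF.pure (decide (p.1 = p.2)))
    (by
      let Φ : ∀ (κ : ℕ), List (Fin (n κ)) → Form (Fin (n κ) ⊕ Fin (n κ)) := fun κ l =>
        l.foldr (fun j F => ((Form.var (Sum.inl j)).beq (Form.var (Sum.inr j))).and F)
          (Form.const true)
      have hs : ∀ κ l, (Φ κ l).size = 19 * l.length + 4 := fun κ l => by
        induction l with
        | nil => rfl
        | cons j l ih =>
          have : (Φ κ (j :: l)).size = 19 + (Φ κ l).size := by
            simp only [Φ, List.foldr_cons, Form.beq, Form.and, Form.size]; omega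
          rw [this, ih, List.length_cons]; omega
      have he : ∀ κ l v, (Φ κ l).eval v = l.all fun j => v (Sum.inl j) == v (Sum.inr j) :=
        fun κ l v => by
          induction l with
          | nil => rfl
          | cons j l ih =>
            have : (Φ κ (j :: l)).eval v = ((v (Sum.inl j) == v (Sum.inr j)) && (Φ κ l).eval v) := by
              simp [Φ, Form.eval]
            rw [this, ih, List.all_cons]
      refine ⟨_, RawEff.form (fun κ => BitCode.fin) (PolyLen.bdd (A := fun _ => Bool))
        (fun κ _ => Φ κ (List.finRange (n κ))) (fun κ => 19 * n κ + 4)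
        (((PolyBdd.const 19).mul h.polyBdd).add (PolyBdd.const 4))
        (fun κ j => by rw [hs]; simp), fun κ a => ?_⟩
      rw [PMF.pure_map]; congr 1; funext j; rw [he, Bool.eq_iff_iff]
      simp only [List.all_eq_true, List.mem_finRange, true_imp_iff, beq_iff_eq]
      exact funext_iff.symm.trans (decide_eq_true_iff).symm) (hg.mk hg')

/-- Uniform bit strings. -/
theorem Eff.uniform {n : ℕ → ℕ} [h : PolyLen fun κ => Bits (n κ)] :
    Eff fun κ (_ : A κ) => PMF.uniformOfFintype (Bits (n κ)) :=
  ⟨fun κ _ => PMF.uniformOfFintype (Fin (n κ) → Bool), ⟨n, h.polyBdd, fun κ =>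
    ⟨Circ.coins _ (n κ), (Circ.size_coins _ _).le, fun v => Circ.eval_coins _ _ v⟩⟩,
    fun _ _ => (PMF.map_id _).symm⟩

/-- `t` steps of a Markov chain. -/
def iter {X : Type} (f : X → PMF X) : ℕ → X → PMF X
  | 0, x => PMF.pure x
  | t + 1, x => (f x).bind (iter f t)

/-- Polynomially many steps of an efficient Markov chain are efficient. -/
theorem Eff.iter {f : ∀ κ, A κ → PMF (A κ)} (hf : Eff f) {t : ℕ → ℕ} (ht : PolyBdd t) :
    Eff fun κ a => GreyOT.iter (f κ) (t κ) a := by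
  obtain ⟨F, ⟨p, hp, hF⟩, hF'⟩ := hf
  have h1 : ∀ κ m, ∃ C : Circ (BitCode.Ix (A κ)) (BitCode.Ix (A κ)),
      C.size ≤ m * p κ ∧ ∀ v, C.eval v = GreyOT.iter (F κ) m v := by
    intro κ m
    obtain ⟨C, hC, hC'⟩ := hF κ
    induction m with
    | zero => exact ⟨.out id, Nat.zero_le _, fun _ => rfl⟩
    | succ m ih =>
      obtain ⟨D, hD, hD'⟩ := ih
      refine ⟨C.seq D Sum.inl, ?_, fun v => ?_⟩
      · rw [Circ.size_seq, Nat.succ_mul]; omega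
      · rw [Circ.eval_seq, hC']
        exact congrArg (PMF.bind (F κ v)) (funext hD')
  have h2 : ∀ κ m a, GreyOT.iter (F κ) m (BitCode.enc a) =
      (GreyOT.iter (f κ) m a).map BitCode.enc := by
    intro κ m
    induction m with
    | zero => exact fun a => (PMF.pure_map _ _).symm
    | succ m ih =>
      intro a
      simp only [GreyOT.iter, hF', PMF.map_bind, PMF.bind_map]
      exact congrArg _ (funext ih)
  exact ⟨fun κ v => GreyOT.iter (F κ) (t κ) v, ⟨_, ht.mul hp, fun κ => h1 κ (t κ)⟩,
    fun κ a => h2 κ (t κ) a⟩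

end Eff

/-! ### Expectations and statistical closeness -/

section Prob

variable {A B : Type}

/-- The expectation of `g` under `p`. -/
def expect (p : PMF A) (g : A → ℝ≥0∞) : ℝ≥0∞ := ∑' a, p a * g a

theorem expect_pure (a : A) (g : A → ℝ≥0∞) : expect (PMF.pure a) g = g a := by
  classical
  rw [expect, tsum_eq_single a]
  · simp
  · intro b hb; simp [hb]

theorem expect_bind (p : PMF A) (f : A → PMF B) (g : B → ℝ≥0∞) :
    expect (p.bind f) g = expect p fun a => expect (f a) g := by
  simp only [expect, PMF.bind_apply, ← ENNReal.tsum_mul_right, ← ENNReal.tsum_mul_left]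
  rw [ENNReal.tsum_comm]
  simp only [mul_assoc]

theorem expect_mono {p : PMF A} {g h : A → ℝ≥0∞} (H : ∀ a ∈ p.support, g a ≤ h a) :
    expect p g ≤ expect p h := by
  refine ENNReal.tsum_le_tsum fun a => ?_
  by_cases ha : p a = 0
  · simp [ha]
  · exact mul_le_mul_right (H a ha) _

theorem expect_congr {p : PMF A} {g h : A → ℝ≥0∞} (H : ∀ a ∈ p.support, g a = h a) :
    expect p g = expect p h :=
  le_antisymm (expect_mono fun a ha => (H a ha).le) (expect_mono fun a ha => (H a ha).ge)

theorem expect_const (p : PMF A) (c : ℝ≥0∞) : expect p (fun _ => c) = c := by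
  rw [expect, ENNReal.tsum_mul_right, p.tsum_coe, one_mul]

theorem expect_add (p : PMF A) (g h : A → ℝ≥0∞) :
    expect p (fun a => g a + h a) = expect p g + expect p h := by
  simp only [expect, mul_add, ENNReal.tsum_add]

theorem expect_le_one {p : PMF A} {g : A → ℝ≥0∞} (H : ∀ a, g a ≤ 1) : expect p g ≤ 1 :=
  (expect_mono fun a _ => H a).trans (expect_const p 1).le

theorem expect_indicator (p : PMF A) (s : Set A) :
    expect p (s.indicator 1) = p.toOuterMeasure s := by
  rw [PMF.toOuterMeasure_apply, expect]
  congr 1; funext a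
  by_cases h : a ∈ s <;> simp [h]

theorem prob_eq (p : PMF A) (s : Set A) : prob p s = (expect p (s.indicator 1)).toReal := by
  rw [expect_indicator]; rfl

theorem prob_ofReal {A : Type} (p : PMF A) (s : Set A) :
    ENNReal.ofReal (prob p s) = p.toOuterMeasure s := by
  rw [prob_eq, expect_indicator, ENNReal.ofReal_toReal]
  rw [← expect_indicator]
  exact ((expect_le_one fun a => Set.indicator_le_self _ 1 a).trans_lt ENNReal.one_lt_top).ne

theorem expect_true (p : PMF Bool) : expect p (({true} : Set Bool).indicator 1) = p true := by
  rw [expect_indicator, PMF.toOuterMeasure_apply_singleton]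

theorem prob_true (p : PMF Bool) : prob p {true} = (p true).toReal := by
  rw [prob_eq, expect_true]

theorem PMF.bind_congr {p : PMF A} {f g : A → PMF B} (H : ∀ a ∈ p.support, f a = g a) :
    p.bind f = p.bind g := by
  ext b
  simp only [PMF.bind_apply]
  congr 1; funext a
  by_cases ha : p a = 0
  · simp [ha]
  · rw [H a ha]

/-- `p` and `q` are `ε`-close outside of `s`: no test with values in `[0, 1]` that rejects `s`
accepts `p` with a probability larger by more than `ε`. The notion is one-sided in general;
for empty `s` it says that the statistical distance is at most `ε`. -/
def Near (s : Set A) (p q : PMF A) (ε : ℝ≥0∞) : Prop :=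
  ∀ g : A → ℝ≥0∞, (∀ a, g a ≤ 1) → (∀ a ∈ s, g a = 0) → expect p g ≤ expect q g + ε

theorem Near.refl (s : Set A) (p : PMF A) (ε : ℝ≥0∞) : Near s p p ε := fun _ _ _ => le_self_add

theorem Near.mono {s : Set A} {p q : PMF A} {ε δ : ℝ≥0∞} (h : Near s p q ε) (hδ : ε ≤ δ) :
    Near s p q δ := fun g hg hs => (h g hg hs).trans (add_le_add_right hδ _)

theorem Near.of_empty {s : Set A} {p q : PMF A} {ε : ℝ≥0∞} (h : Near ∅ p q ε) : Near s p q ε :=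
  fun g hg _ => h g hg fun _ h => h.elim

theorem Near.trans {p q r : PMF A} {ε δ : ℝ≥0∞} (h : Near ∅ p q ε) (h' : Near ∅ q r δ) :
    Near ∅ p r (ε + δ) := fun g hg hs =>
  (h g hg hs).trans ((add_le_add_left (h' g hg hs) _).trans (by rw [add_assoc, add_comm δ]))

theorem Near.symm {p q : PMF A} {ε : ℝ≥0∞} (h : Near ∅ p q ε) : Near ∅ q p ε := by
  intro g hg _
  have hs : ∀ r : PMF A, expect r g + expect r (fun a => 1 - g a) = 1 := fun r => by
    rw [← expect_add]
    simp only [fun a => add_tsub_cancel_of_le (hg a), expect_const]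
  have h1 := h (fun a => 1 - g a) (fun a => tsub_le_self) (fun _ h => h.elim)
  have hq : expect q (fun a => 1 - g a) ≠ ∞ :=
    ((expect_le_one fun a => tsub_le_self).trans_lt ENNReal.one_lt_top).ne
  refine (ENNReal.add_le_add_iff_right hq).1 ?_
  calc expect q g + expect q (fun a => 1 - g a) = 1 := hs q
    _ = expect p g + expect p (fun a => 1 - g a) := (hs p).symm
    _ ≤ expect p g + (expect q (fun a => 1 - g a) + ε) := add_le_add_right h1 _
    _ = _ := by rw [add_assoc, add_comm ε]

theorem Near.bind {p q : PMF A} {ε : ℝ≥0∞} (h : Near ∅ p q ε) (f : A → PMF B) :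
    Near ∅ (p.bind f) (q.bind f) ε := fun g hg _ => by
  rw [expect_bind, expect_bind]
  exact h _ (fun a => expect_le_one hg) fun _ h => h.elim

/-- Mixtures of pairwise close distributions are close, up to the probability of the exceptional
values. -/
theorem Near.bind_left {p : PMF A} {f g : A → PMF B} {s : Set A} {t : Set B} {ε : ℝ≥0∞}
    (h : ∀ a ∈ p.support, a ∉ s → Near t (f a) (g a) ε) :
    Near t (p.bind f) (p.bind g) (ε + p.toOuterMeasure s) := fun k hk ht => by
  classical
  rw [expect_bind, expect_bind, ← expect_indicator]
  calc _ ≤ expect p (fun a => (expect (g a) k + ε) + s.indicator 1 a) := by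
        refine expect_mono fun a ha => ?_
        by_cases has : a ∈ s
        · rw [Set.indicator_of_mem has]
          exact (expect_le_one hk).trans le_add_self
        · exact (h a ha has k hk ht).trans le_self_add
    _ = _ := by rw [expect_add, expect_add, expect_const, add_assoc]

theorem Near.bind_left' {p : PMF A} {f g : A → PMF B} {t : Set B} {ε : ℝ≥0∞}
    (h : ∀ a ∈ p.support, Near t (f a) (g a) ε) : Near t (p.bind f) (p.bind g) ε := by
  simpa using Near.bind_left (s := ∅) fun a ha _ => h a ha

theorem Near.bind_of_mem {A B : Type} {s : Set A} {t : Set B} {p q : PMF A} {ε : ℝ≥0∞}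
    (h : Near s p q ε) {f : A → PMF B} (hf : ∀ a ∈ s, ∀ b ∈ (f a).support, b ∈ t) :
    Near t (p.bind f) (q.bind f) ε := fun g hg ht => by
  rw [expect_bind, expect_bind]
  refine h _ (fun a => expect_le_one hg) fun a ha => ?_
  rw [expect_congr (h := fun _ => 0) fun b hb => ht b (hf a ha b hb), expect_const]

/-- Closeness outside of a set of bad values is closeness up to their probability. -/
theorem Near.of_bad {A : Type} {s : Set A} {p q : PMF A} {ε : ℝ≥0∞} (h : Near s p q ε) :
    Near ∅ p q (ε + p.toOuterMeasure s) := by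
  intro g hg _
  have h1 := h (sᶜ.indicator g) (fun a => (Set.indicator_le_self _ _ a).trans (hg a))
    fun a ha => Set.indicator_of_notMem (Set.notMem_compl_iff.2 ha) _
  calc expect p g ≤ expect p (fun a => sᶜ.indicator g a + s.indicator 1 a) := by
        refine expect_mono fun a _ => ?_
        by_cases ha : a ∈ s
        · rw [Set.indicator_of_mem ha]; exact (hg a).trans le_add_self
        · rw [Set.indicator_of_mem (show a ∈ sᶜ from ha)]; exact le_self_add
    _ ≤ expect q (sᶜ.indicator g) + ε + p.toOuterMeasure s := by
        rw [expect_add, expect_indicator]; exact add_le_add_left h1 _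
    _ ≤ _ := by
        rw [add_assoc]
        exact add_le_add_left (expect_mono fun a _ => Set.indicator_le_self _ _ a) _

/-- A value that is a function of the rest up to an event of small probability can be recomputed. -/
theorem near_bind_fst {A V : Type} (B : PMF (A × V)) (f : A → V) :
    Near ∅ B (B.bind fun y => PMF.pure (y.1, f y.1)) (B.toOuterMeasure {y | f y.1 ≠ y.2}) := by
  have := Near.bind_left (p := B) (f := PMF.pure) (g := fun y => PMF.pure (y.1, f y.1))
    (s := {y | f y.1 ≠ y.2}) (t := ∅) (ε := 0) fun y _ hy => by
      rw [Set.mem_ofPred_eq, not_not] at hy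
      rw [hy]
      exact Near.refl _ _ _
  rwa [PMF.bind_pure, zero_add] at this

theorem Near.of_statDist [Fintype A] {p q : PMF A} {ε : ℝ} (h : statDist p q ≤ ε) :
    Near ∅ p q (ENNReal.ofReal ε) := by
  intro g hg _
  have hgt : ∀ a, g a ≠ ∞ := fun a => ((hg a).trans_lt ENNReal.one_lt_top).ne
  have hfin : ∀ r : PMF A, expect r g ≠ ∞ := fun r =>
    ((expect_le_one hg).trans_lt ENNReal.one_lt_top).ne
  have hr : ∀ r : PMF A, (expect r g).toReal = ∑ a, (r a).toReal * (g a).toReal := fun r => by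
    rw [expect, tsum_fintype, ENNReal.toReal_sum]
    · simp only [ENNReal.toReal_mul]
    · exact fun a _ => ENNReal.mul_ne_top (r.apply_ne_top a) (hgt a)
  have h1 : ∀ r : PMF A, ∑ a, (r a).toReal = 1 := fun r => by
    have h := r.tsum_coe
    rw [tsum_fintype] at h
    rw [← ENNReal.toReal_sum fun a _ => r.apply_ne_top a, h]; rfl
  have key : (expect p g).toReal ≤ (expect q g).toReal + ε := by
    rw [hr, hr]
    have : ∑ a, (p a).toReal * (g a).toReal - ∑ a, (q a).toReal * (g a).toReal ≤
        ∑ a, (1 / 2 * |(p a).toReal - (q a).toReal| + 1 / 2 * ((p a).toReal - (q a).toReal)) := by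
      rw [← Finset.sum_sub_distrib]
      refine Finset.sum_le_sum fun a _ => ?_
      have g0 : 0 ≤ (g a).toReal := ENNReal.toReal_nonneg
      have g1 : (g a).toReal ≤ 1 := ENNReal.toReal_le_of_le_ofReal one_pos.le (by simpa using hg a)
      rw [← sub_mul]
      rcases abs_cases ((p a).toReal - (q a).toReal) with ⟨h, h'⟩ | ⟨h, h'⟩ <;> rw [h] <;>
        nlinarith
    rw [Finset.sum_add_distrib, ← Finset.mul_sum, ← Finset.mul_sum, Finset.sum_sub_distrib, h1,
      h1, sub_self, mul_zero, add_zero] at this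
    unfold statDist at h
    linarith
  rw [← ENNReal.ofReal_toReal (hfin p), ← ENNReal.ofReal_toReal (hfin q)]
  exact (ENNReal.ofReal_le_ofReal key).trans ENNReal.ofReal_add_le

theorem Near.abs_prob {p q : PMF Bool} {ε : ℝ≥0∞} (h : Near ∅ p q ε) (hε : ε ≠ ∞) :
    |prob p {true} - prob q {true}| ≤ ε.toReal := by
  have key : ∀ {p q : PMF Bool}, Near ∅ p q ε → prob p {true} ≤ prob q {true} + ε.toReal := by
    intro p q h
    have h1 := h (({true} : Set Bool).indicator 1)
      (fun b => by by_cases hb : b = true <;> simp [hb]) fun _ h => h.elim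
    rw [expect_true, expect_true] at h1
    rw [prob_true, prob_true, ← ENNReal.toReal_add (q.apply_ne_top _) hε]
    exact ENNReal.toReal_mono (ENNReal.add_ne_top.2 ⟨q.apply_ne_top _, hε⟩) h1
  rw [abs_sub_le_iff]
  constructor
  · linarith [key h]
  · linarith [key h.symm]

end Prob

/-! ### Negligible functions and computational indistinguishability -/

theorem Negl.add {ε δ : ℕ → ℝ} (hε : Negl ε) (hδ : Negl δ) : Negl fun κ => ε κ + δ κ :=
  SuperpolynomialDecay.add hε hδ

theorem Negl.zero : Negl fun _ => 0 := superpolynomialDecay_zero _ _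

theorem Negl.mono {ε δ : ℕ → ℝ} (hδ : Negl δ) (h : ∀ κ, |ε κ| ≤ |δ κ|) : Negl ε :=
  SuperpolynomialDecay.trans_abs_le hδ h

theorem Negl.of_le {ε δ : ℕ → ℝ} (hδ : Negl δ) (h0 : ∀ κ, 0 ≤ ε κ) (h : ∀ κ, ε κ ≤ δ κ) :
    Negl ε :=
  hδ.mono fun κ => by rw [abs_of_nonneg (h0 κ)]; exact (h κ).trans (le_abs_self _)

theorem Negl.max_zero {ε : ℕ → ℝ} (hε : Negl ε) : Negl fun κ => max (ε κ) 0 :=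
  hε.mono fun κ => by
    rw [abs_of_nonneg (le_max_right _ _)]; exact max_le (le_abs_self _) (abs_nonneg _)

theorem Negl.poly_mul {ε : ℕ → ℝ} (hε : Negl ε) {N : ℕ → ℕ} (hN : PolyBdd N) :
    Negl fun κ => N κ * ε κ := by
  obtain ⟨p, hp⟩ := hN
  have h1 : Negl fun κ : ℕ => ((p.map (Nat.castRingHom ℝ)).eval (κ : ℝ)) * ε κ :=
    SuperpolynomialDecay.polynomial_mul hε _
  refine h1.mono fun κ => ?_
  rw [abs_mul, abs_mul]
  refine mul_le_mul_of_nonneg_right ?_ (abs_nonneg _)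
  rw [Nat.abs_cast]
  refine le_trans ?_ (le_abs_self _)
  have : (p.map (Nat.castRingHom ℝ)).eval (κ : ℝ) = ((p.eval κ : ℕ) : ℝ) := by
    rw [Polynomial.eval_natCast_map]; rfl
  rw [this]
  exact_mod_cast hp κ

section CompIndist

variable {A B : ℕ → Type} [∀ κ, BitCode (A κ)] [∀ κ, BitCode (B κ)]

theorem CompIndist.symm {p q : ∀ κ, PMF (A κ)} (h : CompIndist p q) : CompIndist q p :=
  fun D hD => by simpa only [abs_sub_comm] using h D hD

theorem CompIndist.trans {p q r : ∀ κ, PMF (A κ)} (h : CompIndist p q) (h' : CompIndist q r) :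
    CompIndist p r := fun D hD =>
  ((h D hD).add (h' D hD)).of_le (fun _ => abs_nonneg _) fun _ => abs_sub_le _ _ _

theorem CompIndist.of_near {p q : ∀ κ, PMF (A κ)} {ε : ℕ → ℝ} (hε : Negl ε)
    (h : ∀ κ, Near ∅ (p κ) (q κ) (ENNReal.ofReal (ε κ))) : CompIndist p q := fun D _ =>
  hε.max_zero.of_le (fun _ => abs_nonneg _) fun κ => by
    have := ((h κ).bind (D κ)).abs_prob ENNReal.ofReal_ne_top
    rwa [ENNReal.toReal_ofReal'] at this

theorem CompIndist.of_eq {p q : ∀ κ, PMF (A κ)} (h : ∀ κ, p κ = q κ) : CompIndist p q :=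
  CompIndist.of_near Negl.zero fun κ => by rw [h]; exact Near.refl _ _ _

theorem CompIndist.bind [PolyLen A] {p q : ∀ κ, PMF (A κ)} (h : CompIndist p q)
    {f : ∀ κ, A κ → PMF (B κ)} (hf : Eff f) :
    CompIndist (fun κ => (p κ).bind (f κ)) (fun κ => (q κ).bind (f κ)) := fun D hD => by
  simp only [PMF.bind_bind]
  exact h _ (Eff.polyTime (hf.bind (hD.eff.comp EffD.id.snd)))

/-- An efficiently testable event that never happens has negligible probability under an
indistinguishable distribution. -/
theorem CompIndist.negl_event {A : ℕ → Type} [∀ κ, BitCode (A κ)] [PolyLen A]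
    {p q : ∀ κ, PMF (A κ)} (h : CompIndist p q) {g : ∀ κ, A κ → Bool} (hg : EffD g)
    (hq : ∀ κ, ∀ a ∈ (q κ).support, g κ a = false) :
    Negl fun κ => prob (p κ) {a | g κ a = true} := by
  have h1 : ∀ (κ : ℕ) (r : PMF (A κ)), prob (r.bind fun a => PMF.pure (g κ a)) {true} =
      prob r {a | g κ a = true} := fun κ r => by
    rw [prob_eq, prob_eq, expect_bind]
    congr 1
    refine expect_congr fun a _ => ?_
    rw [expect_pure]
    cases ha : g κ a <;> simp [ha]
  refine (h _ hg.polyTime).of_le (fun _ => ENNReal.toReal_nonneg) fun κ => ?_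
  have h0 : prob (q κ) {a | g κ a = true} = 0 := by
    rw [prob_eq, expect_congr (h := fun _ => 0), expect_const]
    · rfl
    · intro a ha
      exact Set.indicator_of_notMem (fun h => by rw [Set.mem_ofPred_eq, hq κ a ha] at h; cases h) _
  simp only [h1, h0, sub_zero]
  exact le_abs_self _

end CompIndist

/-! ### Markov chains -/

section Chain

variable {X Y : Type}

theorem iter_inv {f : X → PMF X} {I : X → Prop} (h : ∀ x, I x → ∀ y ∈ (f x).support, I y)
    (t : ℕ) (x : X) (hx : I x) : ∀ y ∈ (iter f t x).support, I y := by
  induction t generalizing x with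
  | zero => intro y hy; rw [iter, PMF.mem_support_pure_iff] at hy; exact hy ▸ hx
  | succ t ih =>
    intro y hy
    rw [iter, PMF.mem_support_bind_iff] at hy
    obtain ⟨x', hx', hy⟩ := hy
    exact ih x' (h x hx x' hx') y hy

/-- A randomized map that intertwines the steps of two chains intertwines the chains. -/
theorem iter_intertwine {f : X → PMF X} {g : Y → PMF Y} {φ : X → PMF Y} {I : X → Prop}
    (h : ∀ x, I x → (f x).bind φ = (φ x).bind g) (hI : ∀ x, I x → ∀ y ∈ (f x).support, I y)
    (t : ℕ) (x : X) (hx : I x) : (iter f t x).bind φ = (φ x).bind (iter g t) := by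
  induction t generalizing x with
  | zero => simp only [iter, PMF.pure_bind]; exact (PMF.bind_pure _).symm
  | succ t ih =>
    simp only [iter, PMF.bind_bind]
    rw [PMF.bind_congr fun y hy => ih y (hI x hx y hy), ← PMF.bind_bind, h x hx, PMF.bind_bind]

/-- If the steps of two chains are close outside of an absorbing set, so are the chains. -/
theorem iter_near {f g : X → PMF X} {I : X → Prop} {s : Set X} {ε : ℝ≥0∞}
    (h : ∀ x, I x → Near s (f x) (g x) ε) (hs : ∀ x ∈ s, ∀ y ∈ (f x).support, y ∈ s)
    (hI : ∀ x, I x → ∀ y ∈ (f x).support, I y) (t : ℕ) (x : X) (hx : I x) :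
    Near s (iter f t x) (iter g t x) (t * ε) := by
  classical
  induction t generalizing x with
  | zero => exact Near.refl _ _ _
  | succ t ih =>
    intro k hk hks
    simp only [iter, expect_bind]
    calc _ ≤ expect (f x) (fun y => sᶜ.indicator (fun y => expect (iter g t y) k) y + t * ε) := by
          refine expect_mono fun y hy => ?_
          by_cases hys : y ∈ s
          · have : expect (iter f t y) k = 0 := by
              rw [expect_congr (h := fun _ => 0) fun a ha =>
                hks a (iter_inv (I := (· ∈ s)) hs t y hys a ha), expect_const]
            rw [this]; exact zero_le
          · rw [Set.indicator_of_mem (show y ∈ sᶜ from hys)]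
            exact ih y (hI x hx y hy) k hk hks
      _ = expect (f x) (sᶜ.indicator fun y => expect (iter g t y) k) + t * ε := by
          rw [expect_add, expect_const]
      _ ≤ expect (g x) (sᶜ.indicator fun y => expect (iter g t y) k) + ε + t * ε := by
          refine add_le_add_left (h x hx _ (fun a => ?_) fun a ha => ?_) _
          · exact (Set.indicator_le_self _ _ a).trans (expect_le_one hk)
          · exact Set.indicator_of_notMem (Set.notMem_compl_iff.2 ha) _
      _ ≤ _ := by
          rw [add_assoc]
          refine add_le_add (expect_mono fun a _ => Set.indicator_le_self _ _ a) ?_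
          rw [Nat.cast_succ, add_mul, one_mul, add_comm]

end Chain

/-! ### Executions as Markov chains -/

/-- A system at a fixed security parameter. -/
structure Core (S V Q L : Type) where
  rcv : Bool → S → PMF S
  snd : L × L → S → PMF S
  view : S → V
  act : Q → S → PMF (S × Option L)

/-- An adversary and an environment at a fixed security parameter. -/
structure Play (SA SE V Q L N : Type) where
  a0 : SA
  e0 : SE
  stepA : SA × Option N × V → PMF (SA × Option (N ⊕ Q))
  fuel : ℕ
  stepE : SE × Option (L ⊕ N) → PMF (SE × (Bool ⊕ (L × L) ⊕ N))
  guess : SE × Option (L ⊕ N) → PMF Bool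
  rounds : ℕ

namespace Play

section Defs

variable {SA SE S V Q L N : Type} (G : Play SA SE V Q L N) (C : Core S V Q L)

/-- One activation of the adversary within a phase. The left summand holds the state of a running
phase, the right one the result of a phase that is over. -/
def advStep (x : (SA × S × Option N) ⊕ (SA × S × Option (L ⊕ N))) :
    PMF ((SA × S × Option N) ⊕ (SA × S × Option (L ⊕ N))) :=
  x.elim
    (fun y => (G.stepA (y.1, y.2.2, C.view y.2.1)).bind fun r =>
      r.2.elim (PMF.pure (Sum.inr (r.1, y.2.1, none))) fun o => o.elim
        (fun z => PMF.pure (Sum.inr (r.1, y.2.1, some (Sum.inr z))))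
        (fun q => (C.act q y.2.1).bind fun u => PMF.pure (u.2.elim
          (Sum.inl (r.1, u.1, none)) fun m => Sum.inr (r.1, u.1, some (Sum.inl m)))))
    (fun y => PMF.pure (Sum.inr y))

/-- The result of a phase, which may have run out of fuel. -/
def advOut (x : (SA × S × Option N) ⊕ (SA × S × Option (L ⊕ N))) :
    SA × S × Option (L ⊕ N) :=
  x.elim (fun y => (y.1, y.2.1, none)) fun y => y

/-- A phase of the adversary. -/
def adv (y : SA × S × Option N) : PMF (SA × S × Option (L ⊕ N)) :=
  (iter (G.advStep C) G.fuel (Sum.inl y)).bind fun x => PMF.pure (advOut x)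

/-- An activation of the environment with the reaction to it. -/
def round (x : SE × SA × S × Option (L ⊕ N)) : PMF (SE × SA × S × Option (L ⊕ N)) :=
  (G.stepE (x.1, x.2.2.2)).bind fun r => r.2.elim
    (fun b => (C.rcv b x.2.2.1).bind fun s => PMF.pure (r.1, x.2.1, s, none)) fun o => o.elim
      (fun m => (C.snd m x.2.2.1).bind fun s => PMF.pure (r.1, x.2.1, s, none))
      (fun z => (G.adv C (x.2.1, x.2.2.1, some z)).bind fun u => PMF.pure (r.1, u))

/-- The final states of the environment, the adversary and the system, with the last message to
the environment, in an execution that starts from the state `s` of the system. -/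
def run (s : S) : PMF (SE × SA × S × Option (L ⊕ N)) :=
  iter (G.round C) G.rounds (G.e0, G.a0, s, none)

/-- The output of the environment. -/
def bit (s : S) : PMF Bool := (G.run C s).bind fun x => G.guess (x.1, x.2.2.2)

end Defs

end Play

/-- The system `W` at the security parameter `κ`. -/
def System.core {ℓ : ℕ → ℕ} (W : System ℓ) (κ : ℕ) :
    Core (W.St κ) (W.View κ) (W.Act κ) (Bits (ℓ κ)) where
  rcv := W.receiverInput κ
  snd := W.senderInput κ
  view := W.view κ
  act := W.act κ

attribute [instance] Adversary.code Environment.code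

section Exec

variable {ℓ n : ℕ → ℕ} {W : System ℓ} (A : Adversary W n) (E : Environment ℓ n)

/-- The adversary `A` and the environment `E` at the security parameter `κ`. -/
def play (κ : ℕ) :
    Play (A.St κ) (E.St κ) (W.View κ) (W.Act κ) (Bits (ℓ κ)) (Bits (n κ)) where
  a0 := A.start κ
  e0 := E.start κ
  stepA := A.step κ
  fuel := A.fuel κ
  stepE := E.step κ
  guess := E.guess κ
  rounds := E.rounds κ

theorem iter_advStep_inr {SA SE S V Q L N : Type} (G : Play SA SE V Q L N) (C : Core S V Q L)
    (t : ℕ) (y : SA × S × Option (L ⊕ N)) :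
    iter (G.advStep C) t (Sum.inr y) = PMF.pure (Sum.inr y) := by
  induction t with
  | zero => rfl
  | succ t ih => rw [iter, Play.advStep, Sum.elim_inr, PMF.pure_bind, ih]

theorem advPhase_eq (κ t : ℕ) (a : A.St κ) (s : W.St κ) (z : Option (Bits (n κ))) :
    advPhase A κ t a s z = (iter ((play A E κ).advStep (W.core κ)) t (Sum.inl (a, s, z))).bind
      fun x => PMF.pure (Play.advOut x) := by
  induction t generalizing a s z with
  | zero => rw [iter, PMF.pure_bind]; rfl
  | succ t ih =>
    rw [advPhase, iter, PMF.bind_bind]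
    conv_rhs => rw [Play.advStep, Sum.elim_inl, PMF.bind_bind]
    refine congrArg (PMF.bind _) (funext fun r => ?_)
    rcases r with ⟨a', _ | z' | q⟩
    · simp only [Option.elim, PMF.pure_bind, iter_advStep_inr]; rfl
    · simp only [Option.elim, Sum.elim_inl, PMF.pure_bind, iter_advStep_inr]; rfl
    · simp only [Option.elim, Sum.elim_inr, PMF.bind_bind, PMF.pure_bind]
      refine congrArg (PMF.bind _) (funext fun u => ?_)
      rcases u with ⟨s', _ | m⟩
      · exact ih _ _ _
      · simp only [iter_advStep_inr, PMF.pure_bind]; rfl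

theorem execLoop_eq (κ t : ℕ) (e : E.St κ) (a : A.St κ) (s : W.St κ)
    (i : Option (Bits (ℓ κ) ⊕ Bits (n κ))) :
    execLoop A E κ t e a s i = (iter ((play A E κ).round (W.core κ)) t (e, a, s, i)).bind
      fun x => E.guess κ (x.1, x.2.2.2) := by
  induction t generalizing e a s i with
  | zero => rw [iter, PMF.pure_bind]; rfl
  | succ t ih =>
    rw [execLoop, iter, PMF.bind_bind]
    conv_rhs => rw [Play.round, PMF.bind_bind]
    refine congrArg (PMF.bind _) (funext fun r => ?_)
    rcases r with ⟨e', b | m | z⟩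
    · simp only [Sum.elim_inl, PMF.bind_bind, PMF.pure_bind, ← ih]; rfl
    · simp only [Sum.elim_inl, Sum.elim_inr, PMF.bind_bind, PMF.pure_bind, ← ih]; rfl
    · simp only [Sum.elim_inr, PMF.bind_bind, PMF.pure_bind, ← ih, Play.adv]
      rw [advPhase_eq A E]
      simp only [PMF.bind_bind, PMF.pure_bind]; rfl

theorem exec_eq (κ : ℕ) :
    exec W A E κ = (W.start κ).bind ((play A E κ).bit (W.core κ)) :=
  congrArg (PMF.bind _) (funext fun _ => execLoop_eq A E κ _ _ _ _ _)

end Exec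

/-! ### Efficiency of executions -/

section EffRun

variable {A B : ℕ → Type} [∀ κ, BitCode (A κ)] [∀ κ, BitCode (B κ)]

/-- All operations of a family of systems are efficient. -/
structure EffCore {S V Q : ℕ → Type} {ℓ : ℕ → ℕ} [∀ κ, BitCode (S κ)] [∀ κ, BitCode (V κ)]
    [∀ κ, BitCode (Q κ)] (C : ∀ κ, Core (S κ) (V κ) (Q κ) (Bits (ℓ κ))) : Prop where
  rcv : Eff fun κ (p : Bool × S κ) => (C κ).rcv p.1 p.2
  snd : Eff fun κ (p : (Bits (ℓ κ) × Bits (ℓ κ)) × S κ) => (C κ).snd p.1 p.2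
  view : EffD fun κ (s : S κ) => (C κ).view s
  act : Eff fun κ (p : Q κ × S κ) => (C κ).act p.1 p.2

variable {ℓ n : ℕ → ℕ} {W : System ℓ} (A : Adversary W n) (E : Environment ℓ n)
  {S : ℕ → Type} [∀ κ, BitCode (S κ)]
  {C : ∀ κ, Core (S κ) (W.View κ) (W.Act κ) (Bits (ℓ κ))}

theorem Adversary.polyLen_St : PolyLen A.St := A.step_poly.polyLen_left.fst

theorem Adversary.polyLen_msg (A : Adversary W n) : PolyLen fun κ => Bits (n κ) :=
  A.step_poly.polyLen_left.snd.fst.some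

theorem Environment.polyLen_St : PolyLen E.St := E.step_poly.polyLen_left.fst

theorem Environment.polyLen_out (E : Environment ℓ n) : PolyLen fun κ => Bits (ℓ κ) :=
  E.step_poly.polyLen_left.snd.some.left

theorem eff_adv [PolyLen S] [hℓ : PolyLen fun κ => Bits (ℓ κ)] (hC : EffCore C) :
    Eff fun κ (y : A.St κ × S κ × Option (Bits (n κ))) => (play A E κ).adv (C κ) y := by
  have hA := A.polyLen_St
  have hn := A.polyLen_msg
  have hstep : Eff fun κ (x : (A.St κ × S κ × Option (Bits (n κ))) ⊕
      (A.St κ × S κ × Option (Bits (ℓ κ) ⊕ Bits (n κ)))) => (play A E κ).advStep (C κ) x := by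
    unfold Play.advStep
    refine Eff.sumElim EffD.id (Eff.bind (A.step_poly.eff.comp ?_) ?_) (EffD.inr EffD.id.snd)
    · exact EffD.id.snd.fst.mk (EffD.id.snd.snd.snd.mk (hC.view.comp EffD.id.snd.snd.fst))
    refine Eff.optionElim EffD.id.snd.snd ?_ (Eff.sumElim EffD.id.snd ?_ (Eff.bind ?_ ?_))
    · exact EffD.inr (EffD.id.snd.fst.mk (EffD.id.fst.snd.snd.fst.mk (EffD.const fun _ => none)))
    · exact EffD.inr (EffD.id.fst.fst.snd.fst.mk (EffD.id.fst.fst.fst.snd.snd.fst.mk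
        (EffD.some (EffD.inr EffD.id.snd))))
    · exact hC.act.comp (EffD.id.snd.mk EffD.id.fst.fst.fst.snd.snd.fst)
    · refine EffD.optionElim EffD.id.snd.snd ?_ ?_
      · exact EffD.inl (EffD.id.fst.fst.fst.snd.fst.mk
          (EffD.id.snd.fst.mk (EffD.const fun _ => none)))
      · exact EffD.inr (EffD.id.fst.fst.fst.fst.snd.fst.mk
          (EffD.id.fst.snd.fst.mk (EffD.some (EffD.inl EffD.id.snd))))
  have hout : EffD fun κ (x : (A.St κ × S κ × Option (Bits (n κ))) ⊕
      (A.St κ × S κ × Option (Bits (ℓ κ) ⊕ Bits (n κ)))) => Play.advOut x :=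
    EffD.sumElim EffD.id
      (EffD.id.snd.fst.mk (EffD.id.snd.snd.fst.mk (EffD.const fun _ => none))) EffD.id.snd
  exact Eff.bind ((Eff.iter hstep A.fuel_poly).comp (EffD.inl EffD.id)) (hout.comp EffD.id.snd)

theorem eff_run [PolyLen S] (hC : EffCore C) :
    Eff fun κ (s : S κ) => (play A E κ).run (C κ) s := by
  have hA := A.polyLen_St
  have hn := A.polyLen_msg
  have hE := E.polyLen_St
  have hℓ := E.polyLen_out
  have hround : Eff fun κ (x : E.St κ × A.St κ × S κ × Option (Bits (ℓ κ) ⊕ Bits (n κ))) =>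
      (play A E κ).round (C κ) x := by
    unfold Play.round
    refine Eff.bind (E.step_poly.eff.comp (EffD.id.fst.mk EffD.id.snd.snd.snd))
      (Eff.sumElim EffD.id.snd.snd (Eff.bind ?_ ?_) (Eff.sumElim EffD.id.snd (Eff.bind ?_ ?_)
        (Eff.bind ?_ ?_)))
    · exact hC.rcv.comp (EffD.id.snd.mk EffD.id.fst.fst.snd.snd.fst)
    · exact EffD.id.fst.fst.snd.fst.mk (EffD.id.fst.fst.fst.snd.fst.mk
        (EffD.id.snd.mk (EffD.const fun _ => none)))
    · exact hC.snd.comp (EffD.id.snd.mk EffD.id.fst.fst.fst.snd.snd.fst)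
    · exact EffD.id.fst.fst.fst.snd.fst.mk (EffD.id.fst.fst.fst.fst.snd.fst.mk
        (EffD.id.snd.mk (EffD.const fun _ => none)))
    · exact (eff_adv A E hC).comp (EffD.id.fst.fst.fst.snd.fst.mk
        (EffD.id.fst.fst.fst.snd.snd.fst.mk (EffD.some EffD.id.snd)))
    · exact EffD.id.fst.fst.fst.snd.fst.mk EffD.id.snd
  exact (Eff.iter hround E.rounds_poly).comp ((EffD.const E.start).mk
    ((EffD.const A.start).mk (EffD.id.mk (EffD.const fun _ => none))))

theorem eff_bit [PolyLen S] (hC : EffCore C) :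
    Eff fun κ (s : S κ) => (play A E κ).bit (C κ) s :=
  Eff.bind (eff_run A E hC) (E.guess_poly.eff.comp (EffD.id.snd.fst.mk EffD.id.snd.snd.snd.snd))

end EffRun

/-! ### Comparison of executions -/

section Compare

variable {SA SE S S' V Q L N : Type} {G : Play SA SE V Q L N} {C : Core S V Q L}
  {C' : Core S' V Q L}

/-- `φ` maps each state of the system `C` to a distribution on the states of `C'`, compatibly with
all operations, for the states that satisfy the invariant `I`. -/
structure Intertwines (C : Core S V Q L) (C' : Core S' V Q L) (φ : S → PMF S') (I : S → Prop) :
    Prop where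
  rcv : ∀ s b, I s → (C.rcv b s).bind φ = (φ s).bind (C'.rcv b)
  snd : ∀ s m, I s → (C.snd m s).bind φ = (φ s).bind (C'.snd m)
  view : ∀ s, I s → ∀ s' ∈ (φ s).support, C'.view s' = C.view s
  act : ∀ s q, I s → ((C.act q s).bind fun u => (φ u.1).bind fun s' => PMF.pure (s', u.2)) =
    (φ s).bind (C'.act q)
  rcv_inv : ∀ s b, I s → ∀ t ∈ (C.rcv b s).support, I t
  snd_inv : ∀ s m, I s → ∀ t ∈ (C.snd m s).support, I t
  act_inv : ∀ s q, I s → ∀ u ∈ (C.act q s).support, I u.1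

theorem advStep_inv {I : S → Prop} (h : ∀ s q, I s → ∀ u ∈ (C.act q s).support, I u.1)
    (x : (SA × S × Option N) ⊕ (SA × S × Option (L ⊕ N)))
    (hx : x.elim (fun y => I y.2.1) fun y => I y.2.1) :
    ∀ y ∈ (G.advStep C x).support, y.elim (fun y => I y.2.1) fun y => I y.2.1 := by
  intro y hy
  rcases x with ⟨a, s, z⟩ | ⟨a, s, z⟩
  · simp only [Play.advStep, Sum.elim_inl, PMF.mem_support_bind_iff] at hy hx
    obtain ⟨⟨a', _ | z' | q⟩, hr, hy⟩ := hy
    · simp only [Option.elim, PMF.mem_support_pure_iff] at hy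
      rw [hy]; exact hx
    · simp only [Option.elim, Sum.elim_inl, PMF.mem_support_pure_iff] at hy
      rw [hy]; exact hx
    · simp only [Option.elim, Sum.elim_inr, PMF.mem_support_bind_iff,
        PMF.mem_support_pure_iff] at hy
      obtain ⟨⟨s', _ | m⟩, hu, rfl⟩ := hy
      · exact h _ _ hx _ hu
      · exact h _ _ hx _ hu
  · simp only [Play.advStep, Sum.elim_inr, PMF.mem_support_pure_iff] at hy hx
    rw [hy]; exact hx

theorem adv_inv {I : S → Prop} (h : ∀ s q, I s → ∀ u ∈ (C.act q s).support, I u.1)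
    (y : SA × S × Option N) (hy : I y.2.1) : ∀ u ∈ (G.adv C y).support, I u.2.1 := by
  intro u hu
  rw [Play.adv, PMF.mem_support_bind_iff] at hu
  obtain ⟨x, hx, hu⟩ := hu
  rw [PMF.mem_support_pure_iff] at hu
  have := iter_inv (I := fun x => x.elim (fun y => I y.2.1) fun y => I y.2.1)
    (advStep_inv (G := G) h) _ _ (show I y.2.1 from hy) x hx
  subst hu
  rcases x with x | x <;> exact this

theorem round_inv {I : S → Prop} (h1 : ∀ s b, I s → ∀ t ∈ (C.rcv b s).support, I t)
    (h2 : ∀ s m, I s → ∀ t ∈ (C.snd m s).support, I t)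
    (h3 : ∀ s q, I s → ∀ u ∈ (C.act q s).support, I u.1)
    (x : SE × SA × S × Option (L ⊕ N)) (hx : I x.2.2.1) :
    ∀ y ∈ (G.round C x).support, I y.2.2.1 := by
  intro y hy
  rw [Play.round, PMF.mem_support_bind_iff] at hy
  obtain ⟨⟨e, b | m | z⟩, _, hy⟩ := hy
  all_goals
    simp only [Sum.elim_inl, Sum.elim_inr, PMF.mem_support_bind_iff,
      PMF.mem_support_pure_iff] at hy
    obtain ⟨u, hu, rfl⟩ := hy
  · exact h1 _ _ hx _ hu
  · exact h2 _ _ hx _ hu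
  · exact adv_inv h3 (x.2.1, x.2.2.1, some z) hx _ hu

/-- An invariant of all operations of a system is an invariant of its executions. -/
theorem run_inv {I : S → Prop} (h1 : ∀ s b, I s → ∀ t ∈ (C.rcv b s).support, I t)
    (h2 : ∀ s m, I s → ∀ t ∈ (C.snd m s).support, I t)
    (h3 : ∀ s q, I s → ∀ u ∈ (C.act q s).support, I u.1) (s : S) (hs : I s) :
    ∀ y ∈ (G.run C s).support, I y.2.2.1 :=
  iter_inv (I := fun y : SE × SA × S × Option (L ⊕ N) => I y.2.2.1) (round_inv h1 h2 h3) _ _ hs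

variable {φ : S → PMF S'} {I : S → Prop}

theorem Intertwines.adv (h : Intertwines C C' φ I) (a : SA) (s : S) (hs : I s) (z : Option N) :
    ((G.adv C (a, s, z)).bind fun u => (φ u.2.1).bind fun s' => PMF.pure (u.1, s', u.2.2)) =
      (φ s).bind fun s' => G.adv C' (a, s', z) := by
  let Φ : (SA × S × Option N) ⊕ (SA × S × Option (L ⊕ N)) →
      PMF ((SA × S' × Option N) ⊕ (SA × S' × Option (L ⊕ N))) := fun x => x.elim
    (fun y => (φ y.2.1).bind fun s' => PMF.pure (Sum.inl (y.1, s', y.2.2)))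
    (fun y => (φ y.2.1).bind fun s' => PMF.pure (Sum.inr (y.1, s', y.2.2)))
  have key : (iter (G.advStep C) G.fuel (Sum.inl (a, s, z))).bind Φ =
      (Φ (Sum.inl (a, s, z))).bind (iter (G.advStep C') G.fuel) := by
    refine iter_intertwine (I := fun x => x.elim (fun y => I y.2.1) fun y => I y.2.1)
      (fun x hx => ?_) (advStep_inv h.act_inv) _ _ hs
    rcases x with ⟨a, s, z⟩ | ⟨a, s, z⟩
    · simp only [Sum.elim_inl] at hx
      have h1 : (Φ (Sum.inl (a, s, z))).bind (G.advStep C') =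
          (G.stepA (a, z, C.view s)).bind fun r => (φ s).bind fun s' =>
            r.2.elim (PMF.pure (Sum.inr (r.1, s', none))) fun o => o.elim
              (fun z => PMF.pure (Sum.inr (r.1, s', some (Sum.inr z))))
              (fun q => (C'.act q s').bind fun u => PMF.pure (u.2.elim
                (Sum.inl (r.1, u.1, none)) fun m => Sum.inr (r.1, u.1, some (Sum.inl m)))) := by
        rw [PMF.bind_comm]
        simp only [Φ, Sum.elim_inl, PMF.bind_bind, PMF.pure_bind, Play.advStep]
        exact PMF.bind_congr fun s' hs' => by rw [h.view s hx s' hs']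
      rw [h1, Play.advStep, Sum.elim_inl, PMF.bind_bind]
      refine congrArg (PMF.bind _) (funext fun r => ?_)
      rcases r with ⟨a', _ | z' | q⟩
      · simp only [Option.elim, PMF.pure_bind]; rfl
      · simp only [Option.elim, Sum.elim_inl, PMF.pure_bind]; rfl
      · simp only [Option.elim, Sum.elim_inr, PMF.bind_bind, PMF.pure_bind]
        have h2 := congrArg (fun p : PMF (S' × Option L) => p.bind fun u =>
          (PMF.pure (u.2.elim (Sum.inl (a', u.1, none)) fun m =>
            Sum.inr (a', u.1, some (Sum.inl m))) :
            PMF ((SA × S' × Option N) ⊕ (SA × S' × Option (L ⊕ N))))) (h.act s q hx)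
        simp only [PMF.bind_bind, PMF.pure_bind] at h2
        refine Eq.trans ?_ h2
        refine congrArg (PMF.bind _) (funext fun u => ?_)
        rcases u with ⟨s', _ | m⟩ <;> rfl
    · simp only [Φ, Play.advStep, Sum.elim_inr, PMF.pure_bind, PMF.bind_bind]
  have h2 := congrArg (fun p => p.bind fun x => PMF.pure (Play.advOut x)) key
  simp only [Φ, PMF.bind_bind, Sum.elim_inl, PMF.pure_bind] at h2
  simp only [Play.adv, PMF.bind_bind, PMF.pure_bind]
  refine Eq.trans ?_ h2
  refine congrArg (PMF.bind _) (funext fun x => ?_)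
  rcases x with x | x
  · simp only [Sum.elim_inl, PMF.bind_bind, PMF.pure_bind]; rfl
  · simp only [Sum.elim_inr, PMF.bind_bind, PMF.pure_bind]; rfl

/-- Intertwined operations of the system, where a phase of the adversary counts as an operation,
give intertwined executions. The adversaries may differ. -/
theorem bit_intertwine {SA' : Type} {Q' V' : Type} {G' : Play SA' SE V' Q' L N}
    {C' : Core S' V' Q' L} {φ : SA × S → PMF (SA' × S')} {I : SA × S → Prop}
    (he : G.e0 = G'.e0) (hstep : G.stepE = G'.stepE) (hguess : G.guess = G'.guess)
    (hrounds : G.rounds = G'.rounds)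
    (hrcv : ∀ x b, I x → ((C.rcv b x.2).bind fun s => φ (x.1, s)) =
      (φ x).bind fun y => (C'.rcv b y.2).bind fun s => PMF.pure (y.1, s))
    (hsnd : ∀ x m, I x → ((C.snd m x.2).bind fun s => φ (x.1, s)) =
      (φ x).bind fun y => (C'.snd m y.2).bind fun s => PMF.pure (y.1, s))
    (hadv : ∀ x z, I x → ((G.adv C (x.1, x.2, some z)).bind fun u =>
        (φ (u.1, u.2.1)).bind fun y => PMF.pure (y.1, y.2, u.2.2)) =
      (φ x).bind fun y => G'.adv C' (y.1, y.2, some z))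
    (hrcv_inv : ∀ x b, I x → ∀ s ∈ (C.rcv b x.2).support, I (x.1, s))
    (hsnd_inv : ∀ x m, I x → ∀ s ∈ (C.snd m x.2).support, I (x.1, s))
    (hadv_inv : ∀ x z, I x → ∀ u ∈ (G.adv C (x.1, x.2, some z)).support, I (u.1, u.2.1))
    (s : S) (hs : I (G.a0, s)) :
    G.bit C s = (φ (G.a0, s)).bind fun y =>
      (iter (G'.round C') G'.rounds (G'.e0, y.1, y.2, none)).bind fun x =>
        G'.guess (x.1, x.2.2.2) := by
  let Φ : SE × SA × S × Option (L ⊕ N) → PMF (SE × SA' × S' × Option (L ⊕ N)) := fun x =>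
    (φ (x.2.1, x.2.2.1)).bind fun y => PMF.pure (x.1, y.1, y.2, x.2.2.2)
  have key := iter_intertwine (f := G.round C) (g := G'.round C') (φ := Φ)
    (I := fun x => I (x.2.1, x.2.2.1)) (fun x hx => ?_) (fun x hx y hy => ?_) G.rounds
    (G.e0, G.a0, s, none) hs
  · have h2 := congrArg (fun p => p.bind fun x => G'.guess (x.1, x.2.2.2)) key
    simp only [Φ, PMF.bind_bind, PMF.pure_bind, PMF.bind_const] at h2
    rw [← hguess, ← he, ← hrounds]
    rw [← hguess] at h2
    exact h2
  · obtain ⟨e, a, s, i⟩ := x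
    have h1 : (Φ (e, a, s, i)).bind (G'.round C') = (G'.stepE (e, i)).bind fun r =>
        (φ (a, s)).bind fun y => r.2.elim
          (fun b => (C'.rcv b y.2).bind fun s => PMF.pure (r.1, y.1, s, none)) fun o => o.elim
            (fun m => (C'.snd m y.2).bind fun s => PMF.pure (r.1, y.1, s, none))
            (fun z => (G'.adv C' (y.1, y.2, some z)).bind fun u => PMF.pure (r.1, u)) := by
      rw [PMF.bind_comm]
      simp only [Φ, PMF.bind_bind, PMF.pure_bind, Play.round]
    rw [h1, Play.round, PMF.bind_bind, ← hstep]
    refine congrArg (PMF.bind _) (funext fun r => ?_)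
    rcases r with ⟨e', b | m | z⟩
    · have := congrArg (fun p : PMF (SA' × S') => p.bind fun y =>
        (PMF.pure (e', y.1, y.2, none) : PMF (SE × SA' × S' × Option (L ⊕ N)))) (hrcv _ b hx)
      simpa only [Φ, Sum.elim_inl, PMF.bind_bind, PMF.pure_bind] using this
    · have := congrArg (fun p : PMF (SA' × S') => p.bind fun y =>
        (PMF.pure (e', y.1, y.2, none) : PMF (SE × SA' × S' × Option (L ⊕ N)))) (hsnd _ m hx)
      simpa only [Φ, Sum.elim_inl, Sum.elim_inr, PMF.bind_bind, PMF.pure_bind] using this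
    · have := congrArg (fun p : PMF (SA' × S' × Option (L ⊕ N)) => p.bind fun y =>
        (PMF.pure (e', y) : PMF (SE × SA' × S' × Option (L ⊕ N)))) (hadv _ z hx)
      simpa only [Φ, Sum.elim_inr, PMF.bind_bind, PMF.pure_bind] using this
  · rw [Play.round, PMF.mem_support_bind_iff] at hy
    obtain ⟨⟨e, b | m | z⟩, _, hy⟩ := hy
    all_goals
      simp only [Sum.elim_inl, Sum.elim_inr, PMF.mem_support_bind_iff,
        PMF.mem_support_pure_iff] at hy
      obtain ⟨u, hu, rfl⟩ := hy
    · exact hrcv_inv _ _ hx _ hu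
    · exact hsnd_inv _ _ hx _ hu
    · exact hadv_inv _ _ hx _ hu

/-- Executions of intertwined systems have the same outcome. -/
theorem Intertwines.bit (h : Intertwines C C' φ I) (s : S) (hs : I s) :
    G.bit C s = (φ s).bind (G.bit C') := by
  have := bit_intertwine (G := G) (G' := G) (C := C) (C' := C')
    (φ := fun x => (φ x.2).bind fun s' => PMF.pure (x.1, s')) (I := fun x => I x.2) rfl rfl rfl rfl
    (fun x b hx => by
      simp only [PMF.bind_bind, PMF.pure_bind]
      rw [← PMF.bind_bind, h.rcv _ _ hx, PMF.bind_bind])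
    (fun x m hx => by
      simp only [PMF.bind_bind, PMF.pure_bind]
      rw [← PMF.bind_bind, h.snd _ _ hx, PMF.bind_bind])
    (fun x z hx => by
      simp only [PMF.bind_bind, PMF.pure_bind]
      exact h.adv x.1 x.2 hx (some z))
    (fun x b hx => h.rcv_inv _ _ hx) (fun x m hx => h.snd_inv _ _ hx)
    (fun x z hx => adv_inv h.act_inv _ hx) s hs
  rw [this]
  simp only [PMF.bind_bind, PMF.pure_bind]
  rfl

end Compare

/-! ### Executions of close systems -/

section NearRun

variable {SA SE S V Q L N : Type} {G : Play SA SE V Q L N} {C C' : Core S V Q L}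

/-- If the operations of two systems with the same states are close outside of an absorbing set
of bad states, then so are their executions. -/
theorem run_near {I : S → Prop} {bad : Set S} {ε : ℝ≥0∞} (hv : C.view = C'.view)
    (h1 : ∀ s b, I s → Near bad (C.rcv b s) (C'.rcv b s) ε)
    (h2 : ∀ s m, I s → Near bad (C.snd m s) (C'.snd m s) ε)
    (h3 : ∀ s q, I s → Near {u | u.1 ∈ bad} (C.act q s) (C'.act q s) ε)
    (i1 : ∀ s b, I s → ∀ t ∈ (C.rcv b s).support, I t)
    (i2 : ∀ s m, I s → ∀ t ∈ (C.snd m s).support, I t)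
    (i3 : ∀ s q, I s → ∀ u ∈ (C.act q s).support, I u.1)
    (b1 : ∀ s b, s ∈ bad → ∀ t ∈ (C.rcv b s).support, t ∈ bad)
    (b2 : ∀ s m, s ∈ bad → ∀ t ∈ (C.snd m s).support, t ∈ bad)
    (b3 : ∀ s q, s ∈ bad → ∀ u ∈ (C.act q s).support, u.1 ∈ bad) (s : S) (hs : I s) :
    Near {x | x.2.2.1 ∈ bad} (G.run C s) (G.run C' s) (G.rounds * ((G.fuel + 1) * ε)) := by
  have hε : ε ≤ (G.fuel + 1) * ε := by
    rw [add_mul, one_mul]; exact le_add_self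
  have hadv : ∀ y : SA × S × Option N, I y.2.1 →
      Near {u | u.2.1 ∈ bad} (G.adv C y) (G.adv C' y) ((G.fuel + 1) * ε) := by
    intro y hy
    have := iter_near (f := G.advStep C) (g := G.advStep C')
      (I := fun x => x.elim (fun y : SA × S × Option N => I y.2.1)
        fun y : SA × S × Option (L ⊕ N) => I y.2.1)
      (s := {x | x.elim (fun y : SA × S × Option N => y.2.1 ∈ bad)
        fun y : SA × S × Option (L ⊕ N) => y.2.1 ∈ bad}) (ε := ε)
      (fun x hx => ?_) (advStep_inv (G := G) (I := (· ∈ bad)) b3) (advStep_inv i3) G.fuel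
      (Sum.inl y) hy
    · refine Near.mono (Near.bind_of_mem this fun x hx u hu => ?_)
        (mul_le_mul_left (le_add_right le_rfl) _)
      rw [PMF.mem_support_pure_iff] at hu
      subst hu
      rcases x with x | x <;> exact hx
    · rcases x with ⟨a, s, z⟩ | ⟨a, s, z⟩
      · simp only [Sum.elim_inl] at hx
        simp only [Play.advStep, Sum.elim_inl, hv]
        refine Near.bind_left' fun r _ => ?_
        rcases r with ⟨a', _ | z' | q⟩
        · exact Near.refl _ _ _
        · exact Near.refl _ _ _
        · refine Near.bind_of_mem (h3 s q hx) fun u hu x hx => ?_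
          rw [PMF.mem_support_pure_iff] at hx
          subst hx
          rcases u with ⟨s', _ | m⟩ <;> exact hu
      · exact Near.refl _ _ _
  refine iter_near (I := fun x : SE × SA × S × Option (L ⊕ N) => I x.2.2.1) (fun x hx => ?_)
    (round_inv (I := (· ∈ bad)) b1 b2 b3) (round_inv i1 i2 i3) _ _ hs
  rw [Play.round, Play.round]
  refine Near.bind_left' fun r _ => ?_
  rcases r with ⟨e', b | m | z⟩
  · refine Near.bind_of_mem ((h1 _ b hx).mono hε) fun u hu x hx => ?_
    rw [PMF.mem_support_pure_iff] at hx; subst hx; exact hu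
  · refine Near.bind_of_mem ((h2 _ m hx).mono hε) fun u hu x hx => ?_
    rw [PMF.mem_support_pure_iff] at hx; subst hx; exact hu
  · refine Near.bind_of_mem (hadv (x.2.1, x.2.2.1, some z) hx) fun u hu x hx => ?_
    rw [PMF.mem_support_pure_iff] at hx; subst hx; exact hu

end NearRun

/-! ### Systems in which the receiver chooses one of two presampled values -/

/-- A system in which the input bit of the receiver selects one of two values of type `R` that have
been sampled in advance. `U` holds the other data before the choice, and `K` the state
after the choice. Before the choice, the adversary cannot act. -/
structure ChoiceSys (U R K V Q L : Type) where
  choose : Bool → R → U → K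
  sndU : L × L → U → U
  viewU : U → V
  sndK : L × L → K → K
  viewK : K → V
  actK : Q → K → PMF (K × Option L)

namespace ChoiceSys

variable {U R K V Q L : Type} (W : ChoiceSys U R K V Q L)

/-- The system: the left summand holds the state before the choice, with the two presampled values. -/
def core : Core ((U × R × R) ⊕ K) V Q L where
  rcv b x := PMF.pure (x.elim
    (fun y => Sum.inr (bif b then W.choose true y.2.2 y.1 else W.choose false y.2.1 y.1))
    fun k => Sum.inr k)
  snd m x := PMF.pure (x.elim (fun y => Sum.inl (W.sndU m y.1, y.2)) fun k => Sum.inr (W.sndK m k))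
  view x := x.elim (fun y => W.viewU y.1) fun k => W.viewK k
  act q x := x.elim (fun y => PMF.pure (Sum.inl y, none)) fun k =>
    (W.actK q k).bind fun u => PMF.pure (Sum.inr u.1, u.2)

variable {SA SE N : Type} (G : Play SA SE V Q L N)

/-- A system without reactions that shows what the adversary sees before the choice of the
receiver. -/
def idle (u : U) : Core Unit V Q L where
  rcv _ _ := PMF.pure ()
  snd _ _ := PMF.pure ()
  view _ := W.viewU u
  act _ _ := PMF.pure ((), none)

theorem adv_inl (a : SA) (y : U × R × R) (z : Option N) :
    G.adv W.core (a, Sum.inl y, z) = (G.adv (W.idle y.1) (a, (), z)).bind fun u =>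
      PMF.pure (u.1, Sum.inl y, u.2.2) := by
  let Φ : (SA × Unit × Option N) ⊕ (SA × Unit × Option (L ⊕ N)) →
      PMF ((SA × ((U × R × R) ⊕ K) × Option N) ⊕ (SA × ((U × R × R) ⊕ K) × Option (L ⊕ N))) :=
    fun x => PMF.pure (x.elim (fun x => Sum.inl (x.1, Sum.inl y, x.2.2))
      fun x => Sum.inr (x.1, Sum.inl y, x.2.2))
  have key := iter_intertwine (f := G.advStep (W.idle y.1)) (g := G.advStep W.core) (φ := Φ)
    (I := fun _ => True) (fun x _ => ?_) (fun _ _ _ _ => trivial) G.fuel (Sum.inl (a, (), z))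
    trivial
  · have h2 := congrArg (fun p => p.bind fun x => PMF.pure (Play.advOut x)) key
    simp only [Φ, PMF.bind_bind, Sum.elim_inl, PMF.pure_bind] at h2
    simp only [Play.adv, PMF.bind_bind, PMF.pure_bind]
    refine h2.symm.trans ?_
    refine congrArg (PMF.bind _) (funext fun x => ?_)
    rcases x with x | x <;> rfl
  · rcases x with ⟨a, s, z⟩ | ⟨a, s, z⟩
    · simp only [Φ, Play.advStep, Sum.elim_inl, PMF.bind_bind, PMF.pure_bind]
      refine congrArg (PMF.bind _) (funext fun r => ?_)
      rcases r with ⟨a', _ | z' | q⟩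
      · simp only [Option.elim, PMF.pure_bind]; rfl
      · simp only [Option.elim, Sum.elim_inl, PMF.pure_bind]; rfl
      · simp only [Option.elim, Sum.elim_inr, PMF.pure_bind, idle, core, Sum.elim_inl]
    · simp only [Φ, Play.advStep, Sum.elim_inr, PMF.pure_bind]

/-- Since only one of the two presampled values is ever used, the probability of each outcome is
the sum of a function of the first value and a function of the second value. -/
theorem bit_add (u : U) (p₀ p₁ q₀ q₁ : R) (b : Bool) :
    G.bit W.core (Sum.inl (u, p₀, p₁)) b + G.bit W.core (Sum.inl (u, q₀, q₁)) b =
      G.bit W.core (Sum.inl (u, p₀, q₁)) b + G.bit W.core (Sum.inl (u, q₀, p₁)) b := by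
  let g : SE × SA × ((U × R × R) ⊕ K) × Option (L ⊕ N) → ℝ≥0∞ := fun x => G.guess (x.1, x.2.2.2) b
  have key : ∀ t e a i u,
      expect (iter (G.round W.core) t (e, a, Sum.inl (u, p₀, p₁), i)) g +
        expect (iter (G.round W.core) t (e, a, Sum.inl (u, q₀, q₁), i)) g =
      expect (iter (G.round W.core) t (e, a, Sum.inl (u, p₀, q₁), i)) g +
        expect (iter (G.round W.core) t (e, a, Sum.inl (u, q₀, p₁), i)) g := by
    intro t
    induction t with
    | zero => intro e a i u; simp only [iter, expect_pure]; rfl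
    | succ t ih =>
      intro e a i u
      simp only [iter, Play.round, PMF.bind_bind, expect_bind (G.stepE _), ← expect_add]
      refine expect_congr fun r _ => ?_
      rcases r with ⟨e', b | m | z⟩
      · simp only [Sum.elim_inl, core, PMF.pure_bind]
        cases b
        · rfl
        · exact add_comm _ _
      · simp only [Sum.elim_inl, Sum.elim_inr, core, PMF.pure_bind]
        exact ih _ _ _ _
      · simp only [Sum.elim_inr, adv_inl, PMF.bind_bind, PMF.pure_bind,
          expect_bind (G.adv _ _), ← expect_add]
        exact expect_congr fun w _ => ih _ _ _ _
  have h : ∀ s, G.bit W.core s b = expect (G.run W.core s) g := fun s => by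
    rw [Play.bit, PMF.bind_apply]; rfl
  simp only [h, Play.run]
  exact key _ _ _ _ _

end ChoiceSys

theorem ChoiceSys.effCore {U R K V Q : ℕ → Type} {ℓ : ℕ → ℕ} [∀ κ, BitCode (U κ)]
    [∀ κ, BitCode (R κ)] [∀ κ, BitCode (K κ)] [∀ κ, BitCode (V κ)] [∀ κ, BitCode (Q κ)]
    [PolyLen U] [PolyLen R] [PolyLen K] [PolyLen V] [PolyLen fun κ => Bits (ℓ κ)]
    {W : ∀ κ, ChoiceSys (U κ) (R κ) (K κ) (V κ) (Q κ) (Bits (ℓ κ))}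
    (hc : ∀ b, EffD fun κ (p : R κ × U κ) => (W κ).choose b p.1 p.2)
    (hsU : EffD fun κ (p : (Bits (ℓ κ) × Bits (ℓ κ)) × U κ) => (W κ).sndU p.1 p.2)
    (hvU : EffD fun κ (u : U κ) => (W κ).viewU u)
    (hsK : EffD fun κ (p : (Bits (ℓ κ) × Bits (ℓ κ)) × K κ) => (W κ).sndK p.1 p.2)
    (hvK : EffD fun κ (k : K κ) => (W κ).viewK k)
    (haK : Eff fun κ (p : Q κ × K κ) => (W κ).actK p.1 p.2) :
    EffCore fun κ => (W κ).core where
  rcv := EffD.sumElim EffD.id.snd (EffD.inr (EffD.cond EffD.id.fst.fst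
      ((hc true).comp (EffD.id.snd.snd.snd.mk EffD.id.snd.fst))
      ((hc false).comp (EffD.id.snd.snd.fst.mk EffD.id.snd.fst)))) (EffD.inr EffD.id.snd)
  snd := EffD.sumElim EffD.id.snd (EffD.inl (EffD.mk (hsU.comp (EffD.id.fst.fst.mk EffD.id.snd.fst))
    EffD.id.snd.snd)) (EffD.inr (hsK.comp (EffD.id.fst.fst.mk EffD.id.snd)))
  view := EffD.sumElim EffD.id (hvU.comp EffD.id.snd.fst) (hvK.comp EffD.id.snd)
  act := Eff.sumElim EffD.id.snd (EffD.id.snd.inl.mk (EffD.const fun _ => none))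
    (Eff.bind (haK.comp (EffD.id.fst.fst.mk EffD.id.snd)) (EffD.id.snd.fst.inr.mk EffD.id.snd.snd))

section ChoiceHop

variable {ℓ n : ℕ → ℕ} {Wt : System ℓ} (A : Adversary Wt n) (E : Environment ℓ n)
  {U R K Cr : ℕ → Type} [∀ κ, BitCode (U κ)] [∀ κ, BitCode (R κ)] [∀ κ, BitCode (K κ)]
  [∀ κ, BitCode (Cr κ)] [PolyLen U] [PolyLen R] [PolyLen K] [PolyLen Cr]
  {W : ∀ κ, ChoiceSys (U κ) (R κ) (K κ) (Wt.View κ) (Wt.Act κ) (Bits (ℓ κ))}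

/-- The outcome depends, up to indistinguishability, only on the distributions of the two
presampled values taken separately. The reason is the additivity `ChoiceSys.bit_add`: one of the
values can be replaced by a constant. -/
theorem choice_indist (hW : EffCore fun κ => (W κ).core) {u₀ : ∀ κ, Cr κ → U κ} (hu : EffD u₀)
    {J J' : ∀ κ, PMF (Cr κ × R κ × R κ)}
    (h₀ : CompIndist (fun κ => (J κ).map fun x => (x.1, x.2.1))
      (fun κ => (J' κ).map fun x => (x.1, x.2.1)))
    (h₁ : CompIndist (fun κ => (J κ).map fun x => (x.1, x.2.2))
      (fun κ => (J' κ).map fun x => (x.1, x.2.2))) :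
    Negl fun κ =>
      |prob ((J κ).bind fun x => (play A E κ).bit (W κ).core (Sum.inl (u₀ κ x.1, x.2))) {true} -
        prob ((J' κ).bind fun x => (play A E κ).bit (W κ).core (Sum.inl (u₀ κ x.1, x.2)))
          {true}| := by
  -- a constant that takes the place of the value that is not under consideration
  have d : ∀ κ, R κ := fun κ => (J κ).support_nonempty.some.2.1
  let D : ∀ κ, Cr κ × R κ × R κ → PMF Bool := fun κ x =>
    (play A E κ).bit (W κ).core (Sum.inl (u₀ κ x.1, x.2))
  have hD : Eff D := (eff_bit A E hW).comp
    (EffD.inl (EffD.mk (hu.comp EffD.id.fst) EffD.id.snd))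
  have hd : EffD fun κ (_ : Cr κ × R κ) => d κ := EffD.const d
  let D0 : ∀ κ, Cr κ × R κ → PMF Bool := fun κ x => D κ (x.1, x.2, d κ)
  let D1 : ∀ κ, Cr κ × R κ → PMF Bool := fun κ x => D κ (x.1, d κ, x.2)
  let D2 : ∀ κ, Cr κ × R κ → PMF Bool := fun κ x => D κ (x.1, d κ, d κ)
  have n0 := h₀ D0 (Eff.polyTime (hD.comp (EffD.id.fst.mk (EffD.id.snd.mk hd))))
  have n1 := h₁ D1 (Eff.polyTime (hD.comp (EffD.id.fst.mk (hd.mk EffD.id.snd))))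
  have n2 := h₀ D2 (Eff.polyTime (hD.comp (EffD.id.fst.mk (hd.mk hd))))
  have split : ∀ κ (J : PMF (Cr κ × R κ × R κ)),
      prob (J.bind (D κ)) {true} = prob ((J.map fun x => (x.1, x.2.1)).bind (D0 κ)) {true} +
        prob ((J.map fun x => (x.1, x.2.2)).bind (D1 κ)) {true} -
        prob ((J.map fun x => (x.1, x.2.1)).bind (D2 κ)) {true} := by
    intro κ J
    rw [eq_sub_iff_add_eq]
    simp only [prob_true]
    rw [← ENNReal.toReal_add (PMF.apply_ne_top _ _) (PMF.apply_ne_top _ _),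
      ← ENNReal.toReal_add (PMF.apply_ne_top _ _) (PMF.apply_ne_top _ _)]
    congr 1
    simp only [PMF.bind_map, PMF.bind_apply, ← ENNReal.tsum_add, ← mul_add, Function.comp_apply]
    congr 1; funext x; congr 1
    exact (W κ).bit_add _ _ _ _ _ _ _
  refine ((n0.add n1).add n2).of_le (fun _ => abs_nonneg _) fun κ => ?_
  have e1 := split κ (J κ)
  have e2 := split κ (J' κ)
  have tri : ∀ a b c a' b' c' : ℝ,
      |a + b - c - (a' + b' - c')| ≤ |a - a'| + |b - b'| + |c - c'| := fun a b c a' b' c' => by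
    rw [show a + b - c - (a' + b' - c') = (a - a') + (b - b') - (c - c') by ring]
    exact (abs_sub _ _).trans (add_le_add_left (abs_add_le _ _) _)
  exact (congrArg₂ (fun a b => |a - b|) e1 e2).trans_le (tri _ _ _ _ _ _)

end ChoiceHop

/-! ### Simulators -/

section Ideal

variable {ℓ : ℕ} (c : Party → Bool)

/-- What the adversary sees of the functionality. -/
abbrev OTView (ℓ : ℕ) : Type := Bool × Bool × Bool × Option (Bits ℓ)

/-- The functionality before any input. -/
def OTState.init (ℓ : ℕ) : OTState ℓ := ⟨none, none, false, none⟩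

/-- What the adversary sees of the functionality. -/
def OTState.view (i : OTState ℓ) : OTView ℓ :=
  (i.choice.isSome, i.messages.isSome, i.halted, i.leaked)

/-- The reaction to an input of the receiver. -/
def OTState.rcv (b : Bool) (i : OTState ℓ) : OTState ℓ := if c .receiver then i else i.setChoice b

/-- The reaction to an input of the sender. -/
def OTState.snd (m : Bits ℓ × Bits ℓ) (i : OTState ℓ) : OTState ℓ :=
  if c .sender then i else i.setMessages m

/-- The reaction to the adversary. -/
def OTState.act : OTAct ℓ → OTState ℓ → OTState ℓ × Option (Bits ℓ)
  | .receiver b, i => (if c .receiver then i.setChoice b else i, none)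
  | .sender m, i => (if c .sender then i.setMessages m else i, none)
  | .answer, i => i.answer c

/-- The functionality with dummy parties, for strings of length `ℓ`. -/
def otCore (ℓ : ℕ) : Core (OTState ℓ) (OTView ℓ) (OTAct ℓ) (Bits ℓ) where
  rcv b i := PMF.pure (i.rcv c b)
  snd m i := PMF.pure (i.snd c m)
  view i := i.view
  act q i := PMF.pure (i.act c q)

theorem idealOT_core (ℓ : ℕ → ℕ) (κ : ℕ) : (idealOT ℓ c).core κ = otCore c (ℓ κ) := by
  have : ∀ q s, (idealOT ℓ c).act κ q s = PMF.pure (OTState.act c q s) := by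
    intro q s; cases q <;> rfl
  unfold System.core otCore
  congr 1
  funext q s; exact this q s

/-- The action `q` followed by the action `q'`, unless the functionality answers to the first one
with an output. -/
def OTState.act₂ (q q' : OTAct ℓ) (i : OTState ℓ) : OTState ℓ × Option (Bits ℓ) :=
  (i.act c q).2.elim ((i.act c q).1.act c q') fun m => ((i.act c q).1, some m)

end Ideal

/-- The data of a simulator that runs an adversary against a protocol: its internal state `T` and
how it is sampled; an action `pre` on the functionality that is carried out before each
activation of the adversary; the update of the internal state after that; the view
of the adversary; and the reaction to an action of the adversary, with an action on the
functionality. -/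
structure Sim (T V Q : Type) (ℓ : ℕ) where
  init : PMF T
  pre : OTAct ℓ
  upd : T → OTView ℓ → PMF T
  view : T → OTView ℓ → V
  act : Q → T → OTView ℓ → PMF (T × OTAct ℓ)

/-- The state of a simulator: that of the adversary, the internal state (`none` before the
first activation), whether the action `pre` has been carried out, and the pending message
of the environment to the adversary. -/
abbrev SimSt (SA T N : Type) : Type := SA × Option T × Bool × Option N

section SimStep

variable {SA SE T V Q N : Type} {ℓ : ℕ} (M : Sim T V Q ℓ)

/-- The activation of a simulator. It alternates between the action `pre` and an activation of the
adversary; a message of the environment always restarts this. -/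
def Sim.step (stepA : SA × Option N × V → PMF (SA × Option (N ⊕ Q)))
    (x : SimSt SA T N × Option N × OTView ℓ) : PMF (SimSt SA T N × Option (N ⊕ OTAct ℓ)) :=
  (x.1.2.1.elim M.init fun T => PMF.pure T).bind fun T =>
    bif (bif x.2.1.isSome then true else bif x.1.2.2.1 then false else true) then
      PMF.pure ((x.1.1, some T, true, x.2.1), some (Sum.inr M.pre))
    else (M.upd T x.2.2).bind fun T' => (stepA (x.1.1, x.1.2.2.2, M.view T' x.2.2)).bind fun r =>
      r.2.elim (PMF.pure ((r.1, some T', false, none), none)) fun o => o.elim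
        (fun z => PMF.pure ((r.1, some T', false, none), some (Sum.inl z)))
        fun q => (M.act q T' x.2.2).bind fun w =>
          PMF.pure ((r.1, some w.1, false, none), some (Sum.inr w.2))

/-- The simulator in place of the adversary. It is activated once at the start of a phase, and twice
for each activation of the adversary. -/
def Play.sim (G : Play SA SE V Q (Bits ℓ) N) :
    Play (SimSt SA T N) SE (OTView ℓ) (OTAct ℓ) (Bits ℓ) N where
  a0 := (G.a0, none, false, none)
  e0 := G.e0
  stepA := M.step G.stepA
  fuel := 2 * G.fuel + 1
  stepE := G.stepE
  guess := G.guess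
  rounds := G.rounds

/-- `φ` maps each pair of states of the simulator and the functionality to a distribution on
the states of the system `H`, so that the simulation is perfect. Three invariants
are used: `I₀` always holds between phases, `I₁` after the action `pre`, and `I₂` after the update,
when the adversary is activated. -/
structure Simulates {S : Type} (c : Party → Bool) (H : Core S V Q (Bits ℓ))
    (φ : T → OTState ℓ → PMF S) (I₀ I₁ I₂ : T → OTState ℓ → Prop) : Prop where
  init : ∀ t ∈ M.init.support, I₀ t (OTState.init ℓ)
  rcv : ∀ t i b, I₀ t i → φ t (i.rcv c b) = (φ t i).bind (H.rcv b) ∧ I₀ t (i.rcv c b)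
  snd : ∀ t i m, I₀ t i → φ t (i.snd c m) = (φ t i).bind (H.snd m) ∧ I₀ t (i.snd c m)
  pre : ∀ t i, I₀ t i → (i.act c M.pre).2 = none ∧ φ t (i.act c M.pre).1 = φ t i ∧
    I₁ t (i.act c M.pre).1
  weaken₁ : ∀ t i, I₁ t i → I₀ t i
  weaken₂ : ∀ t i, I₂ t i → I₀ t i
  upd : ∀ t i, I₁ t i → ((M.upd t i.view).bind fun t' => φ t' i) = φ t i ∧
    ∀ t' ∈ (M.upd t i.view).support, I₂ t' i
  view : ∀ t i, I₂ t i → ∀ s ∈ (φ t i).support, H.view s = M.view t i.view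
  act : ∀ t i q, I₂ t i →
    ((M.act q t i.view).bind fun w => (φ w.1 (i.act₂ c w.2 M.pre).1).bind fun s =>
      PMF.pure (s, (i.act₂ c w.2 M.pre).2)) = (φ t i).bind (H.act q) ∧
    ∀ w ∈ (M.act q t i.view).support, I₁ w.1 (i.act₂ c w.2 M.pre).1

variable {M} {S : Type} {c : Party → Bool} {H : Core S V Q (Bits ℓ)} {φ : T → OTState ℓ → PMF S}
  {I₀ I₁ I₂ : T → OTState ℓ → Prop}

/-- The distribution on the states of the adversary and the system `H` that corresponds to a state
of the simulator and the functionality. -/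
def Sim.states (M : Sim T V Q ℓ) (φ : T → OTState ℓ → PMF S) (x : SimSt SA T N × OTState ℓ) :
    PMF (SA × S) :=
  (x.1.2.1.elim M.init fun T => PMF.pure T).bind fun t => (φ t x.2).bind fun s =>
    PMF.pure (x.1.1, s)

/-- The invariant `I` for the states of a simulator. -/
def Sim.Inv (M : Sim T V Q ℓ) (I : T → OTState ℓ → Prop) (x : SimSt SA T N × OTState ℓ) : Prop :=
  ∀ t ∈ (x.1.2.1.elim M.init fun T => PMF.pure T).support, I t x.2

theorem Sim.inv_some {I : T → OTState ℓ → Prop} {a : SA} {t : T} {f : Bool} {z : Option N}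
    {i : OTState ℓ} : M.Inv I ((a, some t, f, z), i) ↔ I t i := by
  simp [Sim.Inv]

theorem Sim.states_some {a : SA} {t : T} {f : Bool} {z : Option N} {i : OTState ℓ} :
    M.states φ ((a, some t, f, z), i) = (φ t i).bind fun s => PMF.pure (a, s) := by
  simp only [Sim.states, Option.elim, PMF.pure_bind]

variable {G : Play SA SE V Q (Bits ℓ) N}

theorem Sim.step_pre (x : SimSt SA T N × OTState ℓ) (z : Option N)
    (h : z.isSome = true ∨ x.1.2.2.1 = false) :
    (G.sim M).advStep (otCore c ℓ) (Sum.inl (x.1, x.2, z)) =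
      (x.1.2.1.elim M.init fun T => PMF.pure T).bind fun t => PMF.pure
        ((x.2.act c M.pre).2.elim (Sum.inl ((x.1.1, some t, true, z), (x.2.act c M.pre).1, none))
          fun m => Sum.inr ((x.1.1, some t, true, z), (x.2.act c M.pre).1, some (Sum.inl m))) := by
  have h' : (bif z.isSome then true else bif x.1.2.2.1 then false else true) = true := by
    rcases h with h | h <;> rw [h] <;> simp
  simp only [Play.advStep, Sum.elim_inl, Play.sim, Sim.step, h', cond_true, PMF.bind_bind,
    PMF.pure_bind, Option.elim_some, Sum.elim_inr, otCore]

/-- Two activations of the simulator in the phase correspond to one of the adversary: one for the action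
`pre`, and one that runs the adversary. -/
theorem Simulates.iter_advStep (h : Simulates M c H φ I₀ I₁ I₂) (k : ℕ) (a : SA) (t : T)
    (i : OTState ℓ) (z : Option N) (hI : I₁ t i) :
    (((iter ((G.sim M).advStep (otCore c ℓ)) (2 * k) (Sum.inl ((a, some t, true, z), i, none))).bind
      fun x => PMF.pure (Play.advOut x)).bind fun u => (M.states φ (u.1, u.2.1)).bind fun y =>
        PMF.pure (y.1, y.2, u.2.2)) =
    ((φ t i).bind fun s => (iter (G.advStep H) k (Sum.inl (a, s, z))).bind fun x =>
      PMF.pure (Play.advOut x)) ∧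
    ∀ x ∈ (iter ((G.sim M).advStep (otCore c ℓ)) (2 * k)
      (Sum.inl ((a, some t, true, z), i, none))).support,
      M.Inv I₀ ((Play.advOut x).1, (Play.advOut x).2.1) := by
  induction k generalizing a t i z with
  | zero =>
    constructor
    · simp only [iter, PMF.pure_bind, Play.advOut, Sum.elim_inl, Sim.states_some,
        PMF.bind_bind]
    · intro x hx
      rw [mul_zero, iter, PMF.mem_support_pure_iff] at hx
      subst hx
      exact Sim.inv_some.2 (h.weaken₁ _ _ hI)
  | succ k ih =>
    obtain ⟨hu, hu'⟩ := h.upd t i hI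
    have e0 : (G.sim M).advStep (otCore c ℓ) (Sum.inl ((a, some t, true, z), i, none)) =
        (M.upd t i.view).bind fun t' => (G.stepA (a, z, M.view t' i.view)).bind fun r =>
          r.2.elim (PMF.pure (Sum.inr ((r.1, some t', false, none), i, none))) fun o => o.elim
            (fun z => PMF.pure (Sum.inr ((r.1, some t', false, none), i, some (Sum.inr z))))
            fun q => (M.act q t' i.view).bind fun w => PMF.pure ((i.act c w.2).2.elim
              (Sum.inl ((r.1, some w.1, false, none), (i.act c w.2).1, none))
              fun m => Sum.inr ((r.1, some w.1, false, none), (i.act c w.2).1,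
                some (Sum.inl m))) := by
      simp only [Play.advStep, Sum.elim_inl, Play.sim, Sim.step, Option.isSome, cond_false,
        cond_true, Option.elim_some, PMF.pure_bind, PMF.bind_bind]
      refine congrArg (PMF.bind _) (funext fun t' => congrArg (PMF.bind _) (funext fun r => ?_))
      rcases r with ⟨a', _ | z' | q⟩
      · simp only [Option.elim, PMF.pure_bind]
      · simp only [Option.elim, Sum.elim_inl, PMF.pure_bind]
      · simp only [Option.elim, Sum.elim_inr, PMF.pure_bind, PMF.bind_bind, otCore]
    rw [show 2 * (k + 1) = 2 * k + 1 + 1 by ring, iter, e0]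
    constructor
    · have e1 : ((φ t i).bind fun s => (iter (G.advStep H) (k + 1) (Sum.inl (a, s, z))).bind
          fun x => PMF.pure (Play.advOut x)) =
          (M.upd t i.view).bind fun t' => (G.stepA (a, z, M.view t' i.view)).bind fun r =>
            (φ t' i).bind fun s => r.2.elim (PMF.pure (r.1, s, none)) fun o => o.elim
              (fun z => PMF.pure (r.1, s, some (Sum.inr z)))
              fun q => (H.act q s).bind fun u => u.2.elim
                ((iter (G.advStep H) k (Sum.inl (r.1, u.1, none))).bind fun x =>
                  PMF.pure (Play.advOut x)) fun m => PMF.pure (r.1, u.1, some (Sum.inl m)) := by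
        rw [← hu, PMF.bind_bind]
        refine PMF.bind_congr fun t' ht' => ?_
        rw [PMF.bind_comm (G.stepA _)]
        refine PMF.bind_congr fun s hs => ?_
        rw [← h.view t' i (hu' t' ht') s hs, iter, Play.advStep, Sum.elim_inl, PMF.bind_bind,
          PMF.bind_bind]
        refine congrArg (PMF.bind _) (funext fun r => ?_)
        rcases r with ⟨a', _ | z' | q⟩
        · simp only [Option.elim, PMF.pure_bind, iter_advStep_inr]; rfl
        · simp only [Option.elim, Sum.elim_inl, PMF.pure_bind, iter_advStep_inr]; rfl
        · simp only [Option.elim, Sum.elim_inr, PMF.pure_bind, PMF.bind_bind]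
          refine congrArg (PMF.bind _) (funext fun u => ?_)
          rcases u with ⟨s', _ | m⟩
          · rfl
          · simp only [PMF.pure_bind, iter_advStep_inr]; rfl
      rw [e1]
      simp only [PMF.bind_bind]
      refine PMF.bind_congr fun t' ht' => ?_
      refine congrArg (PMF.bind _) (funext fun r => ?_)
      rcases r with ⟨a', _ | z' | q⟩
      · simp only [Option.elim, PMF.pure_bind, iter_advStep_inr, Play.advOut, Sum.elim_inr,
          Sim.states_some, PMF.bind_bind]
      · simp only [Option.elim, Sum.elim_inl, PMF.pure_bind, iter_advStep_inr, Play.advOut,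
          Sum.elim_inr, Sim.states_some, PMF.bind_bind]
      · simp only [Option.elim_some, Sum.elim_inr, PMF.pure_bind, PMF.bind_bind]
        obtain ⟨ha, ha'⟩ := h.act t' i q (hu' t' ht')
        have ha2 := congrArg (fun p : PMF (S × Option (Bits ℓ)) => p.bind fun u => u.2.elim
          ((iter (G.advStep H) k (Sum.inl (a', u.1, none))).bind fun x =>
            PMF.pure (Play.advOut x)) fun m => PMF.pure (a', u.1, some (Sum.inl m))) ha
        simp only [PMF.bind_bind, PMF.pure_bind] at ha2
        refine Eq.trans ?_ ha2
        refine PMF.bind_congr fun w hw => ?_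
        have ha'' := ha' w hw
        unfold OTState.act₂ at ha'' ⊢
        cases hw1 : (i.act c w.2).2 with
        | some m =>
          simp only [Option.elim_some, iter_advStep_inr, PMF.pure_bind, Play.advOut,
            Sum.elim_inr, Sim.states_some, PMF.bind_bind]
        | none =>
          simp only [hw1, Option.elim_none] at ha'' ⊢
          rw [iter, Sim.step_pre ((a', some w.1, false, none), (i.act c w.2).1) none (Or.inr rfl)]
          simp only [Option.elim_some, PMF.pure_bind]
          cases hw2 : (((i.act c w.2).1).act c M.pre).2 with
          | some m =>
            simp only [Option.elim_some, iter_advStep_inr, PMF.pure_bind, Play.advOut,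
              Sum.elim_inr, Sim.states_some, PMF.bind_bind]
          | none =>
            simp only [Option.elim_none]
            rw [← (ih a' w.1 _ none ha'').1]
            simp only [PMF.bind_bind, PMF.pure_bind]
    · intro x hx
      simp only [PMF.mem_support_bind_iff] at hx
      obtain ⟨y, ⟨t', ht', ⟨a', o⟩, hr, hy⟩, hx⟩ := hx
      have hfin : ∀ y' : SimSt SA T N × OTState ℓ × Option (Bits ℓ ⊕ N), y = Sum.inr y' →
          M.Inv I₀ (y'.1, y'.2.1) → M.Inv I₀ ((Play.advOut x).1, (Play.advOut x).2.1) := by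
        rintro y' rfl hi
        rw [iter_advStep_inr, PMF.mem_support_pure_iff] at hx
        subst hx
        exact hi
      rcases o with _ | z' | q
      · rw [Option.elim_none, PMF.mem_support_pure_iff] at hy
        exact hfin _ hy (Sim.inv_some.2 (h.weaken₂ _ _ (hu' t' ht')))
      · rw [Option.elim_some, Sum.elim_inl, PMF.mem_support_pure_iff] at hy
        exact hfin _ hy (Sim.inv_some.2 (h.weaken₂ _ _ (hu' t' ht')))
      · rw [Option.elim_some, Sum.elim_inr, PMF.mem_support_bind_iff] at hy
        obtain ⟨w, hw, hy⟩ := hy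
        rw [PMF.mem_support_pure_iff] at hy
        have ha := (h.act t' i q (hu' t' ht')).2 w hw
        unfold OTState.act₂ at ha
        cases hw1 : (i.act c w.2).2 with
        | some m =>
          rw [hw1, Option.elim_some] at ha hy
          exact hfin _ hy (Sim.inv_some.2 (h.weaken₁ _ _ ha))
        | none =>
          rw [hw1, Option.elim_none] at ha hy
          subst hy
          rw [iter, Sim.step_pre ((a', some w.1, false, none), (i.act c w.2).1) none
            (Or.inr rfl)] at hx
          simp only [Option.elim_some, PMF.pure_bind] at hx
          cases hw2 : (((i.act c w.2).1).act c M.pre).2 with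
          | some m =>
            rw [hw2, Option.elim_some, iter_advStep_inr, PMF.mem_support_pure_iff] at hx
            subst hx
            exact Sim.inv_some.2 (h.weaken₁ _ _ ha)
          | none =>
            rw [hw2, Option.elim_none] at hx
            exact (ih a' w.1 _ none ha).2 x hx

theorem Simulates.adv (h : Simulates M c H φ I₀ I₁ I₂) (x : SimSt SA T N × OTState ℓ) (z : N)
    (hx : M.Inv I₀ x) :
    (((G.sim M).adv (otCore c ℓ) (x.1, x.2, some z)).bind fun u =>
      (M.states φ (u.1, u.2.1)).bind fun y => PMF.pure (y.1, y.2, u.2.2)) =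
    ((M.states φ x).bind fun y => G.adv H (y.1, y.2, some z)) ∧
    ∀ u ∈ ((G.sim M).adv (otCore c ℓ) (x.1, x.2, some z)).support, M.Inv I₀ (u.1, u.2.1) := by
  rw [Play.adv, show (G.sim M).fuel = 2 * G.fuel + 1 from rfl, iter,
    Sim.step_pre x (some z) (Or.inl rfl)]
  constructor
  · simp only [PMF.bind_bind, PMF.pure_bind, Sim.states]
    refine PMF.bind_congr fun t ht => ?_
    obtain ⟨h1, h2, h3⟩ := h.pre t x.2 (hx t ht)
    rw [h1, Option.elim_none]
    have := (h.iter_advStep (G := G) G.fuel x.1.1 t _ (some z) h3).1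
    rw [h2] at this
    simp only [PMF.bind_bind, PMF.pure_bind, Sim.states] at this
    exact this
  · intro u hu
    simp only [PMF.bind_bind, PMF.pure_bind, PMF.mem_support_bind_iff] at hu
    obtain ⟨t, ht, y, hy, hu⟩ := hu
    rw [PMF.mem_support_pure_iff] at hu
    subst hu
    obtain ⟨h1, h2, h3⟩ := h.pre t x.2 (hx t ht)
    rw [h1, Option.elim_none] at hy
    exact (h.iter_advStep (G := G) G.fuel x.1.1 t _ (some z) h3).2 y hy

/-- A perfect simulation gives the execution of `H`, with the initial state that corresponds to the
state sampled by the simulator. -/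
theorem Simulates.bit (h : Simulates M c H φ I₀ I₁ I₂) :
    (G.sim M).bit (otCore c ℓ) (OTState.init ℓ) =
      (M.init.bind fun t => φ t (OTState.init ℓ)).bind (G.bit H) := by
  have := bit_intertwine (G := G.sim M) (G' := G) (C := otCore c ℓ) (C' := H)
    (φ := M.states φ) (I := M.Inv I₀) rfl rfl rfl rfl
    (fun x b hx => by
      simp only [otCore, PMF.pure_bind, Sim.states, PMF.bind_bind]
      refine PMF.bind_congr fun t ht => ?_
      rw [(h.rcv t x.2 b (hx t ht)).1, PMF.bind_bind])
    (fun x m hx => by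
      simp only [otCore, PMF.pure_bind, Sim.states, PMF.bind_bind]
      refine PMF.bind_congr fun t ht => ?_
      rw [(h.snd t x.2 m (hx t ht)).1, PMF.bind_bind])
    (fun x z hx => (h.adv x z hx).1)
    (fun x b hx s hs t ht => by
      simp only [otCore, PMF.mem_support_pure_iff] at hs
      subst hs
      exact (h.rcv t x.2 b (hx t ht)).2)
    (fun x m hx s hs t ht => by
      simp only [otCore, PMF.mem_support_pure_iff] at hs
      subst hs
      exact (h.snd t x.2 m (hx t ht)).2)
    (fun x z hx => (h.adv x z hx).2) (OTState.init ℓ) (fun t ht => h.init t ht)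
  rw [this]
  simp only [Sim.states, Play.sim, Option.elim_none, PMF.bind_bind, PMF.pure_bind]
  rfl

end SimStep

/-! ### Efficiency of simulators -/

section SimAdv

variable {T : ℕ → Type} [∀ κ, BitCode (T κ)] {ℓ n : ℕ → ℕ} {W : System ℓ}

/-- All parts of a family of simulators are efficient. -/
structure EffSim (M : ∀ κ, Sim (T κ) (W.View κ) (W.Act κ) (ℓ κ)) : Prop where
  init : Eff fun κ (_ : Bits 0) => (M κ).init
  upd : Eff fun κ (p : T κ × OTView (ℓ κ)) => (M κ).upd p.1 p.2
  view : EffD fun κ (p : T κ × OTView (ℓ κ)) => (M κ).view p.1 p.2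
  act : Eff fun κ (p : W.Act κ × T κ × OTView (ℓ κ)) => (M κ).act p.1 p.2.1 p.2.2

instance PolyLen.otAct [h : PolyLen fun κ => Bits (ℓ κ)] : PolyLen fun κ => OTAct (ℓ κ) :=
  ⟨(inferInstance : PolyLen fun κ => Option (Bool ⊕ (Bits (ℓ κ) × Bits (ℓ κ)))).bdd⟩

/-- The simulator as an adversary against the functionality. -/
def simAdversary [PolyLen T] [hℓ : PolyLen fun κ => Bits (ℓ κ)] (c : Party → Bool)
    (A : Adversary W n) (M : ∀ κ, Sim (T κ) (W.View κ) (W.Act κ) (ℓ κ)) (hM : EffSim M) :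
    Adversary (idealOT ℓ c) n where
  St κ := SimSt (A.St κ) (T κ) (Bits (n κ))
  code _ := inferInstance
  start κ := (A.start κ, none, false, none)
  step κ := (M κ).step (A.step κ)
  step_poly := by
    have hA := A.polyLen_St
    have hn := A.polyLen_msg
    have : Eff fun κ (x : SimSt (A.St κ) (T κ) (Bits (n κ)) × Option (Bits (n κ)) ×
        OTView (ℓ κ)) => (M κ).step (A.step κ) x := by
      unfold Sim.step
      refine Eff.bind (Eff.optionElim EffD.id.fst.snd.fst (hM.init.comp (EffD.const fun _ => 0))
        EffD.id.snd) ?_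
      refine Eff.cond (EffD.cond EffD.id.fst.snd.fst.isSome (EffD.const fun _ => true)
        (EffD.cond EffD.id.fst.fst.snd.snd.fst (EffD.const fun _ => false)
          (EffD.const fun _ => true))) ?_ (Eff.bind ?_ (Eff.bind ?_ ?_))
      · exact (EffD.id.fst.fst.fst.mk (EffD.id.snd.some.mk
          ((EffD.const fun _ => true).mk EffD.id.fst.snd.fst))).mk
          (EffD.const fun κ => some (Sum.inr (M κ).pre))
      · exact hM.upd.comp (EffD.id.snd.mk EffD.id.fst.snd.snd)
      · exact A.step_poly.eff.comp (EffD.id.fst.fst.fst.fst.mk (EffD.id.fst.fst.fst.snd.snd.snd.mk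
          (hM.view.comp (EffD.id.snd.mk EffD.id.fst.fst.snd.snd))))
      · have hst : ∀ {D : ℕ → Type} [∀ κ, BitCode (D κ)] {g : ∀ κ, D κ → A.St κ}
            {t : ∀ κ, D κ → T κ}, EffD g → EffD t → EffD fun κ d =>
              ((g κ d, some (t κ d), false, none) : SimSt (A.St κ) (T κ) (Bits (n κ))) :=
          fun hg ht => EffD.mk hg (EffD.mk ht.some
            ((EffD.const fun _ => false).mk (EffD.const fun _ => none)))
        refine Eff.optionElim EffD.id.snd.snd ?_ (Eff.sumElim EffD.id.snd ?_ (Eff.bind ?_ ?_))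
        · exact (hst EffD.id.snd.fst EffD.id.fst.snd).mk (EffD.const fun _ => none)
        · exact (hst EffD.id.fst.fst.snd.fst EffD.id.fst.fst.fst.snd).mk EffD.id.snd.inl.some
        · exact hM.act.comp (EffD.id.snd.mk (EffD.id.fst.fst.fst.snd.mk
            EffD.id.fst.fst.fst.fst.fst.snd.snd))
        · exact (hst EffD.id.fst.fst.fst.snd.fst EffD.id.snd.fst).mk EffD.id.snd.snd.inr.some
    have h := Eff.polyTime this
    exact h
  fuel κ := 2 * A.fuel κ + 1
  fuel_poly := ((PolyBdd.const 2).mul A.fuel_poly).add (PolyBdd.const 1)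

theorem exec_simAdversary [PolyLen T] [PolyLen fun κ => Bits (ℓ κ)] {c : Party → Bool}
    (A : Adversary W n) (E : Environment ℓ n)
    {M : ∀ κ, Sim (T κ) (W.View κ) (W.Act κ) (ℓ κ)} (hM : EffSim M) (κ : ℕ)
    {S : Type} {H : Core S (W.View κ) (W.Act κ) (Bits (ℓ κ))} {φ : T κ → OTState (ℓ κ) → PMF S}
    {I₀ I₁ I₂ : T κ → OTState (ℓ κ) → Prop} (h : Simulates (M κ) c H φ I₀ I₁ I₂) :
    exec (idealOT ℓ c) (simAdversary c A M hM) E κ =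
      ((M κ).init.bind fun t => φ t (OTState.init (ℓ κ))).bind ((play A E κ).bit H) := by
  rw [exec_eq, idealOT_core, ← h.bit]
  exact PMF.pure_bind _ _

end SimAdv

/-! ### The algorithms of the hash function -/

theorem PMF.do_bind {A B : Type} (p : PMF A) (f : A → PMF B) : p >>= f = p.bind f := rfl

theorem PMF.do_pure {A : Type} (a : A) : (pure a : PMF A) = PMF.pure a := rfl

namespace SPHFwG

variable (P : SPHFwG)

/-- Common reference strings. -/
abbrev Crs (κ : ℕ) : Type := Bits (P.nS κ) × Bits (P.nR κ)

/-- `param` of a common reference string. -/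
def par {κ : ℕ} (s : P.Crs κ) : Bits (P.nPar κ) := P.setup κ s.1 s.2

/-- The complement of a word. -/
def compl {κ : ℕ} (s : P.Crs κ) (x : Bits (P.nX κ)) : Bits (P.nX κ) :=
  P.complement κ (P.par s) s.2 x

/-- The projection key of `x` with a uniform value in place of the masked message. -/
def junk (κ : ℕ) (par : Bits (P.nPar κ)) (x : Bits (P.nX κ)) : PMF (P.Cipher κ) :=
  (P.keyAndRandom κ par x).bind fun k => PMF.pure (k.2, k.1)

theorem encrypt_eq (κ : ℕ) (par : Bits (P.nPar κ)) (x : Bits (P.nX κ)) (m : Bits (P.nV κ)) :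
    P.encrypt κ par x m =
      (P.keyAndHash κ par x).bind fun k => PMF.pure (xorBits k.2 m, k.1) := by
  simp only [encrypt, keyAndHash, PMF.do_bind, PMF.do_pure, PMF.bind_bind,
    PMF.pure_bind]

theorem xorBits_xorBits {n : ℕ} (a b : Bits n) : xorBits (xorBits a b) b = a := by
  funext i; simp [xorBits]

theorem xorBits_xorBits_left {n : ℕ} (a b : Bits n) : xorBits (xorBits a b) a = b := by
  funext i
  simp only [xorBits]
  cases a i <;> cases b i <;> rfl

theorem uniform_xor {n : ℕ} (m : Bits n) :
    ((PMF.uniformOfFintype (Bits n)).bind fun v => PMF.pure (xorBits v m)) =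
      PMF.uniformOfFintype (Bits n) := by
  classical
  ext u
  rw [PMF.bind_apply, tsum_eq_single (xorBits u m)]
  · simp [PMF.uniformOfFintype_apply, xorBits_xorBits]
  · intro v hv
    have : u ≠ xorBits v m := fun h => hv (by rw [h, xorBits_xorBits])
    simp [PMF.pure_apply, this]

theorem keyAndRandom_xor (κ : ℕ) (par : Bits (P.nPar κ)) (x : Bits (P.nX κ)) (m : Bits (P.nV κ)) :
    ((P.keyAndRandom κ par x).bind fun k => PMF.pure (k.1, xorBits k.2 m)) =
      P.keyAndRandom κ par x := by
  simp only [keyAndRandom, PMF.do_bind, PMF.do_pure, PMF.bind_bind,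
    PMF.pure_bind]
  refine congrArg (PMF.bind _) (funext fun hk => congrArg (PMF.bind _) (funext fun hp => ?_))
  have := congrArg (fun p : PMF (Bits (P.nV κ)) => p.bind fun v => PMF.pure (hp, v)) (uniform_xor m)
  simpa only [PMF.bind_bind, PMF.pure_bind] using this

/-- A ciphertext under a word of `ℒ'` is close to a ciphertext without content. -/
theorem near_encrypt_junk {κ : ℕ} {par : Bits (P.nPar κ)} {x : Bits (P.nX κ)} {ε : ℝ}
    (h : statDist (P.keyAndHash κ par x) (P.keyAndRandom κ par x) ≤ ε) (m : Bits (P.nV κ)) :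
    Near ∅ (P.encrypt κ par x m) (P.junk κ par x) (ENNReal.ofReal ε) := by
  have := (Near.of_statDist h).bind fun k =>
    (PMF.pure (xorBits k.2 m, k.1) : PMF (P.Cipher κ))
  rw [← encrypt_eq] at this
  convert this using 1
  have h2 := congrArg (fun p : PMF (Bits (P.nHp κ) × Bits (P.nV κ)) =>
    p.bind fun k => (PMF.pure (k.2, k.1) : PMF (P.Cipher κ))) (P.keyAndRandom_xor κ par x m)
  simp only [PMF.bind_bind, PMF.pure_bind] at h2
  exact h2.symm

end SPHFwG

theorem EffD.toSum {P : SPHFwG} {A : ℕ → Type} [∀ κ, BitCode (A κ)] {q : ∀ κ, A κ → P.ProtAct κ}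
    (hq : EffD q) : EffD fun κ a => (q κ a).toSum :=
  Eff.comp (f := fun κ (q : P.ProtAct κ) => PMF.pure q.toSum)
    (EffD.wire' (fun _ j => j) fun _ _ _ => rfl) hq

section EffSPHF

variable {P : SPHFwG} [hP : Fact P.IsSPHFwG]

instance : PolyLen fun κ => Bits (P.nS κ) := hP.out.efficient.sampS1.polyLen_right.fst
instance : PolyLen fun κ => Bits (P.nTd κ) := hP.out.efficient.sampS1.polyLen_right.snd
instance : PolyLen fun κ => Bits (P.nR κ) := hP.out.efficient.sampR0.polyLen_right
instance : PolyLen fun κ => Bits (P.nX κ) := hP.out.efficient.wordGenX.polyLen_right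
instance : PolyLen fun κ => Bits (P.nW κ) := hP.out.efficient.wordGenL.polyLen_right.snd
instance : PolyLen fun κ => Bits (P.nHp κ) := hP.out.efficient.projKG.polyLen_right
instance : PolyLen fun κ => Bits (P.nV κ) := hP.out.efficient.hash.polyLen_right

variable {A : ℕ → Type} [∀ κ, BitCode (A κ)] {s : ∀ κ, A κ → P.Crs κ}
  {p : ∀ κ, A κ → Bits (P.nPar κ)} {x : ∀ κ, A κ → Bits (P.nX κ)} {w : ∀ κ, A κ → Bits (P.nW κ)}
  {m : ∀ κ, A κ → Bits (P.nV κ)} {c : ∀ κ, A κ → P.Cipher κ} {td : ∀ κ, A κ → Bits (P.nTd κ)}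

theorem EffD.par (hs : EffD s) : EffD fun κ a => P.par (s κ a) := hP.out.efficient.setup.eff.comp hs

theorem EffD.compl (hs : EffD s) (hx : EffD x) : EffD fun κ a => P.compl (s κ a) (x κ a) :=
  hP.out.efficient.complement.eff.comp (EffD.mk (EffD.par hs) (hs.snd.mk hx))

theorem EffD.isWord (hp : EffD p) (hx : EffD x) : EffD fun κ a => P.isWord κ (p κ a) (x κ a) :=
  hP.out.efficient.isWord.eff.comp (hp.mk hx)

theorem EffD.wordTest (ht : EffD td) (hx : EffD x) :
    EffD fun κ a => P.wordTest κ (td κ a) (x κ a) :=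
  hP.out.efficient.wordTest.eff.comp (ht.mk hx)

theorem Eff.keyAndHash (hp : EffD p) (hx : EffD x) :
    Eff fun κ a => P.keyAndHash κ (p κ a) (x κ a) := by
  refine Eff.bind (hP.out.efficient.hashKG.eff.comp hp) (Eff.bind (hP.out.efficient.projKG.eff.comp
    (EffD.mk (hp.comp EffD.id.fst) (EffD.id.snd.mk (hx.comp EffD.id.fst)))) (Eff.bind
    (hP.out.efficient.hash.eff.comp (EffD.mk (hp.comp EffD.id.fst.fst)
      (EffD.id.fst.snd.mk (hx.comp EffD.id.fst.fst)))) ?_))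
  exact EffD.id.fst.snd.mk EffD.id.snd

theorem Eff.keyAndRandom (hp : EffD p) (hx : EffD x) :
    Eff fun κ a => P.keyAndRandom κ (p κ a) (x κ a) := by
  refine Eff.bind (hP.out.efficient.hashKG.eff.comp hp) (Eff.bind (hP.out.efficient.projKG.eff.comp
    (EffD.mk (hp.comp EffD.id.fst) (EffD.id.snd.mk (hx.comp EffD.id.fst)))) (Eff.bind
    Eff.uniform ?_))
  exact EffD.id.fst.snd.mk EffD.id.snd

theorem Eff.encrypt (hp : EffD p) (hx : EffD x) (hm : EffD m) :
    Eff fun κ a => P.encrypt κ (p κ a) (x κ a) (m κ a) := by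
  simp only [SPHFwG.encrypt_eq]
  exact Eff.bind (Eff.keyAndHash hp hx)
    ((EffD.xor EffD.id.snd.snd (hm.comp EffD.id.fst)).mk EffD.id.snd.fst)

theorem Eff.junk (hp : EffD p) (hx : EffD x) : Eff fun κ a => P.junk κ (p κ a) (x κ a) :=
  Eff.bind (Eff.keyAndRandom hp hx) (EffD.id.snd.snd.mk EffD.id.snd.fst)

theorem Eff.decrypt (hp : EffD p) (hx : EffD x) (hw : EffD w) (hc : EffD c) :
    Eff fun κ a => P.decrypt κ (p κ a) (x κ a) (w κ a) (c κ a) :=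
  Eff.bind (hP.out.efficient.projHash.eff.comp (hp.mk (hc.snd.mk (hx.mk hw))))
    (EffD.xor EffD.id.snd (EffD.fst (hc.comp EffD.id.fst)))

theorem Eff.wordGenL (hp : EffD p) : Eff fun κ a => P.wordGenL κ (p κ a) :=
  hP.out.efficient.wordGenL.eff.comp hp

theorem eff_crs00 : Eff fun κ (_ : Bits 0) => P.crs00 κ :=
  Eff.bind hP.out.efficient.sampS0.eff (Eff.bind (hP.out.efficient.sampR0.eff.comp EffD.id.snd)
    (EffD.id.fst.snd.mk EffD.id.snd))

end EffSPHF

section EffOTAct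

variable {A : ℕ → Type} [∀ κ, BitCode (A κ)] {ℓ : ℕ → ℕ} [PolyLen fun κ => Bits (ℓ κ)]

theorem EffD.otReceiver {b : ∀ κ, A κ → Bool} (hb : EffD b) :
    EffD fun κ a => (OTAct.receiver (b κ a) : OTAct (ℓ κ)) := by
  obtain ⟨F, hF, h⟩ := (EffD.some (EffD.inl hb) : EffD fun κ a =>
    (Option.some (Sum.inl (b κ a)) : Option (Bool ⊕ (Bits (ℓ κ) × Bits (ℓ κ)))))
  exact ⟨F, hF, fun κ a => (h κ a).trans (by simp only [PMF.pure_map]; rfl)⟩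

theorem EffD.otSender {m : ∀ κ, A κ → Bits (ℓ κ) × Bits (ℓ κ)} (hm : EffD m) :
    EffD fun κ a => OTAct.sender (m κ a) := by
  obtain ⟨F, hF, h⟩ := (EffD.some (EffD.inr hm) : EffD fun κ a =>
    (Option.some (Sum.inr (m κ a)) : Option (Bool ⊕ (Bits (ℓ κ) × Bits (ℓ κ)))))
  exact ⟨F, hF, fun κ a => (h κ a).trans (by simp only [PMF.pure_map]; rfl)⟩

end EffOTAct

/-! ### The protocol -/

namespace SPHFwG

variable (P : SPHFwG)

/-- What the adversary sees of the protocol. -/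
abbrev ProtView (κ : ℕ) : Type :=
  P.Crs κ × Option (Bits (P.nX κ)) × Option (P.Cipher κ × P.Cipher κ)

/-- The state at the start of an execution. -/
def ProtState.init {P : SPHFwG} {κ : ℕ} (s : P.Crs κ) : P.ProtState κ :=
  ⟨s, none, none, false, none, none, none⟩

/-- The protocol at the security parameter `κ`. -/
def protCore (c : Party → Bool) (κ : ℕ) :
    Core (P.ProtState κ) (P.ProtView κ) (P.ProtAct κ) (Bits (P.nV κ)) where
  rcv b s := if c .receiver then PMF.pure s else P.receiverStart κ b s
  snd m s := if c .sender then PMF.pure s else P.senderStart κ m s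
  view s := (s.crs, s.flow1, s.flow2)
  act q s :=
    match q with
    | .deliver1 x =>
      if c .sender then PMF.pure (s, none)
      else match (if c .receiver then some x else s.flow1) with
        | some x' => (P.senderReceive κ x' s).map fun s' => (s', none)
        | none => PMF.pure (s, none)
    | .deliver2 d =>
      if c .receiver then PMF.pure (s, none)
      else match (if c .sender then some d else s.flow2) with
        | some c' => P.receiverFinish κ c' s
        | none => PMF.pure (s, none)

theorem exec_protocolOT {c : Party → Bool} {n : ℕ → ℕ} (A : Adversary (P.protocolOT c) n)
    (E : Environment P.nV n) (κ : ℕ) :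
    exec (P.protocolOT c) A E κ = (P.crs00 κ).bind fun s =>
      (play A E κ).bit (P.protCore c κ) (ProtState.init s) := by
  rw [exec_eq]
  exact PMF.bind_map _ _ _

end SPHFwG

/-! ### Both parties corrupted -/

section BothCorrupted

variable (P : SPHFwG)

/-- With both parties corrupted, the simulator only has to provide a common reference string. -/
def simBothCorrupted (κ : ℕ) :
    Sim (P.Crs κ) (P.ProtView κ) (P.ProtAct κ) (P.nV κ) where
  init := P.crs00 κ
  pre := .answer
  upd t _ := PMF.pure t
  view t _ := (t, none, none)
  act _ t _ := PMF.pure (t, .answer)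

theorem simulates_bothCorrupted {c : Party → Bool} (hr : c .receiver = true)
    (hs : c .sender = true) (κ : ℕ) :
    Simulates (simBothCorrupted P κ) c (P.protCore c κ)
      (fun t _ => PMF.pure (.init t))
      (fun _ i => i = OTState.init _) (fun _ i => i = OTState.init _)
      (fun _ i => i = OTState.init _) where
  init _ _ := rfl
  rcv t i b hi := by
    simp [OTState.rcv, hr, hi, SPHFwG.protCore]
  snd t i m hi := by
    simp [OTState.snd, hs, hi, SPHFwG.protCore]
  pre t i hi := by subst hi; exact ⟨rfl, rfl, rfl⟩
  weaken₁ _ _ h := h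
  weaken₂ _ _ h := h
  upd t i hi := by
    subst hi
    exact ⟨PMF.pure_bind _ _, fun _ _ => rfl⟩
  view t i hi s hs := by
    rw [PMF.mem_support_pure_iff] at hs
    subst hs; rfl
  act t i q hi := by
    subst hi
    constructor
    · simp only [simBothCorrupted, PMF.pure_bind]
      cases q <;> simp only [SPHFwG.protCore, hr, hs, if_true] <;> rfl
    · intro w hw
      simp only [simBothCorrupted, PMF.mem_support_pure_iff] at hw
      subst hw; rfl

theorem realizes_bothCorrupted (hP : P.IsSPHFwG) {c : Party → Bool} (hr : c .receiver = true)
    (hs : c .sender = true) : UCEmulates (P.protocolOT c) (idealOT P.nV c) := by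
  intro n A
  have : Fact P.IsSPHFwG := ⟨hP⟩
  have hM : EffSim (W := P.protocolOT c) (simBothCorrupted P) :=
    { init := eff_crs00
      upd := EffD.id.fst
      view := EffD.id.fst.mk (EffD.const fun κ =>
        ((none, none) : Option (Bits (P.nX κ)) × Option (P.Cipher κ × P.Cipher κ)))
      act := EffD.mk EffD.id.snd.fst (EffD.const fun κ => (OTAct.answer : OTAct (P.nV κ))) }
  refine ⟨simAdversary c A _ hM, fun E => ?_⟩
  have : ∀ κ, exec (P.protocolOT c) A E κ =
      exec (idealOT P.nV c) (simAdversary c A (simBothCorrupted P) hM) E κ := fun κ => by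
    rw [exec_simAdversary A E hM κ (simulates_bothCorrupted P hr hs κ),
      P.exec_protocolOT, PMF.bind_bind]
    simp only [PMF.pure_bind]
    rfl
  simp only [this, sub_self, abs_zero]
  exact Negl.zero

end BothCorrupted

/-! ### Receiver corrupted, sender honest -/

namespace SPHFwG

variable (P : SPHFwG)

/-- The state of an execution with corrupted receiver: the trapdoor of `σ`, the reference string, the
input of the sender, the word that has reached it, and its reply. -/
abbrev RCSt (κ : ℕ) : Type :=
  Bits (P.nTd κ) × P.Crs κ × Option (Bits (P.nV κ) × Bits (P.nV κ)) × Option (Bits (P.nX κ)) ×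
    Option (P.Cipher κ × P.Cipher κ)

variable {κ : ℕ}

/-- The way in which a reply is computed from the trapdoor, the reference string, the received word
and the input of the sender. -/
abbrev Reply (κ : ℕ) : Type :=
  Bits (P.nTd κ) → P.Crs κ → Bits (P.nX κ) → Bits (P.nV κ) × Bits (P.nV κ) →
    PMF (P.Cipher κ × P.Cipher κ)

variable {P}

/-- The reply is sent once, as soon as the input and the word are there. -/
def rcReply (f : P.Reply κ) (s : P.RCSt κ) : PMF (P.RCSt κ) :=
  s.2.2.1.elim (PMF.pure s) fun m => s.2.2.2.1.elim (PMF.pure s) fun x =>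
    s.2.2.2.2.elim ((f s.1 s.2.1 x m).bind fun c =>
      PMF.pure (s.1, s.2.1, some m, some x, some c)) fun _ => PMF.pure s

/-- The protocol with corrupted receiver, in which the sender replies by `f`. -/
def rcCore (f : P.Reply κ) : Core (P.RCSt κ) (P.ProtView κ) (P.ProtAct κ) (Bits (P.nV κ)) where
  rcv _ s := PMF.pure s
  snd m s := s.2.2.1.elim (rcReply f (s.1, s.2.1, some m, s.2.2.2)) fun _ => PMF.pure s
  view s := (s.2.1, none, s.2.2.2.2)
  act q s := q.toSum.elim
    (fun x => s.2.2.2.1.elim (bif P.isWord κ (P.par s.2.1) x then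
        (rcReply f (s.1, s.2.1, s.2.2.1, some x, s.2.2.2.2)).bind fun s' => PMF.pure (s', none)
      else PMF.pure (s, none)) fun _ => PMF.pure (s, none))
    fun _ => PMF.pure (s, none)

variable (P)

/-- The reply of an honest sender. -/
def honestReply (κ : ℕ) : P.Reply κ := fun _ s x m =>
  (P.encrypt κ (P.par s) x m.1).bind fun c₀ =>
    (P.encrypt κ (P.par s) (P.compl s x) m.2).bind fun c₁ => PMF.pure (c₀, c₁)

/-- The reply of the simulator, which knows only one message `m`: the second one if the received
word is in `ℒ'`, and the first one otherwise. -/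
def simReply (κ : ℕ) (td : Bits (P.nTd κ)) (s : P.Crs κ) (x : Bits (P.nX κ))
    (m : Bits (P.nV κ)) : PMF (P.Cipher κ × P.Cipher κ) :=
  bif P.wordTest κ td x then
    (P.junk κ (P.par s) x).bind fun c₀ =>
      (P.encrypt κ (P.par s) (P.compl s x) m).bind fun c₁ => PMF.pure (c₀, c₁)
  else
    (P.encrypt κ (P.par s) x m).bind fun c₀ =>
      (P.junk κ (P.par s) (P.compl s x)).bind fun c₁ => PMF.pure (c₀, c₁)

/-- The reply of the simulator in terms of the input of the sender. -/
def hybridReply (κ : ℕ) : P.Reply κ := fun td s x m =>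
  P.simReply κ td s x (if P.wordTest κ td x then m.2 else m.1)

variable {P}

theorem protCore_intertwines_rc {c : Party → Bool} (hr : c .receiver = true)
    (hs : c .sender = false) :
    Intertwines (rcCore (P.honestReply κ)) (P.protCore c κ)
      (fun s => PMF.pure ⟨s.2.1, none, none, false, s.2.2.1, s.2.2.2.1, s.2.2.2.2⟩)
      (fun _ => True) := by
  have key : ∀ s : P.RCSt κ, ((rcReply (P.honestReply κ) s).bind fun s =>
      (PMF.pure ⟨s.2.1, none, none, false, s.2.2.1, s.2.2.2.1, s.2.2.2.2⟩ : PMF (P.ProtState κ))) =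
      P.senderReply κ ⟨s.2.1, none, none, false, s.2.2.1, s.2.2.2.1, s.2.2.2.2⟩ := by
    rintro ⟨td, crs, _ | m, _ | x, _ | f⟩ <;>
      simp [rcReply, senderReply, honestReply, PMF.do_bind, PMF.do_pure, ProtState.par, par, compl]
  refine ⟨fun s b _ => ?_, fun s m _ => ?_, fun s _ s' hs' => ?_, fun s q _ => ?_,
    fun _ _ _ _ _ => trivial, fun _ _ _ _ _ => trivial, fun _ _ _ _ _ => trivial⟩
  · simp [rcCore, protCore, hr]
  · obtain ⟨td, crs, _ | m', x, f⟩ := s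
    · simp only [rcCore, Option.elim_none, key, PMF.pure_bind, protCore, hs, senderStart]
      rfl
    · simp [rcCore, protCore, hs, senderStart]
  · rw [PMF.mem_support_pure_iff] at hs'
    subst hs'; rfl
  · obtain ⟨td, crs, m, x, f⟩ := s
    rcases q with y | d
    · rcases x with _ | x
      · cases hw : P.isWord κ (P.par crs) y
        · simp [rcCore, protCore, hs, hr, ProtAct.toSum, hw, senderReceive, ProtState.par]
          rw [show P.isWord κ (P.setup κ crs.1 crs.2) y = false from hw]
          simp [PMF.pure_map]
        · simp only [rcCore, protCore, hs, hr, ProtAct.toSum, hw, Sum.elim_inl, Option.elim_none,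
            cond_true, PMF.bind_bind, PMF.pure_bind, if_true, senderReceive, ProtState.par]
          rw [show P.isWord κ (P.setup κ crs.1 crs.2) y = true from hw]
          simp only [Bool.false_eq_true, if_false]
          rw [← key (td, crs, m, some y, f)]
          simp only [PMF.map_bind, PMF.pure_map]
      · simp [rcCore, protCore, hs, hr, ProtAct.toSum, senderReceive, PMF.pure_map]
    · simp [rcCore, protCore, hs, hr, ProtAct.toSum]

/-- The received word, if there is one, is not in `ℒ'`, and neither is its complement. -/
def rcBad (P : SPHFwG) (κ : ℕ) : Set (P.RCSt κ) :=
  {s | ∃ x ∈ s.2.2.2.1, x ∉ P.L' κ (P.par s.2.1) ∧ P.compl s.2.1 x ∉ P.L' κ (P.par s.2.1)}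

/-- The trapdoor fits the reference string, and the received string is a word. -/
def rcInv (P : SPHFwG) (κ : ℕ) (s : P.RCSt κ) : Prop :=
  ((s.2.1.1, s.1) ∈ (P.sampS1 κ).support ∧ s.2.1.2 ∈ (P.sampR0 κ s.2.1.1).support) ∧
    ∀ x ∈ s.2.2.2.1, P.isWord κ (P.par s.2.1) x = true

theorem rcReply_support {f : P.Reply κ} {s t : P.RCSt κ} (ht : t ∈ (rcReply f s).support) :
    t.1 = s.1 ∧ t.2.1 = s.2.1 ∧ t.2.2.2.1 = s.2.2.2.1 := by
  obtain ⟨td, crs, _ | m, _ | x, _ | f⟩ := s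
  case some.some.none =>
    simp only [rcReply, Option.elim_some, Option.elim_none, PMF.mem_support_bind_iff,
      PMF.mem_support_pure_iff] at ht
    obtain ⟨c, _, rfl⟩ := ht
    exact ⟨rfl, rfl, rfl⟩
  all_goals
    simp only [rcReply, Option.elim_some, Option.elim_none, PMF.mem_support_pure_iff] at ht
    subst ht
    exact ⟨rfl, rfl, rfl⟩

theorem rcCore_snd_support {f : P.Reply κ} {s t : P.RCSt κ} {m : Bits (P.nV κ) × Bits (P.nV κ)}
    (ht : t ∈ ((rcCore f).snd m s).support) :
    t.1 = s.1 ∧ t.2.1 = s.2.1 ∧ t.2.2.2.1 = s.2.2.2.1 := by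
  obtain ⟨td, crs, _ | m', x, c⟩ := s
  · exact rcReply_support (f := f) (s := (td, crs, some m, x, c)) ht
  · simp only [rcCore, Option.elim_some, PMF.mem_support_pure_iff] at ht
    subst ht; exact ⟨rfl, rfl, rfl⟩

theorem rcCore_act_support {f : P.Reply κ} {s : P.RCSt κ} {q : P.ProtAct κ}
    {u : P.RCSt κ × Option (Bits (P.nV κ))} (hu : u ∈ ((rcCore f).act q s).support) :
    u.1.1 = s.1 ∧ u.1.2.1 = s.2.1 ∧ (u.1.2.2.2.1 = s.2.2.2.1 ∨
      s.2.2.2.1 = none ∧ ∃ x, u.1.2.2.2.1 = some x ∧ P.isWord κ (P.par s.2.1) x = true) := by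
  obtain ⟨td, crs, m, x, c⟩ := s
  rcases q with y | d
  · rcases x with _ | x
    · cases hw : P.isWord κ (P.par crs) y
      · simp only [rcCore, ProtAct.toSum, Sum.elim_inl, Option.elim_none, hw, cond_false,
          PMF.mem_support_pure_iff] at hu
        subst hu; exact ⟨rfl, rfl, Or.inl rfl⟩
      · simp only [rcCore, ProtAct.toSum, Sum.elim_inl, Option.elim_none, hw, cond_true,
          PMF.mem_support_bind_iff, PMF.mem_support_pure_iff] at hu
        obtain ⟨s', hs', rfl⟩ := hu
        obtain ⟨h1, h2, h3⟩ := rcReply_support hs'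
        exact ⟨h1, h2, Or.inr ⟨rfl, y, h3, hw⟩⟩
    · simp only [rcCore, ProtAct.toSum, Sum.elim_inl, Option.elim_some,
        PMF.mem_support_pure_iff] at hu
      subst hu; exact ⟨rfl, rfl, Or.inl rfl⟩
  · simp only [rcCore, ProtAct.toSum, Sum.elim_inr, PMF.mem_support_pure_iff] at hu
    subst hu; exact ⟨rfl, rfl, Or.inl rfl⟩

/-- Unless the received word is bad, the honest reply is close to that of the simulator. -/
theorem near_rcReply (hP : P.IsSPHFwG) {ε : ℝ} (hε : ∀ σ ρ, P.InS κ σ → P.InR κ σ ρ →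
    ∀ x ∈ P.L' κ (P.setup κ σ ρ), statDist (P.keyAndHash κ (P.setup κ σ ρ) x)
      (P.keyAndRandom κ (P.setup κ σ ρ) x) ≤ ε) (s : P.RCSt κ) (hs : P.rcInv κ s) :
    Near (P.rcBad κ) (rcReply (P.honestReply κ) s) (rcReply (P.hybridReply κ) s)
      (ENNReal.ofReal ε) := by
  by_cases hb : s ∈ P.rcBad κ
  · intro g hg h0
    rw [expect_congr (h := fun _ => 0), expect_const]
    · exact zero_le
    · intro t ht
      obtain ⟨h1, h2, h3⟩ := rcReply_support ht
      refine h0 t ?_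
      unfold rcBad at hb ⊢
      rwa [Set.mem_ofPred_eq, h2, h3]
  obtain ⟨td, crs, _ | m, _ | x, _ | c⟩ := s
  case neg.some.some.none =>
    simp only [rcReply, Option.elim_some, Option.elim_none]
    refine Near.of_empty (Near.bind ?_ _)
    obtain ⟨⟨hs1, hs2⟩, hx⟩ := hs
    have hS : P.InS κ crs.1 := Or.inr ⟨_, hs1⟩
    have hR : P.InR κ crs.1 crs.2 := Or.inl hs2
    have ht := hP.trapdoorTest κ crs.1 td crs.2 hs1 hR x (Finset.mem_filter.2 ⟨Finset.mem_univ _, hx x rfl⟩)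
    have hn : ∀ y ∈ P.L' κ (P.par crs), ∀ m, Near ∅ (P.encrypt κ (P.par crs) y m)
        (P.junk κ (P.par crs) y) (ENNReal.ofReal ε) := fun y hy m =>
      P.near_encrypt_junk (hε _ _ hS hR y hy) m
    cases hw : P.wordTest κ td x
    · have hx' : x ∉ P.L' κ (P.par crs) := fun h => by
        have h' := ht.2 h
        rw [hw] at h'; cases h'
      have hc : P.compl crs x ∈ P.L' κ (P.par crs) := by
        by_contra hc
        exact hb ⟨x, rfl, hx', hc⟩
      simp only [honestReply, hybridReply, simReply, hw, cond_false, Bool.false_eq_true, if_false]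
      exact Near.bind_left' fun c₀ _ => (hn _ hc _).bind _
    · simp only [honestReply, hybridReply, simReply, hw, cond_true, if_true]
      exact (hn x (ht.1 hw) _).bind _
  all_goals exact Near.refl _ _ _

theorem rcInv.of_eq {s t : P.RCSt κ} (h : P.rcInv κ s)
    (ht : t.1 = s.1 ∧ t.2.1 = s.2.1 ∧ t.2.2.2.1 = s.2.2.2.1) : P.rcInv κ t := by
  unfold rcInv at h ⊢
  rwa [ht.1, ht.2.1, ht.2.2]

theorem rcInv.act {f : P.Reply κ} {s : P.RCSt κ} {q : P.ProtAct κ}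
    {u : P.RCSt κ × Option (Bits (P.nV κ))} (h : P.rcInv κ s)
    (hu : u ∈ ((rcCore f).act q s).support) : P.rcInv κ u.1 := by
  obtain ⟨h1, h2, h3 | ⟨h3, x, hx, hw⟩⟩ := rcCore_act_support hu
  · exact h.of_eq ⟨h1, h2, h3⟩
  · unfold rcInv at h ⊢
    rw [h1, h2, hx]
    refine ⟨h.1, fun z hz => ?_⟩
    obtain rfl : x = z := Option.some_injective _ hz
    exact hw

variable {SA SE N : Type} (G : Play SA SE (P.ProtView κ) (P.ProtAct κ) (Bits (P.nV κ)) N)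

theorem rcInv_run (f : P.Reply κ) (s : P.RCSt κ) (hs : P.rcInv κ s) :
    ∀ y ∈ (G.run (rcCore f) s).support, P.rcInv κ y.2.2.1 ∧ y.2.2.1.2.1 = s.2.1 := by
  refine run_inv (I := fun t => P.rcInv κ t ∧ t.2.1 = s.2.1) (fun t b ht t' ht' => ?_)
    (fun t m ht t' ht' => ?_) (fun t q ht u hu => ?_) s ⟨hs, rfl⟩
  · simp only [rcCore, PMF.mem_support_pure_iff] at ht'
    exact ht' ▸ ht
  · have h := rcCore_snd_support ht'
    exact ⟨ht.1.of_eq h, h.2.1.trans ht.2⟩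
  · exact ⟨ht.1.act hu, (rcCore_act_support hu).2.1.trans ht.2⟩

/-- As long as no bad word is received, each reply costs at most the smoothness error. -/
theorem near_rc_run (hP : P.IsSPHFwG) {ε : ℝ} (hε : ∀ σ ρ, P.InS κ σ → P.InR κ σ ρ →
    ∀ x ∈ P.L' κ (P.setup κ σ ρ), statDist (P.keyAndHash κ (P.setup κ σ ρ) x)
      (P.keyAndRandom κ (P.setup κ σ ρ) x) ≤ ε) (s : P.RCSt κ) (hs : P.rcInv κ s) :
    Near {x | x.2.2.1 ∈ P.rcBad κ} (G.run (rcCore (P.honestReply κ)) s)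
      (G.run (rcCore (P.hybridReply κ)) s)
      (G.rounds * ((G.fuel + 1) * ENNReal.ofReal ε)) := by
  have hbad : ∀ {s t : P.RCSt κ}, t.1 = s.1 ∧ t.2.1 = s.2.1 ∧ t.2.2.2.1 = s.2.2.2.1 →
      s ∈ P.rcBad κ → t ∈ P.rcBad κ := by
    rintro s t ⟨h1, h2, h3⟩ h
    unfold rcBad at h ⊢
    rwa [Set.mem_ofPred_eq, h2, h3]
  refine run_near (G := G) (C := rcCore (P.honestReply κ)) (C' := rcCore (P.hybridReply κ))
    (ε := ENNReal.ofReal ε) (bad := P.rcBad κ) (I := P.rcInv κ) rfl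
    (fun s b _ => Near.refl _ _ _) (fun s m hI => ?_) (fun s q hI => ?_)
    (fun s b hI t ht => ?_) (fun s m hI t ht => hI.of_eq (rcCore_snd_support ht))
    (fun s q hI u hu => hI.act hu) (fun s b hb t ht => ?_)
    (fun s m hb t ht => hbad (rcCore_snd_support ht) hb) (fun s q hb u hu => ?_) s hs
  · obtain ⟨td, crs, _ | m', x, c⟩ := s
    · exact near_rcReply hP hε (td, crs, some m, x, c) hI
    · exact Near.refl _ _ _
  · obtain ⟨td, crs, m, x, c⟩ := s
    rcases q with y | d
    · rcases x with _ | x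
      · cases hw : P.isWord κ (P.par crs) y
        · simp only [rcCore, ProtAct.toSum, Sum.elim_inl, Option.elim_none, hw, cond_false]
          exact Near.refl _ _ _
        · simp only [rcCore, ProtAct.toSum, Sum.elim_inl, Option.elim_none, hw, cond_true]
          refine Near.bind_of_mem (near_rcReply hP hε (td, crs, m, some y, c)
            ⟨hI.1, fun z hz => ?_⟩) fun t ht u hu => ?_
          · obtain rfl : y = z := Option.some_injective _ hz
            exact hw
          · rw [PMF.mem_support_pure_iff] at hu
            subst hu; exact ht
      · exact Near.refl _ _ _
    · exact Near.refl _ _ _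
  · simp only [rcCore, PMF.mem_support_pure_iff] at ht
    exact ht ▸ hI
  · simp only [rcCore, PMF.mem_support_pure_iff] at ht
    exact ht ▸ hb
  · obtain ⟨h1, h2, h3 | ⟨h3, x, hx, hw⟩⟩ := rcCore_act_support hu
    · exact hbad ⟨h1, h2, h3⟩ hb
    · obtain ⟨x, hx, _⟩ := hb
      rw [h3] at hx; cases hx

end SPHFwG

section EffRC

variable {P : SPHFwG} [hP : Fact P.IsSPHFwG]

theorem eff_honestReply : Eff fun κ (p : Bits (P.nTd κ) × P.Crs κ × Bits (P.nX κ) ×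
    Bits (P.nV κ) × Bits (P.nV κ)) => P.honestReply κ p.1 p.2.1 p.2.2.1 p.2.2.2 := by
  refine Eff.bind (Eff.encrypt (EffD.par EffD.id.snd.fst) EffD.id.snd.snd.fst
    EffD.id.snd.snd.snd.fst) (Eff.bind (Eff.encrypt (EffD.par EffD.id.fst.snd.fst)
      (EffD.compl EffD.id.fst.snd.fst EffD.id.fst.snd.snd.fst) EffD.id.fst.snd.snd.snd.snd) ?_)
  exact EffD.id.fst.snd.mk EffD.id.snd

theorem eff_simReply : Eff fun κ (p : Bits (P.nTd κ) × P.Crs κ × Bits (P.nX κ) ×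
    Bits (P.nV κ)) => P.simReply κ p.1 p.2.1 p.2.2.1 p.2.2.2 := by
  refine Eff.cond (EffD.wordTest EffD.id.fst EffD.id.snd.snd.fst) ?_ ?_
  · exact Eff.bind (Eff.junk (EffD.par EffD.id.snd.fst) EffD.id.snd.snd.fst)
      (Eff.bind (Eff.encrypt (EffD.par EffD.id.fst.snd.fst)
        (EffD.compl EffD.id.fst.snd.fst EffD.id.fst.snd.snd.fst) EffD.id.fst.snd.snd.snd)
        (EffD.id.fst.snd.mk EffD.id.snd))
  · exact Eff.bind (Eff.encrypt (EffD.par EffD.id.snd.fst) EffD.id.snd.snd.fst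
      EffD.id.snd.snd.snd) (Eff.bind (Eff.junk (EffD.par EffD.id.fst.snd.fst)
        (EffD.compl EffD.id.fst.snd.fst EffD.id.fst.snd.snd.fst))
        (EffD.id.fst.snd.mk EffD.id.snd))

theorem eff_rcReply {f : ∀ κ, P.Reply κ} (hf : Eff fun κ (p : Bits (P.nTd κ) × P.Crs κ ×
    Bits (P.nX κ) × Bits (P.nV κ) × Bits (P.nV κ)) => f κ p.1 p.2.1 p.2.2.1 p.2.2.2) :
    Eff fun κ (s : P.RCSt κ) => SPHFwG.rcReply (f κ) s := by
  refine Eff.optionElim EffD.id.snd.snd.fst EffD.id (Eff.optionElim EffD.id.fst.snd.snd.snd.fst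
    EffD.id.fst (Eff.optionElim EffD.id.fst.fst.snd.snd.snd.snd (Eff.bind (hf.comp
      (EffD.id.fst.fst.fst.mk (EffD.id.fst.fst.snd.fst.mk (EffD.id.snd.mk EffD.id.fst.snd)))) ?_)
      EffD.id.fst.fst.fst))
  exact EffD.id.fst.fst.fst.fst.mk (EffD.id.fst.fst.fst.snd.fst.mk (EffD.id.fst.fst.snd.some.mk
    (EffD.id.fst.snd.some.mk EffD.id.snd.some)))

theorem effCore_rc {f : ∀ κ, P.Reply κ} (hf : Eff fun κ (p : Bits (P.nTd κ) × P.Crs κ ×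
    Bits (P.nX κ) × Bits (P.nV κ) × Bits (P.nV κ)) => f κ p.1 p.2.1 p.2.2.1 p.2.2.2) :
    EffCore fun κ => SPHFwG.rcCore (f κ) where
  rcv := EffD.id.snd
  snd := Eff.optionElim EffD.id.snd.snd.snd.fst ((eff_rcReply hf).comp (EffD.id.snd.fst.mk
    (EffD.id.snd.snd.fst.mk (EffD.id.fst.some.mk EffD.id.snd.snd.snd.snd)))) EffD.id.fst.snd
  view := EffD.id.snd.fst.mk ((EffD.const fun _ => none).mk EffD.id.snd.snd.snd.snd)
  act := by
    refine Eff.sumElim (EffD.toSum EffD.id.fst) (Eff.optionElim EffD.id.fst.snd.snd.snd.snd.fst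
      (Eff.cond (EffD.isWord (EffD.par EffD.id.fst.snd.snd.fst) EffD.id.snd) (Eff.bind
        ((eff_rcReply hf).comp ?_) ?_) ?_) ?_) ?_
    · exact EffD.id.fst.snd.fst.mk (EffD.id.fst.snd.snd.fst.mk (EffD.id.fst.snd.snd.snd.fst.mk
        (EffD.id.snd.some.mk EffD.id.fst.snd.snd.snd.snd.snd)))
    · exact EffD.id.snd.mk (EffD.const fun _ => none)
    · exact EffD.id.fst.snd.mk (EffD.const fun _ => none)
    · exact EffD.id.fst.fst.snd.mk (EffD.const fun _ => none)
    · exact EffD.id.fst.snd.mk (EffD.const fun _ => none)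

end EffRC

theorem OTState.answer_leaked {ℓ : ℕ} {c : Party → Bool} (hr : c .receiver = true)
    (i : OTState ℓ) : (i.answer c).2 = none := by
  obtain ⟨_ | b, _ | m, _ | _, l⟩ := i <;> simp [OTState.answer, hr]

theorem OTState.answer_of_halted {ℓ : ℕ} {c : Party → Bool} {i : OTState ℓ}
    (h : i.choice.isSome = true → i.messages.isSome = true → i.halted = true) :
    i.answer c = (i, none) := by
  obtain ⟨_ | b, _ | m, _ | _, l⟩ := i <;> simp_all [OTState.answer]

namespace SPHFwG

variable (P : SPHFwG)

/-- The internal state of the simulator for a corrupted receiver: the trapdoor of `σ`, the reference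
string, the word received, and the reply. -/
abbrev RCT (κ : ℕ) : Type :=
  Bits (P.nTd κ) × P.Crs κ × Option (Bits (P.nX κ)) × Option (P.Cipher κ × P.Cipher κ)

/-- `σ ∈ S₁` with its trapdoor, and `ρ ∈ R₀`. -/
def crsTd (κ : ℕ) : PMF (Bits (P.nTd κ) × P.Crs κ) :=
  (P.sampS1 κ).bind fun s => (P.sampR0 κ s.1).bind fun ρ => PMF.pure (s.2, s.1, ρ)

/-- The simulator for a corrupted receiver extracts the choice bit from the word received with the
trapdoor of `σ`, gets the chosen message from the functionality, and replies. -/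
def simRC (κ : ℕ) : Sim (P.RCT κ) (P.ProtView κ) (P.ProtAct κ) (P.nV κ) where
  init := (P.crsTd κ).bind fun t => PMF.pure (t.1, t.2, none, none)
  pre := .answer
  upd t v := t.2.2.2.elim (v.2.2.2.elim (PMF.pure t) fun m => t.2.2.1.elim (PMF.pure t) fun x =>
    (P.simReply κ t.1 t.2.1 x m).bind fun c => PMF.pure (t.1, t.2.1, some x, some c))
      fun _ => PMF.pure t
  view t _ := (t.2.1, none, t.2.2.2)
  act q t _ := q.toSum.elim (fun x => t.2.2.1.elim (bif P.isWord κ (P.par t.2.1) x then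
      PMF.pure ((t.1, t.2.1, some x, t.2.2.2), .receiver (P.wordTest κ t.1 x))
    else PMF.pure (t, .answer)) fun _ => PMF.pure (t, .answer)) fun _ => PMF.pure (t, .answer)

variable {P} {κ : ℕ}

/-- The choice bit extracted is that of the functionality; the functionality has given the chosen
message to the simulator if it has halted, which is the case if the reply has been sent. -/
structure RCInv (t : P.RCT κ) (i : OTState (P.nV κ)) : Prop where
  choice : i.choice = t.2.2.1.map (P.wordTest κ t.1)
  reply : t.2.2.2.isSome = true → i.halted = true
  halted : i.halted = true → ∃ b m, i.choice = some b ∧ i.messages = some m ∧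
    i.leaked = some (if b then m.2 else m.1)
  leaked : i.halted = false → i.leaked = none

/-- Moreover the functionality has halted if both records exist. -/
structure RCInv₁ (t : P.RCT κ) (i : OTState (P.nV κ)) : Prop extends RCInv t i where
  answered : i.choice.isSome = true → i.messages.isSome = true → i.halted = true

/-- Moreover the reply has been sent if the functionality has halted. -/
structure RCInv₂ (t : P.RCT κ) (i : OTState (P.nV κ)) : Prop extends RCInv₁ t i where
  replied : i.halted = true → t.2.2.2.isSome = true

/-- The state of the protocol that corresponds to a state of the simulation. The reply has not
been sampled yet if the simulator has not been activated since it became due. -/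
def rcState (t : P.RCT κ) (i : OTState (P.nV κ)) : PMF (P.RCSt κ) :=
  rcReply (P.hybridReply κ) (t.1, t.2.1, i.messages, t.2.2.1, t.2.2.2)

theorem rcState_eq {t : P.RCT κ} {i : OTState (P.nV κ)} (h : RCInv₂ t i) :
    rcState t i = PMF.pure (t.1, t.2.1, i.messages, t.2.2.1, t.2.2.2) := by
  obtain ⟨⟨⟨h1, h2, h3, h4⟩, h5⟩, h6⟩ := h
  obtain ⟨td, crs, _ | x, _ | f⟩ := t <;> obtain ⟨ch, _ | m, ha, l⟩ := i <;>
    simp_all [rcState, rcReply]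

theorem simulates_rc {c : Party → Bool} (hr : c .receiver = true) (hs : c .sender = false) :
    Simulates (P.simRC κ) c (rcCore (P.hybridReply κ)) rcState RCInv RCInv₁ RCInv₂ where
  init t ht := by
    simp only [simRC, PMF.mem_support_bind_iff, PMF.mem_support_pure_iff] at ht
    obtain ⟨t, _, rfl⟩ := ht
    exact ⟨rfl, fun h => (Bool.false_ne_true h).elim, fun h => (Bool.false_ne_true h).elim,
      fun _ => rfl⟩
  rcv t i b hi := by
    simp only [OTState.rcv, hr, if_true, rcCore]
    exact ⟨(PMF.bind_pure _).symm, hi⟩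
  snd t i m hi := by
    simp only [OTState.snd, hs, Bool.false_eq_true, if_false]
    obtain ⟨h1, h2, h3, h4⟩ := hi
    obtain ⟨ch, _ | m', ha, l⟩ := i
    · constructor
      · simp only [rcState, OTState.setMessages]
        simp only [rcReply, Option.elim_none, PMF.pure_bind]
        rfl
      · exact ⟨h1, h2, fun h => (by obtain ⟨b, m, -, h, -⟩ := h3 h; cases h), h4⟩
    · refine ⟨?_, ⟨h1, h2, h3, h4⟩⟩
      obtain ⟨td, crs, _ | x, _ | f⟩ := t <;>
        simp [rcState, rcReply, OTState.setMessages, rcCore]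
  pre t i hi := by
    refine ⟨OTState.answer_leaked hr i, ?_⟩
    obtain ⟨h1, h2, h3, h4⟩ := hi
    obtain ⟨_ | b, _ | m, _ | _, l⟩ := i
    case some.some.false =>
      simp only [OTState.act, simRC, OTState.answer, hr, if_true]
      exact ⟨rfl, ⟨h1, fun _ => rfl, fun _ => ⟨b, m, rfl, rfl, rfl⟩,
        fun h => (Bool.false_ne_true h.symm).elim⟩, fun _ _ => rfl⟩
    all_goals exact ⟨rfl, ⟨h1, h2, h3, h4⟩, by simp [simRC, OTState.act, OTState.answer]⟩
  weaken₁ _ _ h := h.toRCInv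
  weaken₂ _ _ h := h.toRCInv
  upd t i hi := by
    obtain ⟨⟨h1, h2, h3, h4⟩, h5⟩ := hi
    have hp : ∀ h6 : i.halted = true → t.2.2.2.isSome = true,
        (((PMF.pure t).bind fun t' => rcState t' i) = rcState t i) ∧
        ∀ t' ∈ (PMF.pure t).support, RCInv₂ t' i := fun h6 => by
      refine ⟨PMF.pure_bind _ _, fun t' ht' => ?_⟩
      rw [PMF.mem_support_pure_iff] at ht'
      exact ht' ▸ ⟨⟨⟨h1, h2, h3, h4⟩, h5⟩, h6⟩
    obtain ⟨td, crs, x, _ | f⟩ := t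
    · cases ha : i.halted with
      | false =>
        have hl := h4 ha
        simp only [simRC, OTState.view, hl, Option.elim_none]
        exact hp fun h => by rw [ha] at h; cases h
      | true =>
        obtain ⟨b, m, hb, hm, hl⟩ := h3 ha
        rcases x with _ | x
        · rw [h1] at hb; cases hb
        · obtain rfl : P.wordTest κ td x = b := by
            rw [h1] at hb; exact Option.some_injective _ hb
          simp only [simRC, OTState.view, hl, Option.elim_none, Option.elim_some, PMF.bind_bind,
            PMF.pure_bind]
          constructor
          · simp only [rcState, rcReply, hm, Option.elim_none, Option.elim_some]
            rfl
          · intro t' ht'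
            simp only [PMF.mem_support_bind_iff, PMF.mem_support_pure_iff] at ht'
            obtain ⟨d, _, rfl⟩ := ht'
            exact ⟨⟨⟨h1, fun _ => ha, h3, h4⟩, h5⟩, fun _ => rfl⟩
    · exact hp fun _ => rfl
  view t i hi s hs := by
    rw [rcState_eq hi, PMF.mem_support_pure_iff] at hs
    subst hs; rfl
  act t i q hi := by
    have hi1 := hi.toRCInv₁
    have hd : ∀ q : P.ProtAct κ, (rcCore (P.hybridReply κ)).act q
          (t.1, t.2.1, i.messages, t.2.2.1, t.2.2.2) =
          PMF.pure ((t.1, t.2.1, i.messages, t.2.2.1, t.2.2.2), none) →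
        (((PMF.pure (t, (OTAct.answer : OTAct (P.nV κ)))).bind fun w =>
          (rcState w.1 (i.act₂ c w.2 .answer).1).bind fun s =>
            PMF.pure (s, (i.act₂ c w.2 .answer).2)) =
          (rcState t i).bind ((rcCore (P.hybridReply κ)).act q)) ∧
        ∀ w ∈ (PMF.pure (t, (OTAct.answer : OTAct (P.nV κ)))).support,
          RCInv₁ w.1 (i.act₂ c w.2 .answer).1 := fun q hq => by
      have h2 : i.act₂ c .answer .answer = (i, none) := by
        simp only [OTState.act₂, OTState.act, OTState.answer_of_halted hi.answered,
          Option.elim_none]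
      constructor
      · simp only [PMF.pure_bind, h2]
        rw [rcState_eq hi, PMF.pure_bind, PMF.pure_bind, hq]
      · intro w hw
        rw [PMF.mem_support_pure_iff] at hw
        subst hw
        rw [h2]; exact hi1
    obtain ⟨td, crs, x, f⟩ := t
    rcases q with y | d
    · rcases x with _ | x
      · cases hw : P.isWord κ (P.par crs) y
        · have := hd (.deliver1 y) (by simp [rcCore, ProtAct.toSum, hw])
          simpa only [simRC, ProtAct.toSum, Sum.elim_inl, Option.elim_none, hw, cond_false]
            using this
        · rw [rcState_eq hi]
          simp only [simRC, rcCore, ProtAct.toSum, Sum.elim_inl, Option.elim_none, hw, cond_true,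
            PMF.pure_bind]
          obtain ⟨⟨⟨h1, h2, h3, h4⟩, h5⟩, h6⟩ := hi
          obtain ⟨ch, m, ha, l⟩ := i
          simp only [Option.map_none] at h1
          subst h1
          have ha' : ha = false := by
            cases ha
            · rfl
            · obtain ⟨b, m, h, -⟩ := h3 rfl; cases h
          subst ha'
          rcases m with _ | m
          · simp only [OTState.act₂, OTState.act, hr, if_true, OTState.setChoice, Option.elim_none,
              OTState.answer]
            refine ⟨rfl, fun w hw => ?_⟩
            rw [PMF.mem_support_pure_iff] at hw
            subst hw
            exact ⟨⟨rfl, h2, fun h => (Bool.false_ne_true h).elim, h4⟩, fun _ h => (Bool.false_ne_true h).elim⟩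
          · simp only [OTState.act₂, OTState.act, hr, if_true, OTState.setChoice, Option.elim_none,
              OTState.answer]
            refine ⟨rfl, fun w hw => ?_⟩
            rw [PMF.mem_support_pure_iff] at hw
            subst hw
            exact ⟨⟨rfl, fun _ => rfl, fun _ => ⟨_, m, rfl, rfl, rfl⟩,
              fun h => (Bool.false_ne_true h.symm).elim⟩, fun _ _ => rfl⟩
      · exact hd (.deliver1 y) rfl
    · exact hd (.deliver2 d) rfl

end SPHFwG

theorem effSim_rc (P : SPHFwG) [hP : Fact P.IsSPHFwG] (c : Party → Bool) :
    EffSim (W := P.protocolOT c) P.simRC where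
  init := Eff.bind (Eff.bind hP.out.efficient.sampS1.eff (Eff.bind
      (hP.out.efficient.sampR0.eff.comp EffD.id.snd.fst)
      (EffD.id.fst.snd.snd.mk (EffD.id.fst.snd.fst.mk EffD.id.snd))))
    (EffD.mk EffD.id.snd.fst (EffD.id.snd.snd.mk (EffD.const fun κ =>
      ((none, none) : Option (Bits (P.nX κ)) × Option (P.Cipher κ × P.Cipher κ)))))
  upd := by
    refine Eff.optionElim EffD.id.fst.snd.snd.snd (Eff.optionElim EffD.id.snd.snd.snd.snd
      EffD.id.fst (Eff.optionElim EffD.id.fst.fst.snd.snd.fst EffD.id.fst.fst (Eff.bind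
        (eff_simReply.comp (EffD.id.fst.fst.fst.fst.mk (EffD.id.fst.fst.fst.snd.fst.mk
          (EffD.id.snd.mk EffD.id.fst.snd)))) ?_))) EffD.id.fst.fst
    exact EffD.id.fst.fst.fst.fst.fst.mk (EffD.id.fst.fst.fst.fst.snd.fst.mk
      (EffD.id.fst.snd.some.mk EffD.id.snd.some))
  view := EffD.id.fst.snd.fst.mk ((EffD.const fun _ => none).mk EffD.id.fst.snd.snd.snd)
  act := by
    have ha : ∀ {D : ℕ → Type} [∀ κ, BitCode (D κ)] {t : ∀ κ, D κ → P.RCT κ}, EffD t →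
        EffD fun κ d => (t κ d, (OTAct.answer : OTAct (P.nV κ))) := fun ht =>
      ht.mk (EffD.const fun _ => OTAct.answer)
    refine Eff.sumElim (EffD.toSum EffD.id.fst) (Eff.optionElim EffD.id.fst.snd.fst.snd.snd.fst
      (Eff.cond (EffD.isWord (EffD.par EffD.id.fst.snd.fst.snd.fst) EffD.id.snd) ?_
        (ha EffD.id.fst.snd.fst)) (ha EffD.id.fst.fst.snd.fst)) (ha EffD.id.fst.snd.fst)
    exact EffD.mk (EffD.id.fst.snd.fst.fst.mk (EffD.id.fst.snd.fst.snd.fst.mk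
      (EffD.id.snd.some.mk EffD.id.fst.snd.fst.snd.snd.snd)))
      (EffD.otReceiver (EffD.wordTest EffD.id.fst.snd.fst.fst EffD.id.snd))

namespace SPHFwG

variable {P : SPHFwG}

/-- The start of an execution with corrupted receiver. -/
def rcStart {κ : ℕ} (t : Bits (P.nTd κ) × P.Crs κ) : P.RCSt κ := (t.1, t.2, none, none, none)

theorem crsTd_support {κ : ℕ} {t : Bits (P.nTd κ) × P.Crs κ} (ht : t ∈ (P.crsTd κ).support) :
    P.rcInv κ (rcStart t) := by
  simp only [crsTd, PMF.mem_support_bind_iff, PMF.mem_support_pure_iff] at ht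
  obtain ⟨s, hs, ρ, hρ, rfl⟩ := ht
  exact ⟨⟨hs, hρ⟩, fun x hx => by cases hx⟩

theorem exec_protocolOT_rc {c : Party → Bool} (hr : c .receiver = true)
    (hs : c .sender = false) {n : ℕ → ℕ} (A : Adversary (P.protocolOT c) n)
    (E : Environment P.nV n) (κ : ℕ) (td : Bits (P.nTd κ)) (s : P.Crs κ) :
    (play A E κ).bit (P.protCore c κ) (ProtState.init s) =
      (play A E κ).bit (rcCore (P.honestReply κ)) (rcStart (td, s)) := by
  rw [(protCore_intertwines_rc hr hs).bit (G := play A E κ) _ trivial, PMF.pure_bind]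
  rfl

/-- The searcher for two complementary words outside of `ℒ'` that runs the execution with corrupted
receiver, and returns the word received by the sender with its complement. -/
def rcSearch {c : Party → Bool} {n : ℕ → ℕ} (A : Adversary (P.protocolOT c) n)
    (E : Environment P.nV n) (κ : ℕ) (t : Bits (P.nS κ) × Bits (P.nTd κ) × Bits (P.nR κ)) :
    PMF (Bits (P.nX κ) × Bits (P.nX κ)) :=
  ((play A E κ).run (rcCore (P.honestReply κ)) (rcStart (t.2.1, t.1, t.2.2))).bind fun y =>
    PMF.pure (y.2.2.1.2.2.2.1.elim (fun _ => false, fun _ => false) fun x =>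
      (x, P.compl y.2.2.1.2.1 x))

theorem eff_rcSearch [Fact P.IsSPHFwG] {c : Party → Bool} {n : ℕ → ℕ}
    (A : Adversary (P.protocolOT c) n) (E : Environment P.nV n) : Eff (rcSearch A E) := by
  have hst : EffD fun κ (t : Bits (P.nS κ) × Bits (P.nTd κ) × Bits (P.nR κ)) =>
      (rcStart (t.2.1, t.1, t.2.2) : P.RCSt κ) :=
    EffD.id.snd.fst.mk ((EffD.id.fst.mk EffD.id.snd.snd).mk (EffD.const fun κ =>
      ((none, none, none) : Option (Bits (P.nV κ) × Bits (P.nV κ)) × Option (Bits (P.nX κ)) ×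
        Option (P.Cipher κ × P.Cipher κ))))
  refine Eff.bind ((eff_run A E (effCore_rc eff_honestReply)).comp hst) (EffD.optionElim
    EffD.id.snd.snd.snd.fst.snd.snd.snd.fst (EffD.const fun κ => _) ?_)
  exact EffD.id.snd.mk (EffD.compl EffD.id.fst.snd.snd.snd.fst.snd.fst EffD.id.snd)

/-- In an execution with corrupted receiver, the sender gets a word outside of `ℒ'` with complement
outside of `ℒ'` only with negligible probability. -/
theorem negl_rcBad (hP : P.IsSPHFwG) {c : Party → Bool} {n : ℕ → ℕ}
    (A : Adversary (P.protocolOT c) n) (E : Environment P.nV n) :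
    Negl fun κ => prob ((P.crsTd κ).bind fun t =>
      (play A E κ).run (rcCore (P.honestReply κ)) (rcStart t)) {x | x.2.2.1 ∈ P.rcBad κ} := by
  have : Fact P.IsSPHFwG := ⟨hP⟩
  refine (hP.decompositionIntractability (rcSearch A E) (eff_rcSearch A E).polyTime).of_le
    (fun _ => ENNReal.toReal_nonneg) fun κ => ?_
  rw [prob_eq, prob_eq]
  refine ENNReal.toReal_mono ((expect_le_one fun a => Set.indicator_le_self _ 1 a).trans_lt
    ENNReal.one_lt_top).ne ?_
  simp only [decompose, crsTd, PMF.do_bind, PMF.do_pure, rcSearch, PMF.bind_bind, PMF.pure_bind,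
    expect_bind, expect_pure]
  refine expect_mono fun s hs => expect_mono fun ρ hρ => expect_mono fun y hy => ?_
  obtain ⟨hI, he⟩ := rcInv_run (play A E κ) (P.honestReply κ) (rcStart (s.2, s.1, ρ))
    (crsTd_support (by
      simp only [crsTd, PMF.mem_support_bind_iff, PMF.mem_support_pure_iff]
      exact ⟨s, hs, ρ, hρ, rfl⟩)) y hy
  by_cases hb : y.2.2.1 ∈ P.rcBad κ
  · obtain ⟨x, hx, hx1, hx2⟩ := hb
    have hw := hI.2 x hx
    rw [he] at hx1 hx2 hw
    rw [Option.mem_def] at hx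
    have hX : x ∈ P.X κ (P.setup κ s.1 ρ) := Finset.mem_filter.2 ⟨Finset.mem_univ _, hw⟩
    rw [hx, Option.elim_some, he]
    refine (Set.indicator_le_self _ _ _).trans (le_of_eq ?_)
    rw [Set.indicator_of_mem]
    · rfl
    exact ⟨⟨hX, hx1⟩, ⟨(hP.complement κ s.1 ρ (Or.inr ⟨s.2, hs⟩) hρ x hX).1, hx2⟩, rfl⟩
  · rw [Set.indicator_of_notMem (show y ∉ {x | x.2.2.1 ∈ P.rcBad κ} from hb)]
    exact zero_le

end SPHFwG

theorem realizes_receiverCorrupted (P : SPHFwG) (hP : P.IsSPHFwG) {c : Party → Bool}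
    (hr : c .receiver = true) (hs : c .sender = false) :
    UCEmulates (P.protocolOT c) (idealOT P.nV c) := by
  intro n A
  have : Fact P.IsSPHFwG := ⟨hP⟩
  refine ⟨simAdversary c A _ (effSim_rc P c), fun E => ?_⟩
  obtain ⟨ε, hε, hsm⟩ := hP.smoothness
  let H : ∀ κ, P.RCSt κ → PMF Bool := fun κ => (play A E κ).bit (SPHFwG.rcCore (P.honestReply κ))
  let H' : ∀ κ, P.RCSt κ → PMF Bool := fun κ => (play A E κ).bit (SPHFwG.rcCore (P.hybridReply κ))
  let D : ∀ κ, P.Crs κ → PMF Bool := fun κ s => H κ (SPHFwG.rcStart (fun _ => false, s))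
  have hD : Eff D := (eff_bit A E (effCore_rc eff_honestReply)).comp
    ((EffD.const fun κ => ((fun _ => false) : Bits (P.nTd κ))).mk (EffD.id.mk (EffD.const fun κ =>
      ((none, none, none) : Option (Bits (P.nV κ) × Bits (P.nV κ)) × Option (Bits (P.nX κ)) ×
        Option (P.Cipher κ × P.Cipher κ)))))
  have hreal : ∀ κ, exec (P.protocolOT c) A E κ = (P.crs00 κ).bind (D κ) := fun κ => by
    rw [P.exec_protocolOT]
    exact congrArg (PMF.bind _) (funext fun s => SPHFwG.exec_protocolOT_rc hr hs A E κ _ s)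
  have hhyb : ∀ κ, (P.crs10 κ).bind (D κ) = (P.crsTd κ).bind fun t => H κ (SPHFwG.rcStart t) :=
    fun κ => by
      simp only [SPHFwG.crs10, SPHFwG.crsTd, PMF.do_bind, PMF.do_pure, PMF.bind_bind,
        PMF.pure_bind]
      -- the trapdoor of `σ` is not used by the honest sender
      refine congrArg (PMF.bind _) (funext fun s => congrArg (PMF.bind _) (funext fun ρ => ?_))
      exact (SPHFwG.exec_protocolOT_rc hr hs A E κ _ _).symm.trans
        (SPHFwG.exec_protocolOT_rc hr hs A E κ _ _)
  have hideal : ∀ κ, exec (idealOT P.nV c) (simAdversary c A P.simRC (effSim_rc P c)) E κ =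
      (P.crsTd κ).bind fun t => H' κ (SPHFwG.rcStart t) := fun κ => by
    rw [exec_simAdversary A E (effSim_rc P c) κ (SPHFwG.simulates_rc hr hs)]
    simp only [SPHFwG.simRC, PMF.bind_bind, PMF.pure_bind, SPHFwG.rcState, SPHFwG.rcReply,
      OTState.init, Option.elim_none]
    rfl
  have h1 := hP.crsIndistinguishability.1 D hD.polyTime
  let N : ℕ → ℕ := fun κ => E.rounds κ * (A.fuel κ + 1)
  have hN : PolyBdd N := E.rounds_poly.mul (A.fuel_poly.add (PolyBdd.const 1))
  have h2 := (hε.max_zero.poly_mul hN).add (SPHFwG.negl_rcBad hP A E)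
  refine (h1.add h2).of_le (fun _ => abs_nonneg _) fun κ => ?_
  rw [hreal, hideal]
  refine (abs_sub_le _ _ _).trans (add_le_add le_rfl ?_)
  rw [hhyb]
  have hnear := (Near.bind_left' fun t ht => SPHFwG.near_rc_run (play A E κ) hP (hsm κ)
    (SPHFwG.rcStart t) (SPHFwG.crsTd_support ht)).of_bad
  have hb := (hnear.bind fun x => (play A E κ).guess (x.1, x.2.2.2)).abs_prob
    (ENNReal.add_ne_top.2 ⟨ENNReal.mul_ne_top (ENNReal.natCast_ne_top _) (ENNReal.mul_ne_top
      (by finiteness) ENNReal.ofReal_ne_top), ?_⟩)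
  · rw [PMF.bind_bind, PMF.bind_bind] at hb
    refine hb.trans ((ENNReal.toReal_add_le).trans (add_le_add (le_of_eq ?_) le_rfl))
    simp only [N, ENNReal.toReal_mul, ENNReal.toReal_natCast, ENNReal.toReal_ofReal']
    rw [show ((play A E κ).fuel : ℝ≥0∞) + 1 = ((A.fuel κ + 1 : ℕ) : ℝ≥0∞) by push_cast; rfl,
      ENNReal.toReal_natCast, Nat.cast_mul, mul_assoc]
    rfl
  · rw [← expect_indicator]
    exact ((expect_le_one fun a => Set.indicator_le_self _ 1 a).trans_lt ENNReal.one_lt_top).ne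

/-! ### Sender corrupted, receiver honest -/

namespace SPHFwG

variable (P : SPHFwG)

/-- What the receiver has to sample: its flow, and the word of `ℒ` with a witness. -/
abbrev SCR (κ : ℕ) : Type := Bits (P.nX κ) × Bits (P.nX κ) × Bits (P.nW κ)

/-- The state after the choice: the reference string, the choice bit, the presampled values, and
whether the receiver has finished. -/
abbrev SCK (κ : ℕ) : Type := P.Crs κ × Bool × P.SCR κ × Bool

/-- The protocol with corrupted sender, when the flow and the witness of the receiver are sampled in
advance for both choice bits. -/
def scSys (κ : ℕ) :
    ChoiceSys (P.Crs κ) (P.SCR κ) (P.SCK κ) (P.ProtView κ) (P.ProtAct κ) (Bits (P.nV κ)) where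
  choose b p u := (u, b, p, false)
  sndU _ u := u
  viewU u := (u, none, none)
  sndK _ k := k
  viewK k := (k.1, some k.2.2.1.1, none)
  actK q k := q.toSum.elim (fun _ => PMF.pure (k, none)) fun d =>
    bif k.2.2.2 then PMF.pure (k, none) else
      (P.decrypt κ (P.par k.1) k.2.2.1.2.1 k.2.2.1.2.2 (bif k.2.1 then d.2 else d.1)).bind fun m =>
        PMF.pure ((k.1, k.2.1, k.2.2.1, true), some m)

variable {κ : ℕ}

/-- The flow of the receiver with choice bit `b` and the word `x` of `ℒ`. -/
def flow (s : P.Crs κ) (b : Bool) (x : Bits (P.nX κ)) : Bits (P.nX κ) :=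
  bif b then P.compl s x else x

/-- The values sampled by the receiver. -/
def scGen (b : Bool) (s : P.Crs κ) : PMF (P.SCR κ) :=
  (P.wordGenL κ (P.par s)).bind fun xw => PMF.pure (P.flow s b xw.1, xw)

variable {P}

/-- The state of the protocol, with values sampled in advance. -/
def scState (s : P.ProtState κ) : PMF ((P.Crs κ × P.SCR κ × P.SCR κ) ⊕ P.SCK κ) :=
  s.chosen.elim ((P.scGen false s.crs).bind fun p₀ => (P.scGen true s.crs).bind fun p₁ =>
    PMF.pure (Sum.inl (s.crs, p₀, p₁))) fun y =>
      PMF.pure (Sum.inr (s.crs, y.1, (P.flow s.crs y.1 y.2.1, y.2), s.finished))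

/-- The flow of the receiver is determined by its choice bit and its word. -/
def ScInv (s : P.ProtState κ) : Prop :=
  s.flow1 = s.chosen.map (fun y => P.flow s.crs y.1 y.2.1) ∧ s.flow2 = none ∧
    (s.chosen = none → s.finished = false)

/-- Sampling the values of the receiver in advance, for both choice bits, has no effect. -/
theorem protCore_intertwines_sc {c : Party → Bool} (hr : c .receiver = false)
    (hs : c .sender = true) :
    Intertwines (P.protCore c κ) (P.scSys κ).core scState ScInv := by
  have hflow : ∀ (s : P.Crs κ) (b : Bool) (x : Bits (P.nX κ)),
      (if b = true then P.complement κ (P.par s) s.2 x else x) = P.flow s b x := by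
    intro s b x; cases b <;> rfl
  refine ⟨fun s b hI => ?_, fun s m hI => ?_, fun s hI s' hs' => ?_, fun s q hI => ?_,
    fun s b hI t ht => ?_, fun s m hI t ht => ?_, fun s q hI u hu => ?_⟩
  · obtain ⟨crs, ch, f1, fin, ms, rc, f2⟩ := s
    obtain ⟨h1, h2, h3⟩ := hI
    rcases ch with _ | ⟨b', xw⟩
    · obtain rfl : fin = false := h3 rfl
      simp only [protCore, hr, Bool.false_eq_true, if_false, receiverStart, PMF.do_bind,
        PMF.do_pure, PMF.bind_bind, PMF.pure_bind, scState, Option.elim_none, Option.elim_some,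
        ChoiceSys.core, Sum.elim_inl]
      cases b
      · simp only [PMF.bind_const, scGen, PMF.bind_bind, PMF.pure_bind, cond_false]
        rfl
      · simp only [PMF.bind_const, scGen, PMF.bind_bind, PMF.pure_bind, cond_true]
        rfl
    · simp only [protCore, hr, Bool.false_eq_true, if_false, receiverStart, PMF.pure_bind, scState,
        Option.elim_some]
      rfl
  · simp only [protCore, hs, if_true, PMF.pure_bind]
    refine (PMF.bind_pure _).symm.trans (congrArg (PMF.bind _) (funext fun x => ?_))
    rcases x with x | x <;> rfl
  · obtain ⟨crs, ch, f1, fin, ms, rc, f2⟩ := s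
    obtain ⟨h1, h2, h3⟩ := hI
    rcases ch with _ | ⟨b', xw⟩
    · simp only [scState, Option.elim_none, PMF.mem_support_bind_iff,
        PMF.mem_support_pure_iff] at hs'
      obtain ⟨_, _, _, _, rfl⟩ := hs'
      simp only [Option.map_none] at h1 h2
      subst h1 h2; rfl
    · simp only [scState, Option.elim_some, PMF.mem_support_pure_iff] at hs'
      simp only [Option.map_some] at h1 h2
      subst hs' h1 h2; rfl
  · rcases q with y | d
    · simp only [protCore, hs, if_true, PMF.pure_bind]
      refine congrArg (PMF.bind _) (funext fun x => ?_)
      rcases x with x | x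
      · rfl
      · simp only [ChoiceSys.core, Sum.elim_inr, scSys, ProtAct.toSum, Sum.elim_inl, PMF.pure_bind]
    · obtain ⟨crs, ch, f1, fin, ms, rc, f2⟩ := s
      obtain ⟨h1, h2, h3⟩ := hI
      rcases ch with _ | ⟨b', xw⟩
      · simp only [protCore, hr, hs, if_true, Bool.false_eq_true, if_false, receiverFinish,
          PMF.pure_bind, scState, Option.elim_none, PMF.bind_bind]
        rfl
      · cases fin
        · simp only [protCore, hr, hs, if_true, Bool.false_eq_true, if_false, receiverFinish,
            PMF.pure_bind, scState, Option.elim_some, PMF.bind_bind, PMF.do_bind, PMF.do_pure,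
            ChoiceSys.core, Sum.elim_inr, scSys, ProtAct.toSum, cond_false]
          cases b' <;> rfl
        · simp only [protCore, hr, hs, if_true, Bool.false_eq_true, if_false, receiverFinish,
            PMF.pure_bind, scState, Option.elim_some,
            ChoiceSys.core, Sum.elim_inr, scSys, ProtAct.toSum, cond_true]
  · obtain ⟨crs, ch, f1, fin, ms, rc, f2⟩ := s
    rcases ch with _ | ⟨b', xw⟩
    · simp only [protCore, hr, Bool.false_eq_true, if_false, receiverStart, PMF.do_bind,
        PMF.do_pure, PMF.mem_support_bind_iff, PMF.mem_support_pure_iff] at ht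
      obtain ⟨xw, _, rfl⟩ := ht
      exact ⟨congrArg some (hflow _ _ _), hI.2.1, fun h => by cases h⟩
    · simp only [protCore, hr, Bool.false_eq_true, if_false, receiverStart,
        PMF.mem_support_pure_iff] at ht
      exact ht ▸ hI
  · simp only [protCore, hs, if_true, PMF.mem_support_pure_iff] at ht
    exact ht ▸ hI
  · rcases q with y | d
    · simp only [protCore, hs, if_true, PMF.mem_support_pure_iff] at hu
      subst hu; exact hI
    · obtain ⟨crs, _ | ⟨b', xw⟩, f1, _ | _, ms, rc, f2⟩ := s
      case refine_7.deliver2.some.false =>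
        simp only [protCore, hr, hs, if_true, Bool.false_eq_true, if_false, receiverFinish,
          PMF.do_bind, PMF.do_pure, PMF.mem_support_bind_iff, PMF.mem_support_pure_iff] at hu
        obtain ⟨m, _, rfl⟩ := hu
        exact ⟨hI.1, hI.2.1, fun h => by cases h⟩
      all_goals
        simp only [protCore, hr, hs, if_true, Bool.false_eq_true, if_false, receiverFinish,
          PMF.mem_support_pure_iff] at hu
        subst hu; exact hI

variable (P)

/-- `σ ∈ S₀`, and `ρ ∈ R₁` with its trapdoor. -/
def crsTrap (κ : ℕ) : PMF (P.Crs κ × (Bits (P.nX κ) × Bits (P.nW κ)) ×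
    (Bits (P.nX κ) × Bits (P.nW κ))) :=
  (P.sampS0 κ).bind fun σ => (P.sampR1 κ σ).bind fun r => PMF.pure ((σ, r.1), r.2)

/-- The simulator for a corrupted sender uses the trapdoor of `ρ`, which provides witnesses for
both words, to decrypt both messages. -/
def simSC (κ : ℕ) : Sim (P.Crs κ × (Bits (P.nX κ) × Bits (P.nW κ)) ×
    (Bits (P.nX κ) × Bits (P.nW κ))) (P.ProtView κ) (P.ProtAct κ) (P.nV κ) where
  init := P.crsTrap κ
  pre := .answer
  upd t _ := PMF.pure t
  view t v := (t.1, bif v.1 then some t.2.1.1 else none, none)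
  act q t v := q.toSum.elim (fun _ => PMF.pure (t, .receiver false)) fun d =>
    bif v.1 then bif v.2.2.1 then PMF.pure (t, .receiver false) else
      (P.decrypt κ (P.par t.1) t.2.1.1 t.2.1.2 d.1).bind fun m₀ =>
        (P.decrypt κ (P.par t.1) t.2.2.1 t.2.2.2 d.2).bind fun m₁ =>
          PMF.pure (t, .sender (m₀, m₁))
    else PMF.pure (t, .receiver false)

variable {P}

theorem simulates_sc {c : Party → Bool} (hr : c .receiver = false) (hs : c .sender = true) :
    Simulates (P.simSC κ) c (P.scSys κ).core
      (fun t i => PMF.pure (i.choice.elim (Sum.inl (t.1, (t.2.1.1, t.2.1), (t.2.1.1, t.2.2)))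
        fun b => Sum.inr (t.1, b, (t.2.1.1, bif b then t.2.2 else t.2.1), i.halted)))
      (fun _ i => (i.halted = false → i.messages = none) ∧ (i.halted = true → i.choice.isSome = true))
      (fun _ i => (i.halted = false → i.messages = none) ∧ (i.halted = true → i.choice.isSome = true))
      (fun _ i => (i.halted = false → i.messages = none) ∧ (i.halted = true → i.choice.isSome = true))
      where
  init t _ := ⟨fun _ => rfl, fun h => (Bool.false_ne_true h).elim⟩
  rcv t i b hi := by
    obtain ⟨_ | b', ms, ha, l⟩ := i
    · obtain rfl : ha = false := by
        cases ha
        · rfl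
        · exact (Bool.false_ne_true (hi.2 rfl)).elim
      simp only [OTState.rcv, hr, Bool.false_eq_true, if_false, OTState.setChoice, PMF.pure_bind,
        Option.elim_none, Option.elim_some]
      exact ⟨by cases b <;> rfl, fun _ => hi.1 rfl, fun _ => rfl⟩
    · simp only [OTState.rcv, hr, Bool.false_eq_true, if_false, OTState.setChoice, PMF.pure_bind,
        Option.elim_some]
      exact ⟨rfl, hi⟩
  snd t i m hi := by
    simp only [OTState.snd, hs, if_true, PMF.pure_bind]
    refine ⟨?_, hi⟩
    cases i.choice <;> rfl
  pre t i hi := by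
    obtain ⟨ch, ms, _ | _, l⟩ := i
    · obtain rfl : ms = none := hi.1 rfl
      rcases ch with _ | b <;> exact ⟨rfl, rfl, hi⟩
    · exact ⟨rfl, rfl, hi⟩
  weaken₁ _ _ h := h
  weaken₂ _ _ h := h
  upd t i hi := by
    refine ⟨PMF.pure_bind _ _, fun _ _ => hi⟩
  view t i hi s hs' := by
    rw [PMF.mem_support_pure_iff] at hs'
    subst hs'
    obtain ⟨_ | b, ms, ha, l⟩ := i <;> rfl
  act t i q hi := by
    have h2 : i.act₂ c (.receiver false) .answer = (i, none) := by
      obtain ⟨ch, ms, _ | _, l⟩ := i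
      · obtain rfl : ms = none := hi.1 rfl
        rcases ch with _ | b <;> simp [OTState.act₂, OTState.act, hr, OTState.answer]
      · simp [OTState.act₂, OTState.act, hr, OTState.answer]
    have hd : ∀ (q : P.ProtAct κ) (s : (P.Crs κ × P.SCR κ × P.SCR κ) ⊕ P.SCK κ),
        (P.scSys κ).core.act q s = PMF.pure (s, none) →
        s = (i.choice.elim (Sum.inl (t.1, (t.2.1.1, t.2.1), (t.2.1.1, t.2.2)))
          fun b => Sum.inr (t.1, b, (t.2.1.1, bif b then t.2.2 else t.2.1), i.halted)) →
        (((PMF.pure (t, (OTAct.receiver false : OTAct (P.nV κ)))).bind fun w =>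
          (PMF.pure ((i.act₂ c w.2 .answer).1.choice.elim
            (Sum.inl (w.1.1, (w.1.2.1.1, w.1.2.1), (w.1.2.1.1, w.1.2.2)))
            fun b => Sum.inr (w.1.1, b, (w.1.2.1.1, bif b then w.1.2.2 else w.1.2.1),
              (i.act₂ c w.2 .answer).1.halted))).bind fun s =>
            PMF.pure (s, (i.act₂ c w.2 .answer).2)) =
          (PMF.pure s).bind ((P.scSys κ).core.act q)) ∧
        ∀ w ∈ (PMF.pure (t, (OTAct.receiver false : OTAct (P.nV κ)))).support,
          ((i.act₂ c w.2 .answer).1.halted = false → (i.act₂ c w.2 .answer).1.messages = none) ∧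
          ((i.act₂ c w.2 .answer).1.halted = true →
            (i.act₂ c w.2 .answer).1.choice.isSome = true) := fun q s hq he => by
      constructor
      · rw [PMF.pure_bind, PMF.pure_bind, PMF.pure_bind, hq, h2, he]
      · intro w hw
        rw [PMF.mem_support_pure_iff] at hw
        subst hw
        rw [h2]; exact hi
    rcases q with y | d
    · refine hd (.deliver1 y) _ ?_ rfl
      cases i.choice <;>
        simp [ChoiceSys.core, scSys, ProtAct.toSum]
    · obtain ⟨_ | b, ms, ha, l⟩ := i
      · exact hd (.deliver2 d) _ rfl rfl
      · cases ha
        · obtain rfl : ms = none := hi.1 rfl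
          have h3 : ∀ m, OTState.act₂ c (.sender m) .answer
              (⟨some b, none, false, l⟩ : OTState (P.nV κ)) =
              (⟨some b, some m, true, l⟩, some (bif b then m.2 else m.1)) := by
            intro m
            simp only [OTState.act₂, OTState.act, hs, if_true, OTState.setMessages,
              Option.elim_none, OTState.answer, hr, Bool.false_eq_true, if_false]
            cases b <;> rfl
          constructor
          · simp only [simSC, ProtAct.toSum, Sum.elim_inr, OTState.view, Option.isSome, cond_true,
              cond_false, PMF.bind_bind, PMF.pure_bind, h3, ChoiceSys.core, scSys, Option.elim_some]
            cases b
            · simp only [cond_false, PMF.bind_const]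
            · simp only [cond_true, PMF.bind_const]
          · intro w hw
            simp only [simSC, ProtAct.toSum, Sum.elim_inr, OTState.view, Option.isSome, cond_true,
              cond_false, PMF.mem_support_bind_iff, PMF.mem_support_pure_iff] at hw
            obtain ⟨_, _, _, _, rfl⟩ := hw
            rw [show (P.simSC κ).pre = .answer from rfl, h3]
            exact ⟨fun h => (Bool.false_ne_true h.symm).elim, fun _ => rfl⟩
        · refine hd (.deliver2 d) _ ?_ rfl
          simp [ChoiceSys.core, scSys, ProtAct.toSum]

end SPHFwG

theorem SPHFwG.crs00_support (P : SPHFwG) {κ : ℕ} {s : P.Crs κ} (hs : s ∈ (P.crs00 κ).support) :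
    s.1 ∈ (P.sampS0 κ).support ∧ s.2 ∈ (P.sampR0 κ s.1).support := by
  simp only [SPHFwG.crs00, PMF.do_bind, PMF.do_pure, PMF.mem_support_bind_iff,
    PMF.mem_support_pure_iff] at hs
  obtain ⟨σ, h1, ρ, h2, rfl⟩ := hs
  exact ⟨h1, h2⟩

section SenderCorrupted

variable (P : SPHFwG) [hP : Fact P.IsSPHFwG]

theorem effCore_sc : EffCore fun κ => (P.scSys κ).core := by
  refine ChoiceSys.effCore (fun b => ?_) EffD.id.snd ?_ EffD.id.snd ?_ ?_
  · exact EffD.id.snd.mk ((EffD.const fun _ => b).mk (EffD.id.fst.mk (EffD.const fun _ => false)))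
  · exact EffD.id.mk (EffD.const fun κ => ((none, none) : Option (Bits (P.nX κ)) ×
      Option (P.Cipher κ × P.Cipher κ)))
  · exact EffD.id.fst.mk (EffD.id.snd.snd.fst.fst.some.mk (EffD.const fun _ => none))
  · refine Eff.sumElim (EffD.toSum EffD.id.fst) (EffD.id.fst.snd.mk (EffD.const fun _ => none))
      (Eff.cond EffD.id.fst.snd.snd.snd.snd (EffD.id.fst.snd.mk (EffD.const fun _ => none))
        (Eff.bind (Eff.decrypt (EffD.par EffD.id.fst.snd.fst) EffD.id.fst.snd.snd.snd.fst.snd.fst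
          EffD.id.fst.snd.snd.snd.fst.snd.snd
          (EffD.cond EffD.id.fst.snd.snd.fst EffD.id.snd.snd EffD.id.snd.fst)) ?_))
    exact (EffD.id.fst.fst.snd.fst.mk (EffD.id.fst.fst.snd.snd.fst.mk
      (EffD.id.fst.fst.snd.snd.snd.fst.mk (EffD.const fun _ => true)))).mk EffD.id.snd.some

theorem effSim_sc (c : Party → Bool) : EffSim (W := P.protocolOT c) P.simSC where
  init := Eff.bind hP.out.efficient.sampS0.eff (Eff.bind
    (hP.out.efficient.sampR1.eff.comp EffD.id.snd)
    (EffD.mk (EffD.id.fst.snd.mk EffD.id.snd.fst) EffD.id.snd.snd))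
  upd := EffD.id.fst
  view := EffD.id.fst.fst.mk ((EffD.cond EffD.id.snd.fst EffD.id.fst.snd.fst.fst.some
    (EffD.const fun _ => none)).mk (EffD.const fun _ => none))
  act := by
    have ha : ∀ {D : ℕ → Type} [∀ κ, BitCode (D κ)] {t : ∀ κ, D κ → P.Crs κ ×
        (Bits (P.nX κ) × Bits (P.nW κ)) × (Bits (P.nX κ) × Bits (P.nW κ))}, EffD t →
        EffD fun κ d => (t κ d, (OTAct.receiver false : OTAct (P.nV κ))) := fun ht =>
      ht.mk (EffD.const fun _ => OTAct.receiver false)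
    refine Eff.sumElim (EffD.toSum EffD.id.fst) (ha EffD.id.fst.snd.fst) (Eff.cond
      EffD.id.fst.snd.snd.fst (Eff.cond EffD.id.fst.snd.snd.snd.snd.fst (ha EffD.id.fst.snd.fst)
        (Eff.bind (Eff.decrypt (EffD.par EffD.id.fst.snd.fst.fst) EffD.id.fst.snd.fst.snd.fst.fst
          EffD.id.fst.snd.fst.snd.fst.snd EffD.id.snd.fst) (Eff.bind (Eff.decrypt
            (EffD.par EffD.id.fst.fst.snd.fst.fst) EffD.id.fst.fst.snd.fst.snd.snd.fst
            EffD.id.fst.fst.snd.fst.snd.snd.snd EffD.id.fst.snd.snd) ?_)))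
        (ha EffD.id.fst.snd.fst))
    exact EffD.mk EffD.id.fst.fst.fst.snd.fst (EffD.otSender (EffD.id.fst.snd.mk EffD.id.snd))

/-- A reference string of the normal use with a random word of `ℒ` and its witness. -/
def crsWord (κ : ℕ) : PMF (P.Crs κ × Bits (P.nX κ) × Bits (P.nW κ)) :=
  (P.crs00 κ).bind fun s => (P.wordGenL κ (P.par s)).bind fun xw => PMF.pure (s, xw)

theorem crsWord_crsFresh : CompIndist (crsWord P) P.crsFresh :=
  CompIndist.bind hP.out.crsIndistinguishability.2.1 (Eff.bind (Eff.wordGenL (EffD.par EffD.id))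
    (EffD.id.fst.mk EffD.id.snd))

/-- The complement of the second word of the trapdoor of `ρ ∈ R₁` is the first word, with
overwhelming probability: `complement` is an involution for `ρ ∈ R₀`, which can be tested. -/
theorem negl_compl : Negl fun κ => prob (P.crsTrap κ)
    {t | P.compl t.1 t.2.2.1 ≠ t.2.1.1} := by
  let g : ∀ κ, P.Crs κ × Bits (P.nX κ) × Bits (P.nW κ) → Bool := fun κ t =>
    bif decide (P.compl t.1 (P.compl t.1 t.2.1) = t.2.1) then false else true
  have hg : EffD g := EffD.cond (EffD.beq (EffD.compl EffD.id.fst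
    (EffD.compl EffD.id.fst EffD.id.snd.fst)) EffD.id.snd.fst) (EffD.const fun _ => false)
    (EffD.const fun _ => true)
  have h := (hP.out.trapdoorR1.2.1.trans (crsWord_crsFresh P).symm).negl_event hg fun κ t ht => by
    simp only [crsWord, PMF.mem_support_bind_iff, PMF.mem_support_pure_iff] at ht
    obtain ⟨s, hs, xw, hxw, rfl⟩ := ht
    obtain ⟨h1, h2⟩ := P.crs00_support hs
    have hX := (hP.out.wordGen.1 κ s.1 s.2 (Or.inl h1) (Or.inl h2) xw hxw).1
    have := (hP.out.complement κ s.1 s.2 (Or.inl h1) h2 xw.1 hX).2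
    have h3 : P.compl s (P.compl s xw.1) = xw.1 := this
    simp only [g, h3, decide_true, cond_true]
  refine h.of_le (fun _ => ENNReal.toReal_nonneg) fun κ => ?_
  rw [prob_eq, prob_eq]
  refine ENNReal.toReal_mono ((expect_le_one fun a => Set.indicator_le_self _ 1 a).trans_lt
    ENNReal.one_lt_top).ne ?_
  simp only [SPHFwG.crsTrap, SPHFwG.crsTrapFst, PMF.do_bind, PMF.do_pure, expect_bind, expect_pure]
  refine expect_mono fun σ hσ => expect_mono fun r hr => ?_
  by_cases hb : P.compl (σ, r.1) r.2.2.1 ≠ r.2.1.1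
  · refine (Set.indicator_le_self _ _ _).trans (le_of_eq ?_)
    rw [Set.indicator_of_mem]
    · rfl
    · have hc : r.2.2.1 = P.compl (σ, r.1) r.2.1.1 :=
        (hP.out.trapdoorR1.1 κ σ (Or.inl hσ) r hr).2.2
      rw [hc] at hb
      simp only [g, Set.mem_ofPred_eq, hb, decide_false, cond_false]
  · rw [Set.indicator_of_notMem (show _ ∉ {t : P.Crs κ × (Bits (P.nX κ) × Bits (P.nW κ)) ×
      (Bits (P.nX κ) × Bits (P.nW κ)) | P.compl t.1 t.2.2.1 ≠ t.2.1.1} from hb)]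
    exact zero_le

/-- The values sampled by the receiver in the protocol, for both choice bits. -/
def scReal (κ : ℕ) : PMF (P.Crs κ × P.SCR κ × P.SCR κ) :=
  (P.crs00 κ).bind fun s => (P.scGen false s).bind fun p₀ => (P.scGen true s).bind fun p₁ =>
    PMF.pure (s, p₀, p₁)

/-- The values used in the simulation, for both choice bits. -/
def scIdeal (κ : ℕ) : PMF (P.Crs κ × P.SCR κ × P.SCR κ) :=
  (P.crsTrap κ).bind fun t => PMF.pure (t.1, (t.2.1.1, t.2.1), (t.2.1.1, t.2.2))

theorem scReal_fst : CompIndist (fun κ => (scReal P κ).map fun x => (x.1, x.2.1))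
    (fun κ => (scIdeal P κ).map fun x => (x.1, x.2.1)) := by
  have h := ((crsWord_crsFresh P).trans hP.out.trapdoorR1.2.1.symm).bind
    (f := fun κ t => PMF.pure (t.1, t.2.1, t.2)) (EffD.id.fst.mk (EffD.id.snd.fst.mk EffD.id.snd))
  refine ((CompIndist.of_eq fun κ => ?_).trans h).trans (CompIndist.of_eq fun κ => ?_)
  · simp only [scReal, crsWord, PMF.map_bind, PMF.pure_map, PMF.bind_bind, PMF.pure_bind,
      SPHFwG.scGen, PMF.bind_const]
    rfl
  · simp only [scIdeal, SPHFwG.crsTrapFst, SPHFwG.crsTrap, PMF.do_bind, PMF.do_pure, PMF.map_bind,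
      PMF.pure_map, PMF.bind_bind, PMF.pure_bind]

/-- The flow for the choice bit `1` is the complement of the word with the witness, whereas the simulator
sends the first word of the trapdoor; these agree by `negl_compl`. -/
theorem scReal_snd : CompIndist (fun κ => (scReal P κ).map fun x => (x.1, x.2.2))
    (fun κ => (scIdeal P κ).map fun x => (x.1, x.2.2)) := by
  have h := ((crsWord_crsFresh P).trans hP.out.trapdoorR1.2.2.symm).bind
    (f := fun κ t => PMF.pure (t.1, P.compl t.1 t.2.1, t.2))
    (EffD.id.fst.mk (EffD.mk (EffD.compl EffD.id.fst EffD.id.snd.fst) EffD.id.snd))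
  refine ((CompIndist.of_eq fun κ => ?_).trans h).trans ((CompIndist.of_eq fun κ => ?_).trans
    (CompIndist.of_near (p := fun κ => (P.crsTrap κ).bind fun t =>
      PMF.pure (t.1, P.compl t.1 t.2.2.1, t.2.2)) (negl_compl P) fun κ => ?_))
  · simp only [scReal, crsWord, PMF.map_bind, PMF.pure_map, PMF.bind_bind, PMF.pure_bind,
      SPHFwG.scGen, PMF.bind_const]
    rfl
  · simp only [SPHFwG.crsTrapSnd, SPHFwG.crsTrap, PMF.do_bind, PMF.do_pure,
      PMF.bind_bind, PMF.pure_bind]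
  · rw [prob_ofReal]
    simp only [scIdeal, PMF.map_bind, PMF.pure_map]
    rw [← zero_add ((P.crsTrap κ).toOuterMeasure _)]
    refine Near.bind_left fun t _ ht => ?_
    rw [Set.mem_ofPred_eq, not_not] at ht
    rw [ht]
    exact Near.refl _ _ _

end SenderCorrupted

theorem realizes_senderCorrupted (P : SPHFwG) (hP : P.IsSPHFwG) {c : Party → Bool}
    (hr : c .receiver = false) (hs : c .sender = true) :
    UCEmulates (P.protocolOT c) (idealOT P.nV c) := by
  intro n A
  have : Fact P.IsSPHFwG := ⟨hP⟩
  refine ⟨simAdversary c A _ (effSim_sc P c), fun E => ?_⟩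
  refine (choice_indist A E (effCore_sc P) (u₀ := fun κ s => s) EffD.id (scReal_fst P)
    (scReal_snd P)).of_le (fun _ => abs_nonneg _) fun κ => le_of_eq ?_
  rw [exec_simAdversary A E (effSim_sc P c) κ (SPHFwG.simulates_sc hr hs), P.exec_protocolOT]
  congr 3
  · simp only [scReal, PMF.bind_bind, PMF.pure_bind]
    refine congrArg (PMF.bind _) (funext fun s => ?_)
    rw [(SPHFwG.protCore_intertwines_sc hr hs).bit (G := play A E κ) (SPHFwG.ProtState.init s)
      ⟨rfl, rfl, fun _ => rfl⟩]
    simp only [SPHFwG.scState, SPHFwG.ProtState.init, Option.elim_none, PMF.bind_bind,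
      PMF.pure_bind]
    rfl
  · simp only [scIdeal, SPHFwG.simSC, PMF.bind_bind, PMF.pure_bind]
    rfl

/-! ### Both parties honest -/

namespace SPHFwG

variable (P : SPHFwG)

/-- A projection key with a hash value. -/
abbrev KeyVal (κ : ℕ) : Type := Bits (P.nHp κ) × Bits (P.nV κ)

/-- What is sampled in advance in an execution with honest parties: the flow of the receiver, the
projection keys and the hash values of the sender, and the hash value that the receiver computes. -/
abbrev BHR (κ : ℕ) : Type := Bits (P.nX κ) × (P.KeyVal κ × P.KeyVal κ) × Bits (P.nV κ)

/-- The state after the choice: the reference string, the choice bit, the flow of the receiver, the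
projection keys and hash values of the sender; the hash value computed by the receiver (`none` if
it has finished); the input of the sender; and whether the flow of the receiver was delivered. -/
abbrev BHK (κ : ℕ) : Type :=
  (P.Crs κ × Bool × Bits (P.nX κ) × P.KeyVal κ × P.KeyVal κ) × Option (Bits (P.nV κ)) ×
    Option (Bits (P.nV κ) × Bits (P.nV κ)) × Bool

variable {P} {κ : ℕ}

/-- The flow of the sender with keys and hash values `k` and input `m`. -/
def reply (k : P.KeyVal κ × P.KeyVal κ) (m : Bits (P.nV κ) × Bits (P.nV κ)) :
    P.Cipher κ × P.Cipher κ :=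
  ((xorBits k.1.2 m.1, k.1.1), (xorBits k.2.2 m.2, k.2.1))

/-- The keys and hash values from which the flow `c` of a sender with input `m` was computed. -/
def unreply (c : P.Cipher κ × P.Cipher κ) (m : Bits (P.nV κ) × Bits (P.nV κ)) :
    P.KeyVal κ × P.KeyVal κ :=
  ((c.1.2, xorBits c.1.1 m.1), (c.2.2, xorBits c.2.1 m.2))

theorem reply_unreply (c : P.Cipher κ × P.Cipher κ) (m : Bits (P.nV κ) × Bits (P.nV κ)) :
    reply (unreply c m) m = c := by
  simp only [reply, unreply, xorBits_xorBits]

theorem unreply_reply (k : P.KeyVal κ × P.KeyVal κ) (m : Bits (P.nV κ) × Bits (P.nV κ)) :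
    unreply (reply k m) m = k := by
  simp only [reply, unreply, xorBits_xorBits]

/-- The flow of the sender in the state `k`, if it has been sent. -/
def BHK.flow2 (k : P.BHK κ) : Option (P.Cipher κ × P.Cipher κ) :=
  bif k.2.2.2 then k.2.2.1.elim none fun m => some (reply k.1.2.2.2 m) else none

variable (P)

/-- The protocol with honest parties, when all random values are sampled in advance for both choice
bits. -/
def bhSys (κ : ℕ) : ChoiceSys (P.Crs κ × Option (Bits (P.nV κ) × Bits (P.nV κ))) (P.BHR κ) (P.BHK κ)
    (P.ProtView κ) (P.ProtAct κ) (Bits (P.nV κ)) where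
  choose b p u := ((u.1, b, p.1, p.2.1), some p.2.2, u.2, false)
  sndU m u := (u.1, u.2.elim (some m) fun m' => some m')
  viewU u := (u.1, none, none)
  sndK m k := (k.1, k.2.1, k.2.2.1.elim (some m) fun m' => some m', k.2.2.2)
  viewK k := (k.1.1, some k.1.2.2.1, BHK.flow2 k)
  actK q k := q.toSum.elim (fun _ => PMF.pure ((k.1, k.2.1, k.2.2.1, true), none)) fun _ =>
    (BHK.flow2 k).elim (PMF.pure (k, none)) fun d => k.2.1.elim (PMF.pure (k, none)) fun h =>
      PMF.pure ((k.1, none, k.2.2), some (xorBits h (bif k.1.2.1 then d.2.1 else d.1.1)))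

/-- The projection keys and hash values of the words `f` and its complement, with uniform values in
place of the hash values of `f` if `α` holds, and of its complement if `β` holds. -/
def keys (α β : Bool) (s : P.Crs κ) (f : Bits (P.nX κ)) : PMF (P.KeyVal κ × P.KeyVal κ) :=
  (bif α then P.keyAndRandom κ (P.par s) f else P.keyAndHash κ (P.par s) f).bind fun k₀ =>
    (bif β then P.keyAndRandom κ (P.par s) (P.compl s f)
      else P.keyAndHash κ (P.par s) (P.compl s f)).bind fun k₁ => PMF.pure (k₀, k₁)

/-- The hash value that the receiver computes. -/
def bhHash (b : Bool) (s : P.Crs κ) (k : P.KeyVal κ × P.KeyVal κ)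
    (xw : Bits (P.nX κ) × Bits (P.nW κ)) : PMF (Bits (P.nV κ)) :=
  P.projHash κ (P.par s) (bif b then k.2.1 else k.1.1) xw.1 xw.2

/-- The values sampled in advance, for the choice bit `b`. -/
def bhGen (b : Bool) (s : P.Crs κ) : PMF (P.BHR κ) :=
  (P.wordGenL κ (P.par s)).bind fun xw => (P.keys false false s (P.flow s b xw.1)).bind fun k =>
    (P.bhHash b s k xw).bind fun h => PMF.pure (P.flow s b xw.1, k, h)

variable {P}

/-- The keys of the sender in a state of the protocol. -/
def bhKeys (s : P.ProtState κ) (f : Bits (P.nX κ)) : PMF (P.KeyVal κ × P.KeyVal κ) :=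
  s.flow2.elim (P.keys false false s.crs f) fun c =>
    s.messages.elim (P.keys false false s.crs f) fun m => PMF.pure (unreply c m)

/-- The state of the protocol, with values sampled in advance. -/
def bhState (s : P.ProtState κ) :
    PMF (((P.Crs κ × Option (Bits (P.nV κ) × Bits (P.nV κ))) × P.BHR κ × P.BHR κ) ⊕ P.BHK κ) :=
  s.chosen.elim ((P.bhGen false s.crs).bind fun p₀ => (P.bhGen true s.crs).bind fun p₁ =>
    PMF.pure (Sum.inl ((s.crs, s.messages), p₀, p₁))) fun y =>
      (bhKeys s (P.flow s.crs y.1 y.2.1)).bind fun k =>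
        (bif s.finished then PMF.pure none else (P.bhHash y.1 s.crs k y.2).bind fun h =>
          PMF.pure (some h)).bind fun h =>
            PMF.pure (Sum.inr ((s.crs, y.1, P.flow s.crs y.1 y.2.1, k), h, s.messages,
              s.received.isSome))

/-- The invariant of an execution with honest parties. -/
structure BhInv (s : P.ProtState κ) : Prop where
  crs₁ : s.crs.1 ∈ (P.sampS0 κ).support
  crs₂ : s.crs.2 ∈ (P.sampR0 κ s.crs.1).support
  word : ∀ y ∈ s.chosen, y.2 ∈ (P.wordGenL κ (P.par s.crs)).support
  flow1 : s.flow1 = s.chosen.map fun y => P.flow s.crs y.1 y.2.1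
  received : ∀ x ∈ s.received, s.flow1 = some x
  flow2 : s.flow2.isSome = (s.received.isSome && s.messages.isSome)
  finished : s.finished = true → s.flow2.isSome = true

theorem flow_mem (hP : P.IsSPHFwG) {s : P.Crs κ} (h₁ : s.1 ∈ (P.sampS0 κ).support)
    (h₂ : s.2 ∈ (P.sampR0 κ s.1).support) {xw : Bits (P.nX κ) × Bits (P.nW κ)}
    (h : xw ∈ (P.wordGenL κ (P.par s)).support) (b : Bool) :
    P.isWord κ (P.par s) (P.flow s b xw.1) = true := by
  have hX := (hP.wordGen.1 κ s.1 s.2 (Or.inl h₁) (Or.inl h₂) xw h).1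
  cases b
  · exact (Finset.mem_filter.1 hX).2
  · exact (Finset.mem_filter.1 (hP.complement κ s.1 s.2 (Or.inl h₁) h₂ xw.1 hX).1).2

theorem senderReply_bhState {s : P.ProtState κ}
    (h : ∀ x ∈ s.received, ∃ y, s.chosen = some y ∧ x = P.flow s.crs y.1 y.2.1) :
    (P.senderReply κ s).bind bhState = bhState s := by
  obtain ⟨crs, ch, f1, fin, _ | m, _ | x, _ | f2⟩ := s
  case some.some.none =>
    obtain ⟨y, rfl, hx⟩ := h x rfl
    change x = P.flow crs y.1 y.2.1 at hx
    subst hx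
    simp only [senderReply, PMF.do_bind, PMF.do_pure, encrypt_eq, PMF.bind_bind, PMF.pure_bind,
      bhState, bhKeys, Option.elim_some, Option.elim_none, keys, cond_false]
    have : ∀ k₀ k₁ : P.KeyVal κ, unreply (P := P) ((xorBits k₀.2 m.1, k₀.1),
      (xorBits k₁.2 m.2, k₁.1)) m = (k₀, k₁) := fun k₀ k₁ => unreply_reply (k₀, k₁) m
    simp only [this]
    rfl
  all_goals exact PMF.pure_bind _ _

theorem senderReply_inv {s : P.ProtState κ}
    (h : BhInv s ∨ s.flow2 = none ∧ BhInv { s with messages := none } ∨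
      s.flow2 = none ∧ BhInv { s with received := none } ∧
        ∀ x ∈ s.received, s.flow1 = some x) :
    ∀ t ∈ (P.senderReply κ s).support, BhInv t := by
  intro t ht
  obtain ⟨crs, ch, f1, fin, _ | m, _ | x, _ | f2⟩ := s
  case some.some.none =>
    simp only [senderReply, PMF.do_bind, PMF.do_pure, PMF.mem_support_bind_iff,
      PMF.mem_support_pure_iff] at ht
    obtain ⟨c₀, _, c₁, _, rfl⟩ := ht
    rcases h with h | ⟨-, h⟩ | ⟨-, h, h'⟩
    · exact ⟨h.crs₁, h.crs₂, h.word, h.flow1, h.received, rfl, fun _ => rfl⟩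
    · exact ⟨h.crs₁, h.crs₂, h.word, h.flow1, h.received, rfl, fun _ => rfl⟩
    · exact ⟨h.crs₁, h.crs₂, h.word, h.flow1, h', rfl, fun _ => rfl⟩
  all_goals
    simp only [senderReply, PMF.mem_support_pure_iff] at ht
    subst ht
    rcases h with h | ⟨h₂, h⟩ | ⟨h₂, h, h'⟩
    · exact h
    · first
        | (cases h₂; done)
        | exact ⟨h.crs₁, h.crs₂, h.word, h.flow1, h.received, rfl, h.finished⟩
    · first
        | (cases h₂; done)
        | exact ⟨h.crs₁, h.crs₂, h.word, h.flow1, h', rfl, h.finished⟩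

/-- Sampling the values of both parties in advance, for both choice bits, has no effect. -/
theorem protCore_intertwines_bh (hP : P.IsSPHFwG) {c : Party → Bool} (hr : c .receiver = false)
    (hs : c .sender = false) :
    Intertwines (P.protCore c κ) (P.bhSys κ).core bhState BhInv := by
  have hflow : ∀ (s : P.Crs κ) (b : Bool) (x : Bits (P.nX κ)),
      (if b = true then P.complement κ (P.par s) s.2 x else x) = P.flow s b x := by
    intro s b x; cases b <;> rfl
  have hword : ∀ {s : P.ProtState κ}, BhInv s → ∀ x ∈ s.received,
      ∃ y, s.chosen = some y ∧ x = P.flow s.crs y.1 y.2.1 := by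
    intro s hI x hx
    have h1 := hI.received x hx
    rw [hI.flow1] at h1
    obtain ⟨y, hy, rfl⟩ := Option.map_eq_some_iff.1 h1
    exact ⟨y, hy, rfl⟩
  refine ⟨fun s b hI => ?_, fun s m hI => ?_, fun s hI s' hs' => ?_, fun s q hI => ?_,
    fun s b hI t ht => ?_, fun s m hI t ht => ?_, fun s q hI u hu => ?_⟩
  · obtain ⟨crs, _ | ⟨b', xw⟩, f1, fin, ms, rc, f2⟩ := s
    · have hrc : rc = none := by
        rcases rc with _ | x
        · rfl
        · obtain ⟨y, hy, _⟩ := hword hI x rfl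
          cases hy
      subst hrc
      have hf2 : f2 = none := by simpa using hI.flow2
      subst hf2
      obtain rfl : fin = false := by
        cases fin
        · rfl
        · exact (Bool.false_ne_true (hI.finished rfl)).elim
      simp only [protCore, hr, Bool.false_eq_true, if_false, receiverStart, PMF.do_bind,
        PMF.do_pure, PMF.bind_bind, PMF.pure_bind, bhState, Option.elim_none, Option.elim_some,
        ChoiceSys.core, Sum.elim_inl, bhKeys, cond_false]
      cases b
      · simp only [PMF.bind_const, bhGen, PMF.bind_bind, PMF.pure_bind, cond_false]
        rfl
      · simp only [PMF.bind_const, bhGen, PMF.bind_bind, PMF.pure_bind, cond_true]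
        rfl
    · simp only [protCore, hr, Bool.false_eq_true, if_false, receiverStart, PMF.pure_bind, bhState,
        Option.elim_some, PMF.bind_bind]
      rfl
  · simp only [protCore, hs, Bool.false_eq_true, if_false]
    obtain ⟨crs, ch, f1, fin, _ | m', rc, f2⟩ := s
    · have hf2 : f2 = none := by simpa using hI.flow2
      subst hf2
      simp only [senderStart]
      have hw := hword hI
      rw [senderReply_bhState (s := ⟨crs, ch, f1, fin, some m, rc, none⟩) hw]
      rcases ch with _ | y
      · simp only [bhState, Option.elim_none, PMF.bind_bind, PMF.pure_bind]
        rfl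
      · simp only [bhState, Option.elim_some, PMF.bind_bind, PMF.pure_bind, bhKeys,
          Option.elim_none]
        rfl
    · simp only [senderStart, PMF.pure_bind]
      rcases ch with _ | y
      · simp only [bhState, Option.elim_none, PMF.bind_bind, PMF.pure_bind]
        rfl
      · simp only [bhState, Option.elim_some, PMF.bind_bind, PMF.pure_bind]
        rfl
  · obtain ⟨crs, ch, f1, fin, ms, rc, f2⟩ := s
    have h1 := hI.flow1
    have h2 := hI.flow2
    rcases ch with _ | y
    · have hrc : rc = none := by
        rcases rc with _ | x
        · rfl
        · obtain ⟨y, hy, _⟩ := hword hI x rfl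
          cases hy
      subst hrc
      have hf2 : f2 = none := by simpa using h2
      simp only [bhState, Option.elim_none, PMF.mem_support_bind_iff,
        PMF.mem_support_pure_iff] at hs'
      obtain ⟨_, _, _, _, rfl⟩ := hs'
      simp only [Option.map_none] at h1
      subst h1 hf2; rfl
    · simp only [bhState, Option.elim_some, PMF.mem_support_bind_iff,
        PMF.mem_support_pure_iff] at hs'
      obtain ⟨k, hk, h, _, rfl⟩ := hs'
      simp only [Option.map_some] at h1
      subst h1
      simp only [ChoiceSys.core, Sum.elim_inr, bhSys, protCore, BHK.flow2]
      rcases f2 with _ | f2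
      · rcases rc with _ | x <;> rcases ms with _ | m <;> first | rfl | simp at h2
      · rcases rc with _ | x <;> rcases ms with _ | m <;> simp at h2
        simp only [bhKeys, Option.elim_some, PMF.mem_support_pure_iff] at hk
        subst hk
        simp [reply_unreply]
  · obtain ⟨crs, ch, f1, fin, ms, rc, f2⟩ := s
    have h1 := hI.flow1
    have h2 := hI.flow2
    rcases q with y | d
    · rcases ch with _ | ⟨b', xw⟩
      · simp only [Option.map_none] at h1
        subst h1
        simp only [protCore, hr, hs, Bool.false_eq_true, if_false, PMF.pure_bind, bhState,
          Option.elim_none, PMF.bind_bind]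
        rfl
      · simp only [Option.map_some] at h1
        subst h1
        rcases rc with _ | x
        · have hf2 : f2 = none := by simpa using h2
          subst hf2
          have hw := flow_mem hP hI.crs₁ hI.crs₂ (hI.word _ rfl) b'
          simp only [protCore, hr, hs, Bool.false_eq_true, if_false, senderReceive,
            ProtState.par]
          rw [show P.isWord κ (P.setup κ crs.1 crs.2) (P.flow crs b' xw.1) = true from hw]
          have key := senderReply_bhState (P := P) (s := ⟨crs, some (b', xw),
            some (P.flow crs b' xw.1), fin, ms, some (P.flow crs b' xw.1), none⟩)
            fun x hx => ⟨_, rfl, (Option.some_injective _ hx).symm⟩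
          have key2 := congrArg (fun p => p.bind fun s' => PMF.pure (s', (none : Option
            (Bits (P.nV κ))))) key
          simp only [PMF.bind_bind] at key2
          simp only [PMF.bind_map, Function.comp_def]
          refine key2.trans ?_
          simp only [bhState, Option.elim_some, PMF.bind_bind, PMF.pure_bind, bhKeys,
            Option.elim_none, ChoiceSys.core, Sum.elim_inr, bhSys, ProtAct.toSum, Sum.elim_inl]
          rfl
        · simp only [protCore, hr, hs, Bool.false_eq_true, if_false, senderReceive, PMF.pure_map,
            PMF.pure_bind, bhState, Option.elim_some, PMF.bind_bind, ChoiceSys.core, Sum.elim_inr,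
            bhSys, ProtAct.toSum, Sum.elim_inl]
          rfl
    · rcases ch with _ | ⟨b', xw⟩
      · have hrc : rc = none := by
          rcases rc with _ | x
          · rfl
          · obtain ⟨y, hy, _⟩ := hword hI x rfl
            cases hy
        subst hrc
        have hf2 : f2 = none := by simpa using h2
        subst hf2
        simp only [protCore, hr, hs, Bool.false_eq_true, if_false, PMF.pure_bind, bhState,
          Option.elim_none, PMF.bind_bind]
        rfl
      · rcases f2 with _ | f2
        · have h3 : ∀ k h, BHK.flow2 (((crs, b', P.flow crs b' xw.1, k), h, ms, rc.isSome) :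
              P.BHK κ) = none := by
            intro k h
            rcases rc with _ | x <;> rcases ms with _ | m <;> first | rfl | simp at h2
          simp only [protCore, hr, hs, Bool.false_eq_true, if_false, PMF.pure_bind, bhState,
            Option.elim_some, PMF.bind_bind, ChoiceSys.core, Sum.elim_inr, bhSys, ProtAct.toSum, h3,
            Option.elim_none]
        · rcases rc with _ | x <;> rcases ms with _ | m <;> simp at h2
          have h3 : ∀ k h, BHK.flow2 (((crs, b', P.flow crs b' xw.1, k), h, some m, true) :
              P.BHK κ) = some (reply k m) := fun _ _ => rfl
          cases fin
          · simp only [protCore, hr, hs, Bool.false_eq_true, if_false, receiverFinish, decrypt,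
              PMF.pure_bind, bhState, Option.elim_some, PMF.bind_bind, PMF.do_bind, PMF.do_pure,
              ChoiceSys.core, Sum.elim_inr, bhSys, ProtAct.toSum, cond_false, cond_true, bhKeys,
              Option.isSome_some, h3, reply_unreply]
            cases b' <;> rfl
          · simp only [protCore, hr, hs, Bool.false_eq_true, if_false, receiverFinish,
              PMF.pure_bind, bhState, Option.elim_some,
              ChoiceSys.core, Sum.elim_inr, bhSys, ProtAct.toSum, cond_true, bhKeys,
              Option.isSome_some, h3, Option.elim_none]
  · obtain ⟨crs, _ | ⟨b', xw⟩, f1, fin, ms, rc, f2⟩ := s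
    · simp only [protCore, hr, Bool.false_eq_true, if_false, receiverStart, PMF.do_bind,
        PMF.do_pure, PMF.mem_support_bind_iff, PMF.mem_support_pure_iff] at ht
      obtain ⟨xw, hxw, rfl⟩ := ht
      refine ⟨hI.crs₁, hI.crs₂, fun y hy => ?_, congrArg some (hflow _ _ _), fun x hx => ?_,
        hI.flow2, hI.finished⟩
      · obtain rfl := Option.some_injective _ hy
        exact hxw
      · obtain ⟨y, hy, _⟩ := hword hI x hx
        cases hy
    · simp only [protCore, hr, Bool.false_eq_true, if_false, receiverStart,
        PMF.mem_support_pure_iff] at ht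
      exact ht ▸ hI
  · simp only [protCore, hs, Bool.false_eq_true, if_false] at ht
    obtain ⟨crs, ch, f1, fin, _ | m', rc, f2⟩ := s
    · exact senderReply_inv (Or.inr (Or.inl ⟨by simpa using hI.flow2, hI⟩)) t ht
    · simp only [senderStart, PMF.mem_support_pure_iff] at ht
      exact ht ▸ hI
  · obtain ⟨crs, ch, f1, fin, ms, rc, f2⟩ := s
    rcases q with y | d
    · rcases f1 with _ | f
      · simp only [protCore, hr, hs, Bool.false_eq_true, if_false, PMF.mem_support_pure_iff] at hu
        subst hu; exact hI
      · simp only [protCore, hr, hs, Bool.false_eq_true, if_false, PMF.mem_support_map_iff] at hu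
        obtain ⟨t, ht, rfl⟩ := hu
        rcases rc with _ | x
        · unfold senderReceive at ht
          split at ht
          · refine senderReply_inv (Or.inr (Or.inr ⟨by simpa using hI.flow2, hI, fun x hx => ?_⟩))
              t ht
            exact hx
          · rw [PMF.mem_support_pure_iff] at ht
            subst ht; exact hI
        · simp only [senderReceive, PMF.mem_support_pure_iff] at ht
          subst ht; exact hI
    · rcases f2 with _ | f2
      · simp only [protCore, hr, hs, Bool.false_eq_true, if_false, PMF.mem_support_pure_iff] at hu
        subst hu; exact hI
      · simp only [protCore, hr, hs, Bool.false_eq_true, if_false] at hu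
        unfold receiverFinish at hu
        split at hu
        · simp only [PMF.do_bind, PMF.do_pure, PMF.mem_support_bind_iff,
            PMF.mem_support_pure_iff] at hu
          obtain ⟨m, _, rfl⟩ := hu
          exact ⟨hI.crs₁, hI.crs₂, hI.word, hI.flow1, hI.received, hI.flow2, fun _ => rfl⟩
        · rw [PMF.mem_support_pure_iff] at hu
          subst hu; exact hI

end SPHFwG

namespace SPHFwG

variable (P : SPHFwG)

/-- The internal state of the simulator for honest parties: the reference string, the flow of the
receiver, whether it was delivered, and the flow of the sender. -/
abbrev BHT (κ : ℕ) : Type :=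
  P.Crs κ × Bits (P.nX κ) × Bool × Option (P.Cipher κ × P.Cipher κ)

/-- The simulator for honest parties: the flow of the receiver is a random word of `ℒ`, and the
flow of the sender contains uniform values. -/
def simBH (κ : ℕ) : Sim (P.BHT κ) (P.ProtView κ) (P.ProtAct κ) (P.nV κ) where
  init := (P.crs00 κ).bind fun s => (P.wordGenL κ (P.par s)).bind fun xw =>
    PMF.pure (s, xw.1, false, none)
  pre := .receiver false
  upd t v := bif t.2.2.1 then bif v.2.1 then t.2.2.2.elim
      ((P.junk κ (P.par t.1) t.2.1).bind fun c₀ =>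
        (P.junk κ (P.par t.1) (P.compl t.1 t.2.1)).bind fun c₁ =>
          PMF.pure (t.1, t.2.1, true, some (c₀, c₁))) fun _ => PMF.pure t
    else PMF.pure t else PMF.pure t
  view t v := (t.1, bif v.1 then some t.2.1 else none, t.2.2.2)
  act q t v := q.toSum.elim (fun _ => bif v.1 then
      PMF.pure ((t.1, t.2.1, true, t.2.2.2), .receiver false)
    else PMF.pure (t, .receiver false)) fun _ =>
      t.2.2.2.elim (PMF.pure (t, .receiver false)) fun _ => PMF.pure (t, .answer)

variable {P} {κ : ℕ}

/-- The keys of the sender in the simulation. -/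
def simKeys (t : P.BHT κ) (i : OTState (P.nV κ)) : PMF (P.KeyVal κ × P.KeyVal κ) :=
  t.2.2.2.elim (P.keys true true t.1 t.2.1) fun c =>
    i.messages.elim (P.keys true true t.1 t.2.1) fun m => PMF.pure (unreply c m)

/-- The state of the system with presampled values that corresponds to a state of the simulation.
The hash value that the receiver computes is that of the sender. -/
def simState (t : P.BHT κ) (i : OTState (P.nV κ)) :
    PMF (((P.Crs κ × Option (Bits (P.nV κ) × Bits (P.nV κ))) × P.BHR κ × P.BHR κ) ⊕ P.BHK κ) :=
  (simKeys t i).bind fun k => PMF.pure (i.choice.elim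
    (Sum.inl ((t.1, i.messages), (t.2.1, k, k.1.2), (t.2.1, k, k.2.2)))
    fun b => Sum.inr ((t.1, b, t.2.1, k), bif i.halted then none else some (bif b then k.2.2
      else k.1.2), i.messages, t.2.2.1))

/-- The invariant of the simulation for honest parties. -/
structure SimBhInv (t : P.BHT κ) (i : OTState (P.nV κ)) : Prop where
  received : t.2.2.1 = true → i.choice.isSome = true
  flow2 : t.2.2.2.isSome = true → t.2.2.1 = true ∧ i.messages.isSome = true
  halted : i.halted = true → t.2.2.2.isSome = true

/-- Moreover the flow of the sender is there if it is due. -/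
structure SimBhInv₂ (t : P.BHT κ) (i : OTState (P.nV κ)) : Prop extends SimBhInv t i where
  replied : t.2.2.1 = true → i.messages.isSome = true → t.2.2.2.isSome = true

/-- Flows of the sender that contain uniform values can be sampled without its input. -/
theorem junk_unreply (s : P.Crs κ) (f : Bits (P.nX κ)) (m : Bits (P.nV κ) × Bits (P.nV κ))
    {B : Type} (g : P.KeyVal κ × P.KeyVal κ → PMF B) :
    ((P.junk κ (P.par s) f).bind fun c₀ => (P.junk κ (P.par s) (P.compl s f)).bind fun c₁ =>
      g (unreply (c₀, c₁) m)) = (P.keys true true s f).bind g := by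
  simp only [junk, keys, cond_true, PMF.bind_bind, PMF.pure_bind, unreply]
  have h := fun (x : Bits (P.nX κ)) (m : Bits (P.nV κ)) (g : P.KeyVal κ → PMF B) =>
    congrArg (fun p : PMF (P.KeyVal κ) => p.bind g) (P.keyAndRandom_xor κ (P.par s) x m)
  simp only [PMF.bind_bind, PMF.pure_bind] at h
  refine Eq.trans ?_ (h f m.1 _)
  refine congrArg (PMF.bind _) (funext fun k₀ => ?_)
  exact h (P.compl s f) m.2 fun k₁ => g ((k₀.1, xorBits k₀.2 m.1), k₁)

theorem flow2_eq {t : P.BHT κ} {i : OTState (P.nV κ)} (hi : SimBhInv₂ t i)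
    {k : P.KeyVal κ × P.KeyVal κ} (hk : k ∈ (simKeys t i).support) (b : Bool)
    (h : Option (Bits (P.nV κ))) :
    BHK.flow2 (((t.1, b, t.2.1, k), h, i.messages, t.2.2.1) : P.BHK κ) = t.2.2.2 := by
  have h1 := hi.flow2
  have h2 := hi.replied
  obtain ⟨s, f, rc, _ | c⟩ := t
  · obtain ⟨ch, _ | m, ha, l⟩ := i <;> cases rc <;> first | rfl | simp at h2
  · obtain ⟨ch, _ | m, ha, l⟩ := i <;> cases rc <;> simp at h1
    simp only [simKeys, Option.elim_some, PMF.mem_support_pure_iff] at hk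
    subst hk
    simp [BHK.flow2, reply_unreply]

theorem simulates_bh {c : Party → Bool} (hr : c .receiver = false) (hs : c .sender = false) :
    Simulates (P.simBH κ) c (P.bhSys κ).core simState SimBhInv SimBhInv SimBhInv₂ where
  init t ht := by
    simp only [simBH, PMF.mem_support_bind_iff, PMF.mem_support_pure_iff] at ht
    obtain ⟨_, _, _, _, rfl⟩ := ht
    exact ⟨fun h => (Bool.false_ne_true h).elim, fun h => (Bool.false_ne_true h).elim,
      fun h => (Bool.false_ne_true h).elim⟩
  rcv t i b hi := by
    simp only [OTState.rcv, hr, Bool.false_eq_true, if_false]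
    obtain ⟨s, f, rc, f2⟩ := t
    obtain ⟨_ | b', ms, ha, l⟩ := i
    · obtain rfl : rc = false := by
        cases rc
        · rfl
        · exact (Bool.false_ne_true (hi.received rfl)).elim
      obtain rfl : f2 = none := by
        cases f2
        · rfl
        · exact (Bool.false_ne_true (hi.flow2 rfl).1).elim
      obtain rfl : ha = false := by
        cases ha
        · rfl
        · exact (Bool.false_ne_true (hi.halted rfl)).elim
      refine ⟨?_, ⟨fun _ => rfl, hi.flow2, hi.halted⟩⟩
      simp only [simState, OTState.setChoice, PMF.bind_bind, PMF.pure_bind]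
      cases b <;> rfl
    · refine ⟨?_, hi⟩
      simp only [simState, OTState.setChoice, PMF.bind_bind, PMF.pure_bind]
      rfl
  snd t i m hi := by
    simp only [OTState.snd, hs, Bool.false_eq_true, if_false]
    obtain ⟨s, f, rc, f2⟩ := t
    obtain ⟨ch, _ | m', ha, l⟩ := i
    · obtain rfl : f2 = none := by
        cases f2
        · rfl
        · exact (Bool.false_ne_true (hi.flow2 rfl).2).elim
      refine ⟨?_, ⟨hi.received, fun h => (Bool.false_ne_true h).elim, hi.halted⟩⟩
      simp only [simState, OTState.setMessages, PMF.bind_bind, PMF.pure_bind]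
      cases ch <;> rfl
    · refine ⟨?_, hi⟩
      simp only [simState, OTState.setMessages, PMF.bind_bind, PMF.pure_bind]
      cases ch <;> rfl
  pre t i hi := by
    have h0 : i.act c (P.simBH κ).pre = (i, none) := by
      simp only [simBH, OTState.act, hr, Bool.false_eq_true, if_false]
    rw [h0]
    exact ⟨rfl, rfl, hi⟩
  weaken₁ _ _ h := h
  weaken₂ _ _ h := h.toSimBhInv
  upd t i hi := by
    have hp : ∀ h6 : t.2.2.1 = true → i.messages.isSome = true → t.2.2.2.isSome = true,
        (((PMF.pure t).bind fun t' => simState t' i) = simState t i) ∧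
        ∀ t' ∈ (PMF.pure t).support, SimBhInv₂ t' i := fun h6 => by
      refine ⟨PMF.pure_bind _ _, fun t' ht' => ?_⟩
      rw [PMF.mem_support_pure_iff] at ht'
      exact ht' ▸ ⟨hi, h6⟩
    obtain ⟨s, f, rc, _ | f2⟩ := t
    · cases rc
      · exact hp fun h => (Bool.false_ne_true h).elim
      · obtain ⟨ch, _ | m, ha, l⟩ := i
        · exact hp fun _ h => (Bool.false_ne_true h).elim
        · simp only [simBH, OTState.view, Option.isSome_some, cond_true, Option.elim_none,
            PMF.bind_bind, PMF.pure_bind]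
          constructor
          · simp only [simState, simKeys, Option.elim_some, PMF.pure_bind, Option.elim_none]
            rw [← junk_unreply s f m]
          · intro t' ht'
            simp only [PMF.mem_support_bind_iff, PMF.mem_support_pure_iff] at ht'
            obtain ⟨_, _, _, _, rfl⟩ := ht'
            exact ⟨⟨hi.received, fun _ => ⟨rfl, rfl⟩, fun _ => rfl⟩, fun _ _ => rfl⟩
    · have := hp fun _ _ => rfl
      simp only [simBH, Option.elim_some]
      cases rc
      · exact this
      · cases i.view.2.1 <;> exact this
  view t i hi s hs' := by
    simp only [simState, PMF.mem_support_bind_iff, PMF.mem_support_pure_iff] at hs'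
    obtain ⟨k, hk, rfl⟩ := hs'
    have h2 := flow2_eq hi hk
    obtain ⟨s, f, rc, f2⟩ := t
    obtain ⟨_ | b, ms, ha, l⟩ := i
    · obtain rfl : f2 = none := by
        cases f2
        · rfl
        · exact (Bool.false_ne_true (hi.received (hi.flow2 rfl).1)).elim
      rfl
    · simp only [Option.elim_some, ChoiceSys.core, Sum.elim_inr, bhSys]
      rw [h2]
      rfl
  act t i q hi := by
    have h0 : i.act c (.receiver false) = (i, none) := by
      simp only [OTState.act, hr, Bool.false_eq_true, if_false]
    have hd : ∀ a : OTAct (P.nV κ), i.act c a = (i, none) →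
        i.act₂ c a (.receiver false) = (i, none) := by
      intro a ha
      simp only [OTState.act₂, ha, Option.elim_none, h0]
    have hd0 := hd _ h0
    have hpre : (P.simBH κ).pre = .receiver false := rfl
    -- an action without effect on the functionality
    have hp : ∀ (q : P.ProtAct κ) (t' : P.BHT κ) (a : OTAct (P.nV κ)), SimBhInv t' i →
        i.act₂ c a (.receiver false) = (i, none) →
        ((simState t' i).bind fun s => PMF.pure (s, none)) =
          (simState t i).bind ((P.bhSys κ).core.act q) →
        (((PMF.pure (t', a)).bind fun w =>
          (simState w.1 (i.act₂ c w.2 (P.simBH κ).pre).1).bind fun s =>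
            PMF.pure (s, (i.act₂ c w.2 (P.simBH κ).pre).2)) =
          (simState t i).bind ((P.bhSys κ).core.act q)) ∧
        ∀ w ∈ (PMF.pure (t', a)).support, SimBhInv w.1 (i.act₂ c w.2 (P.simBH κ).pre).1 := by
      intro q t' a ht' ha he
      constructor
      · rw [PMF.pure_bind, hpre, ha]
        exact he
      · intro w hw
        rw [PMF.mem_support_pure_iff] at hw
        subst hw
        rw [hpre, ha]
        exact ht'
    rcases q with y | d
    · cases hch : i.choice with
      | none =>
        have := hp (.deliver1 y) t (.receiver false) hi.toSimBhInv hd0 (by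
          simp only [simState, hch, Option.elim_none, PMF.bind_bind, PMF.pure_bind]
          rfl)
        simpa only [simBH, ProtAct.toSum, Sum.elim_inl, OTState.view, hch, Option.isSome_none,
          cond_false] using this
      | some b =>
        have := hp (.deliver1 y) (t.1, t.2.1, true, t.2.2.2) (.receiver false)
          ⟨fun _ => by rw [hch]; rfl, fun h => ⟨rfl, (hi.flow2 h).2⟩, hi.halted⟩ hd0 (by
            simp only [simState, simKeys, hch, Option.elim_some, PMF.bind_bind, PMF.pure_bind,
              ChoiceSys.core, Sum.elim_inr, bhSys, ProtAct.toSum, Sum.elim_inl])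
        simpa only [simBH, ProtAct.toSum, Sum.elim_inl, OTState.view, hch, Option.isSome_some,
          cond_true] using this
    · cases hf2 : t.2.2.2 with
      | none =>
        have := hp (.deliver2 d) t (.receiver false) hi.toSimBhInv hd0 (by
          simp only [simState, PMF.bind_bind, PMF.pure_bind]
          refine PMF.bind_congr fun k hk => ?_
          have h2 := flow2_eq hi hk
          cases hch : i.choice with
          | none => rfl
          | some b =>
            simp only [Option.elim_some, ChoiceSys.core, Sum.elim_inr, bhSys, ProtAct.toSum, h2,
              hf2, Option.elim_none, PMF.pure_bind])
        simpa only [simBH, ProtAct.toSum, Sum.elim_inr, hf2, Option.elim_none] using this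
      | some f2 =>
        have hI := hi.toSimBhInv
        have hm := (hi.flow2 (by rw [hf2]; rfl)).2
        have hc := hi.received (hi.flow2 (by rw [hf2]; rfl)).1
        obtain ⟨s, f, rc, f2'⟩ := t
        change f2' = some f2 at hf2
        subst hf2
        obtain ⟨_ | b, _ | m, ha, l⟩ := i
        · cases hc
        · cases hc
        · cases hm
        have hfl := fun k hk => flow2_eq (k := k) hi hk b
        simp only [simKeys, Option.elim_some, PMF.mem_support_pure_iff] at hfl
        have hfl := hfl _ rfl
        cases ha
        · have hact : OTState.act₂ c .answer (.receiver false)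
              (⟨some b, some m, false, l⟩ : OTState (P.nV κ)) =
              (⟨some b, some m, true, l⟩, some (bif b then m.2 else m.1)) := by
            simp only [OTState.act₂, OTState.act, OTState.answer, hr, Bool.false_eq_true, if_false,
              Option.elim_some]
            cases b <;> rfl
          simp only [simBH, ProtAct.toSum, Sum.elim_inr, Option.elim_some]
          constructor
          · simp only [PMF.pure_bind, hact, simState, simKeys, Option.elim_some, ChoiceSys.core,
              Sum.elim_inr, bhSys, ProtAct.toSum, hfl, cond_true, cond_false]
            cases b
            · simp only [cond_false, unreply, xorBits_xorBits_left]
            · simp only [cond_true, unreply, xorBits_xorBits_left]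
          · intro w hw
            rw [PMF.mem_support_pure_iff] at hw
            subst hw
            rw [hact]
            exact ⟨hI.received, hI.flow2, fun _ => rfl⟩
        · exact hp (.deliver2 d) _ .answer hI (hd _ rfl) (by
            simp only [simState, simKeys, Option.elim_some, PMF.pure_bind, ChoiceSys.core,
              Sum.elim_inr, bhSys, ProtAct.toSum, hfl, cond_true, Option.elim_none])

end SPHFwG

section EffBH

variable (P : SPHFwG) [hP : Fact P.IsSPHFwG]

theorem effCore_bh : EffCore fun κ => (P.bhSys κ).core := by
  have hfl : EffD fun κ (k : P.BHK κ) => SPHFwG.BHK.flow2 k :=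
    EffD.cond EffD.id.snd.snd.snd (EffD.optionElim EffD.id.snd.snd.fst (EffD.const fun _ => none)
      (EffD.some (EffD.mk (EffD.mk (EffD.xor EffD.id.fst.fst.snd.snd.snd.fst.snd EffD.id.snd.fst)
        EffD.id.fst.fst.snd.snd.snd.fst.fst) (EffD.mk (EffD.xor EffD.id.fst.fst.snd.snd.snd.snd.snd
        EffD.id.snd.snd) EffD.id.fst.fst.snd.snd.snd.snd.fst)))) (EffD.const fun _ => none)
  refine ChoiceSys.effCore (fun b => ?_) ?_ ?_ ?_ ?_ ?_
  · exact EffD.mk (EffD.id.snd.fst.mk ((EffD.const fun _ => b).mk (EffD.id.fst.fst.mk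
      EffD.id.fst.snd.fst))) (EffD.id.fst.snd.snd.some.mk (EffD.id.snd.snd.mk
        (EffD.const fun _ => false)))
  · exact EffD.id.snd.fst.mk (EffD.optionElim EffD.id.snd.snd EffD.id.fst.some EffD.id.snd.some)
  · exact EffD.id.fst.mk (EffD.const fun κ => ((none, none) : Option (Bits (P.nX κ)) ×
      Option (P.Cipher κ × P.Cipher κ)))
  · exact EffD.id.snd.fst.mk (EffD.id.snd.snd.fst.mk (EffD.mk (EffD.optionElim
      EffD.id.snd.snd.snd.fst EffD.id.fst.some EffD.id.snd.some) EffD.id.snd.snd.snd.snd))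
  · exact EffD.id.fst.fst.mk (EffD.id.fst.snd.snd.fst.some.mk hfl)
  · refine Eff.sumElim (EffD.toSum EffD.id.fst) ?_ (Eff.optionElim (hfl.comp EffD.id.fst.snd)
      (EffD.id.fst.snd.mk (EffD.const fun _ => none)) (Eff.optionElim EffD.id.fst.fst.snd.snd.fst
        (EffD.id.fst.fst.snd.mk (EffD.const fun _ => none)) ?_))
    · exact EffD.mk (EffD.id.fst.snd.fst.mk (EffD.id.fst.snd.snd.fst.mk
        (EffD.id.fst.snd.snd.snd.fst.mk (EffD.const fun _ => true)))) (EffD.const fun _ => none)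
    · exact EffD.mk (EffD.id.fst.fst.fst.snd.fst.mk (EffD.mk (EffD.const fun _ => none)
        EffD.id.fst.fst.fst.snd.snd.snd)) (EffD.some (EffD.xor EffD.id.snd (EffD.cond
          EffD.id.fst.fst.fst.snd.fst.snd.fst EffD.id.fst.snd.snd.fst EffD.id.fst.snd.fst.fst)))

theorem effSim_bh (c : Party → Bool) : EffSim (W := P.protocolOT c) P.simBH where
  init := Eff.bind eff_crs00 (Eff.bind (Eff.wordGenL (EffD.par EffD.id.snd))
    (EffD.id.fst.snd.mk (EffD.id.snd.fst.mk (EffD.const fun κ =>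
      ((false, none) : Bool × Option (P.Cipher κ × P.Cipher κ))))))
  upd := by
    refine Eff.cond EffD.id.fst.snd.snd.fst (Eff.cond EffD.id.snd.snd.fst (Eff.optionElim
      EffD.id.fst.snd.snd.snd (Eff.bind (Eff.junk (EffD.par EffD.id.fst.fst) EffD.id.fst.snd.fst)
        (Eff.bind (Eff.junk (EffD.par EffD.id.fst.fst.fst) (EffD.compl EffD.id.fst.fst.fst
          EffD.id.fst.fst.snd.fst)) ?_)) EffD.id.fst.fst) EffD.id.fst) EffD.id.fst
    exact EffD.id.fst.fst.fst.fst.mk (EffD.id.fst.fst.fst.snd.fst.mk ((EffD.const fun _ => true).mk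
      (EffD.some (EffD.id.fst.snd.mk EffD.id.snd))))
  view := EffD.id.fst.fst.mk ((EffD.cond EffD.id.snd.fst EffD.id.fst.snd.fst.some
    (EffD.const fun _ => none)).mk EffD.id.fst.snd.snd.snd)
  act := by
    have ha : ∀ (a : ∀ κ, OTAct (P.nV κ)) {D : ℕ → Type} [∀ κ, BitCode (D κ)]
        {t : ∀ κ, D κ → P.BHT κ}, EffD t → EffD fun κ d => (t κ d, a κ) := fun a _ _ _ ht =>
      ht.mk (EffD.const a)
    exact Eff.sumElim (EffD.toSum EffD.id.fst) (Eff.cond EffD.id.fst.snd.snd.fst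
      (ha (fun _ => .receiver false) (EffD.id.fst.snd.fst.fst.mk (EffD.id.fst.snd.fst.snd.fst.mk
        ((EffD.const fun _ => true).mk EffD.id.fst.snd.fst.snd.snd.snd))))
      (ha (fun _ => .receiver false) EffD.id.fst.snd.fst)) (Eff.optionElim
        EffD.id.fst.snd.fst.snd.snd.snd (ha (fun _ => .receiver false) EffD.id.fst.snd.fst)
        (ha (fun _ => .answer) EffD.id.fst.fst.snd.fst))

end EffBH

/-! ### The presampled values of honest parties -/

namespace SPHFwG

variable {P : SPHFwG} {κ : ℕ}

/-- For a word of `ℒ`, the hash value that the receiver computes can be replaced by that of the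
sender. -/
theorem near_projHash {ε : ℝ} {par : Bits (P.nPar κ)} {x : Bits (P.nX κ)} {w : Bits (P.nW κ)}
    (h : prob (P.bothHashes κ par x w) {H | H.1 ≠ H.2} ≤ ε) :
    Near ∅ ((P.keyAndHash κ par x).bind fun k => (P.projHash κ par k.1 x w).bind fun h =>
      PMF.pure (k, h)) ((P.keyAndHash κ par x).bind fun k => PMF.pure (k, k.2))
      (ENNReal.ofReal ε) := by
  let B : PMF (P.KeyVal κ × Bits (P.nV κ)) := (P.keyAndHash κ par x).bind fun k =>
    (P.projHash κ par k.1 x w).bind fun h => PMF.pure (k, h)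
  have h2 : ((P.keyAndHash κ par x).bind fun k => PMF.pure (k, k.2)) =
      B.bind fun y => PMF.pure (y.1, y.1.2) := by
    simp only [B, PMF.bind_bind, PMF.pure_bind, PMF.bind_const]
  have h3 : P.bothHashes κ par x w = B.bind fun y => PMF.pure (y.1.2, y.2) := by
    simp only [B, bothHashes, keyAndHash, PMF.do_bind, PMF.do_pure, PMF.bind_bind, PMF.pure_bind]
  have h4 : B.toOuterMeasure {y | y.1.2 ≠ y.2} ≤ ENNReal.ofReal ε := by
    refine le_trans (le_of_eq ?_) (ENNReal.ofReal_le_ofReal h)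
    rw [h3, prob_ofReal, ← expect_indicator, ← expect_indicator, expect_bind B]
    refine expect_congr fun y _ => ?_
    rw [expect_pure]
    rfl
  rw [h2]
  exact (near_bind_fst B _).mono h4

/-- The projection keys with the values that an honest receiver and an honest sender compute, for
the choice bit `b`. -/
theorem near_bhGen (hP : P.IsSPHFwG) {ε : ℝ} (hε : ∀ σ ρ, P.InS κ σ → P.InR κ σ ρ →
    ∀ x w, x ∈ P.X κ (P.setup κ σ ρ) → P.Rel κ (P.setup κ σ ρ) x w →
      prob (P.bothHashes κ (P.setup κ σ ρ) x w) {H | H.1 ≠ H.2} ≤ ε) (b : Bool) {s : P.Crs κ}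
    (hs : s ∈ (P.crs00 κ).support) :
    Near ∅ (P.bhGen b s) ((P.wordGenL κ (P.par s)).bind fun xw =>
      (P.keys false false s (P.flow s b xw.1)).bind fun k =>
        PMF.pure (P.flow s b xw.1, k, bif b then k.2.2 else k.1.2)) (ENNReal.ofReal ε) := by
  obtain ⟨h₁, h₂⟩ := P.crs00_support hs
  refine Near.bind_left' fun xw hxw => ?_
  obtain ⟨hX, hR⟩ := hP.wordGen.1 κ s.1 s.2 (Or.inl h₁) (Or.inl h₂) xw hxw
  have hn := near_projHash (par := P.par s)
    (hε s.1 s.2 (Or.inl h₁) (Or.inl h₂) xw.1 xw.2 hX hR)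
  cases b
  · have := hn.bind fun y => (P.keyAndHash κ (P.par s) (P.compl s xw.1)).bind fun k₁ =>
      (PMF.pure (xw.1, (y.1, k₁), y.2) : PMF (P.BHR κ))
    simp only [PMF.bind_bind, PMF.pure_bind] at this
    simp only [flow, keys, bhHash, cond_false, PMF.bind_bind, PMF.pure_bind]
    convert this using 3 with k
    exact PMF.bind_comm _ _ _
  · have hc : P.compl s (P.compl s xw.1) = xw.1 :=
      (hP.complement κ s.1 s.2 (Or.inl h₁) h₂ xw.1 hX).2
    simp only [flow, keys, bhHash, cond_false, cond_true, PMF.bind_bind, PMF.pure_bind, hc]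
    refine Near.bind_left' fun k₀ _ => ?_
    have := hn.bind fun y => (PMF.pure (P.compl s xw.1, (k₀, y.1), y.2) : PMF (P.BHR κ))
    simpa only [PMF.bind_bind, PMF.pure_bind] using this

variable (P)

/-- A reference string of the normal use with the flow of an honest receiver. -/
def crsFlow (b : Bool) (κ : ℕ) : PMF (P.Crs κ × Bits (P.nX κ)) :=
  (P.crs00 κ).bind fun s => (P.wordGenL κ (P.par s)).bind fun xw => PMF.pure (s, P.flow s b xw.1)

/-- A reference string from `S₁ × R₀` with the flow of an honest receiver. -/
def crsFlow' (b : Bool) (κ : ℕ) : PMF (P.Crs κ × Bits (P.nX κ)) :=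
  (P.crs10 κ).bind fun s => (P.wordGenL κ (P.par s)).bind fun xw => PMF.pure (s, P.flow s b xw.1)

/-- Add the keys of the sender. -/
def addKeys (α β : Bool) (κ : ℕ) (t : P.Crs κ × Bits (P.nX κ)) :
    PMF ((P.Crs κ × Bits (P.nX κ)) × P.KeyVal κ × P.KeyVal κ) :=
  (P.keys α β t.1 t.2).bind fun k => PMF.pure (t, k)

/-- On `ρ ∈ R₀`, the complement permutes the set of words. -/
theorem uniform_compl (hP : P.IsSPHFwG) {s : P.Crs κ} (h₁ : P.InS κ s.1)
    (h₂ : s.2 ∈ (P.sampR0 κ s.1).support) (h : (P.X κ (P.par s)).Nonempty) :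
    (PMF.uniformOfFinset _ h).map (P.compl s) = PMF.uniformOfFinset _ h := by
  classical
  have hc := hP.complement κ s.1 s.2 h₁ h₂
  have hc1 : ∀ x ∈ P.X κ (P.par s), P.compl s x ∈ P.X κ (P.par s) := fun x hx => (hc x hx).1
  have hc2 : ∀ x ∈ P.X κ (P.par s), P.compl s (P.compl s x) = x := fun x hx => (hc x hx).2
  ext y
  rw [PMF.map_apply]
  by_cases hy : y ∈ P.X κ (P.par s)
  · rw [tsum_eq_single (P.compl s y)]
    · rw [if_pos (hc2 y hy).symm, PMF.uniformOfFinset_apply_of_mem _ (hc1 y hy),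
        PMF.uniformOfFinset_apply_of_mem _ hy]
    · intro x hx
      by_cases hxX : x ∈ P.X κ (P.par s)
      · rw [if_neg]
        rintro rfl
        exact hx (hc2 x hxX).symm
      · rw [PMF.uniformOfFinset_apply_of_notMem _ hxX, ite_self]
  · rw [PMF.uniformOfFinset_apply_of_notMem _ hy, ENNReal.tsum_eq_zero]
    intro x
    by_cases hxX : x ∈ P.X κ (P.par s)
    · rw [if_neg]
      rintro rfl
      exact hy (hc1 x hxX)
    · rw [PMF.uniformOfFinset_apply_of_notMem _ hxX, ite_self]

end SPHFwG

theorem SPHFwG.crs10_support (P : SPHFwG) {κ : ℕ} {s : P.Crs κ} (hs : s ∈ (P.crs10 κ).support) :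
    P.InS κ s.1 ∧ P.InR κ s.1 s.2 := by
  simp only [SPHFwG.crs10, PMF.do_bind, PMF.do_pure, PMF.mem_support_bind_iff,
    PMF.mem_support_pure_iff] at hs
  obtain ⟨s', h1, ρ, h2, rfl⟩ := hs
  exact ⟨Or.inr ⟨s'.2, h1⟩, Or.inl h2⟩

section BothHonest

variable (P : SPHFwG) [hP : Fact P.IsSPHFwG]

theorem Eff.keys (α β : Bool) : Eff fun κ (t : P.Crs κ × Bits (P.nX κ)) =>
    P.keys α β t.1 t.2 := by
  refine Eff.bind (Eff.cond (EffD.const fun _ => α) (Eff.keyAndRandom (EffD.par EffD.id.fst)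
    EffD.id.snd) (Eff.keyAndHash (EffD.par EffD.id.fst) EffD.id.snd)) (Eff.bind (Eff.cond
      (EffD.const fun _ => β) (Eff.keyAndRandom (EffD.par EffD.id.fst.fst)
        (EffD.compl EffD.id.fst.fst EffD.id.fst.snd)) (Eff.keyAndHash (EffD.par EffD.id.fst.fst)
        (EffD.compl EffD.id.fst.fst EffD.id.fst.snd))) (EffD.id.fst.snd.mk EffD.id.snd))

theorem eff_addKeys (α β : Bool) : Eff (P.addKeys α β) :=
  Eff.bind (Eff.keys P α β) EffD.id

theorem eff_flow (b : Bool) : Eff fun κ (s : P.Crs κ) =>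
    (P.wordGenL κ (P.par s)).bind fun xw => PMF.pure (s, P.flow s b xw.1) :=
  Eff.bind (Eff.wordGenL (EffD.par EffD.id)) (EffD.id.fst.mk (EffD.cond (EffD.const fun _ => b)
    (EffD.compl EffD.id.fst EffD.id.snd.fst) EffD.id.snd.fst))

theorem crsFlow_crsFlow' (b : Bool) : CompIndist (P.crsFlow b) (P.crsFlow' b) :=
  CompIndist.bind hP.out.crsIndistinguishability.1 (eff_flow P b)

/-- The flow of an honest receiver hides the choice bit: words of `ℒ` and their complements both
look like uniform words. -/
theorem crsFlow_true_false : CompIndist (P.crsFlow true) (P.crsFlow false) := by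
  obtain ⟨ε, hε, hX⟩ := hP.out.wordGen.2
  have h0 : CompIndist (P.crsFlow false) P.crsWithX :=
    (CompIndist.of_eq fun κ => rfl).trans hP.out.wordIndistinguishability
  have hc := h0.bind (f := fun κ t => PMF.pure (t.1, P.compl t.1 t.2))
    (EffD.id.fst.mk (EffD.compl EffD.id.fst EffD.id.snd))
  -- the complement of a nearly uniform word is nearly uniform
  have hu : CompIndist (fun κ => (P.crsWithX κ).bind fun t => PMF.pure (t.1, P.compl t.1 t.2))
      P.crsWithX := by
    refine CompIndist.of_near (ε := fun κ => 2 * max (ε κ) 0) ?_ fun κ => ?_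
    · exact (hε.max_zero.add hε.max_zero).of_le (fun κ => by positivity)
        fun κ => (two_mul _).le
    · simp only [SPHFwG.crsWithX, PMF.do_bind, PMF.do_pure, PMF.bind_bind, PMF.pure_bind]
      refine Near.bind_left' fun s hs => ?_
      obtain ⟨h₁, h₂⟩ := P.crs00_support hs
      obtain ⟨hne, hst⟩ := hX κ s.1 s.2 (Or.inl h₁) (Or.inl h₂)
      have hn := Near.of_statDist hst
      have e := congrArg (fun p : PMF (Bits (P.nX κ)) => p.bind fun x => PMF.pure (s, x))
        (P.uniform_compl hP.out (Or.inl h₁) h₂ hne)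
      simp only [PMF.bind_map, Function.comp_def] at e
      have h1 := hn.bind fun x => (PMF.pure (s, P.compl s x) : PMF (P.Crs κ × Bits (P.nX κ)))
      have h2 := hn.symm.bind fun x => (PMF.pure (s, x) : PMF (P.Crs κ × Bits (P.nX κ)))
      rw [show (PMF.uniformOfFinset (P.X κ (P.setup κ s.1 s.2)) hne).bind
        (fun x => PMF.pure (s, P.compl s x)) = _ from e] at h1
      refine (h1.trans h2).mono ?_
      rw [two_mul, ENNReal.ofReal_add (le_max_right _ _) (le_max_right _ _)]
      exact add_le_add (ENNReal.ofReal_le_ofReal (le_max_left _ _))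
        (ENNReal.ofReal_le_ofReal (le_max_left _ _))
  refine ((CompIndist.of_eq fun κ => ?_).trans (hc.trans hu)).trans h0.symm
  simp only [SPHFwG.crsFlow, PMF.bind_bind, PMF.pure_bind]
  rfl

/-- For `σ ∈ S₁`, the complement of a random word of `ℒ` is in `ℒ'` with overwhelming
probability. -/
theorem negl_compl_L' : Negl fun κ => prob (P.crsFlow' false κ)
    {t | P.compl t.1 t.2 ∉ P.L' κ (P.par t.1)} := by
  have := hP.out.decompositionIntractability (fun κ t =>
    (P.wordGenL κ (P.par (t.1, t.2.2))).bind fun xw =>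
      PMF.pure (xw.1, P.compl (t.1, t.2.2) xw.1)) (Eff.polyTime (Eff.bind
        (Eff.wordGenL (EffD.par (EffD.id.fst.mk EffD.id.snd.snd))) (EffD.id.snd.fst.mk
          (EffD.compl (EffD.mk EffD.id.fst.fst EffD.id.fst.snd.snd) EffD.id.snd.fst))))
  refine this.of_le (fun _ => ENNReal.toReal_nonneg) fun κ => ?_
  rw [prob_eq, prob_eq]
  refine ENNReal.toReal_mono ((expect_le_one fun a => Set.indicator_le_self _ 1 a).trans_lt
    ENNReal.one_lt_top).ne ?_
  simp only [SPHFwG.decompose, SPHFwG.crsFlow', SPHFwG.crs10, PMF.do_bind, PMF.do_pure,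
    PMF.bind_bind, PMF.pure_bind, expect_bind, expect_pure]
  refine expect_mono fun s hs => expect_mono fun ρ hρ => expect_mono fun xw hxw => ?_
  have hS : P.InS κ s.1 := Or.inr ⟨s.2, hs⟩
  have hR : P.InR κ s.1 ρ := Or.inl hρ
  obtain ⟨hX, hw⟩ := hP.out.wordGen.1 κ s.1 ρ hS hR xw hxw
  by_cases hb : P.compl (s.1, ρ) xw.1 ∉ P.L' κ (P.par (s.1, ρ))
  · refine (Set.indicator_le_self _ _ _).trans (le_of_eq ?_)
    rw [Set.indicator_of_mem]
    · rfl
    · exact ⟨⟨hX, fun h => (hP.out.languages κ s.1 ρ hS hR _ h).2 ⟨hX, xw.2, hw⟩⟩,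
        ⟨(hP.out.complement κ s.1 ρ hS hρ xw.1 hX).1, hb⟩, rfl⟩
  · refine (Set.indicator_of_notMem ?_ _).trans_le zero_le
    exact hb

/-- With overwhelming probability, the sender masks the second message with a hash value of a word
of `ℒ'` if `σ ∈ S₁` and the flow of the receiver is a random word of `ℒ`. -/
theorem crsFlow'_keys_snd :
    CompIndist (fun κ => (P.crsFlow' false κ).bind (P.addKeys false false κ))
      (fun κ => (P.crsFlow' false κ).bind (P.addKeys false true κ)) := by
  obtain ⟨ε, hε, hsm⟩ := hP.out.smoothness
  refine CompIndist.of_near (hε.max_zero.add (negl_compl_L' P)) fun κ => ?_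
  rw [ENNReal.ofReal_add (le_max_right _ _) (show 0 ≤ prob _ _ from ENNReal.toReal_nonneg),
    prob_ofReal]
  refine Near.bind_left fun t ht hb => ?_
  rw [Set.mem_ofPred_eq, not_not] at hb
  simp only [SPHFwG.crsFlow', PMF.mem_support_bind_iff, PMF.mem_support_pure_iff] at ht
  obtain ⟨s, hs, xw, hxw, rfl⟩ := ht
  obtain ⟨hS, hR⟩ := P.crs10_support hs
  have hn := (Near.of_statDist (hsm κ s.1 s.2 hS hR _ hb)).mono
    (ENNReal.ofReal_le_ofReal (le_max_left (ε κ) 0))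
  exact Near.bind (Near.bind_left' fun k₀ _ => hn.bind _) _

/-- With overwhelming probability, the sender masks the first message with a hash value of a word
of `ℒ'` if `σ ∈ S₁` and the flow of the receiver is the complement of a random word of `ℒ`. -/
theorem crsFlow'_keys_fst :
    CompIndist (fun κ => (P.crsFlow' true κ).bind (P.addKeys false true κ))
      (fun κ => (P.crsFlow' true κ).bind (P.addKeys true true κ)) := by
  obtain ⟨ε, hε, hsm⟩ := hP.out.smoothness
  refine CompIndist.of_near (hε.max_zero.add (negl_compl_L' P)) fun κ => ?_
  rw [ENNReal.ofReal_add (le_max_right _ _) (show 0 ≤ prob _ _ from ENNReal.toReal_nonneg),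
    prob_ofReal]
  have e : P.crsFlow' true κ = (P.crsFlow' false κ).bind fun t =>
      PMF.pure (t.1, P.compl t.1 t.2) := by
    simp only [SPHFwG.crsFlow', PMF.bind_bind, PMF.pure_bind]
    rfl
  rw [e, PMF.bind_bind, PMF.bind_bind]
  refine Near.bind_left fun t ht hb => ?_
  rw [Set.mem_ofPred_eq, not_not] at hb
  simp only [SPHFwG.crsFlow', PMF.mem_support_bind_iff, PMF.mem_support_pure_iff] at ht
  obtain ⟨s, hs, xw, hxw, rfl⟩ := ht
  obtain ⟨hS, hR⟩ := P.crs10_support hs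
  have hn := (Near.of_statDist (hsm κ s.1 s.2 hS hR _ hb)).mono
    (ENNReal.ofReal_le_ofReal (le_max_left (ε κ) 0))
  rw [PMF.pure_bind, PMF.pure_bind]
  exact Near.bind (Near.bind hn _) _

/-- The hash values of the sender look uniform to the adversary. The hash value of the second word
is replaced under `σ ∈ S₁` while the flow of the receiver is a word of `ℒ`; that of the first word,
while its complement is one. -/
theorem crsFlow_keys :
    CompIndist (fun κ => (P.crsFlow false κ).bind (P.addKeys false false κ))
      (fun κ => (P.crsFlow false κ).bind (P.addKeys true true κ)) := by
  have h0 := fun α β => (crsFlow_crsFlow' P false).bind (eff_addKeys P α β)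
  have h1 := fun α β => (crsFlow_crsFlow' P true).bind (eff_addKeys P α β)
  have h2 := fun α β => (crsFlow_true_false P).bind (eff_addKeys P α β)
  exact ((((((h0 false false).trans (crsFlow'_keys_snd P)).trans (h0 false true).symm).trans
    (h2 false true).symm).trans (h1 false true)).trans (crsFlow'_keys_fst P)).trans
      ((h1 true true).symm.trans (h2 true true))

/-- All presampled values for the choice bit `b`, from the flow and the keys. -/
def addHash (b : Bool) (κ : ℕ) (t : (P.Crs κ × Bits (P.nX κ)) × P.KeyVal κ × P.KeyVal κ) :
    PMF (P.Crs κ × P.BHR κ) :=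
  PMF.pure (t.1.1, t.1.2, t.2, bif b then t.2.2.2 else t.2.1.2)

/-- The presampled values for both choice bits are indistinguishable from those in which the flow is a
random word of `ℒ` and the hash values are uniform; then only the hash value of the receiver, which
is selected among those of the sender, depends on the bit. -/
theorem bhGen_indist (b : Bool) :
    CompIndist (fun κ => (P.crs00 κ).bind fun s => (P.bhGen b s).bind fun p => PMF.pure (s, p))
      (fun κ => ((P.crsFlow false κ).bind (P.addKeys true true κ)).bind (addHash P b κ)) := by
  obtain ⟨ε, hε, hc⟩ := hP.out.correctness
  have hg : Eff (addHash P b) := EffD.id.fst.fst.mk (EffD.id.fst.snd.mk (EffD.id.snd.mk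
    (EffD.cond (EffD.const fun _ => b) EffD.id.snd.snd.snd EffD.id.snd.fst.snd)))
  have hb : CompIndist (P.crsFlow b) (P.crsFlow false) := by
    cases b
    · exact CompIndist.of_eq fun _ => rfl
    · exact crsFlow_true_false P
  refine (CompIndist.of_near hε fun κ => ?_).trans
    (((hb.bind (eff_addKeys P false false)).trans (crsFlow_keys P)).bind hg)
  simp only [SPHFwG.crsFlow, SPHFwG.addKeys, addHash, PMF.bind_bind, PMF.pure_bind]
  refine Near.bind_left' fun s hs => ?_
  have := (SPHFwG.near_bhGen hP.out (hc κ) b hs).bind fun p =>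
    (PMF.pure (s, p) : PMF (P.Crs κ × P.BHR κ))
  simpa only [PMF.bind_bind, PMF.pure_bind] using this

/-- The values sampled in the protocol, for both choice bits. -/
def bhReal (κ : ℕ) : PMF (P.Crs κ × P.BHR κ × P.BHR κ) :=
  (P.crs00 κ).bind fun s => (P.bhGen false s).bind fun p₀ => (P.bhGen true s).bind fun p₁ =>
    PMF.pure (s, p₀, p₁)

/-- The values sampled in the simulation, for both choice bits. -/
def bhIdeal (κ : ℕ) : PMF (P.Crs κ × P.BHR κ × P.BHR κ) :=
  (P.crs00 κ).bind fun s => (P.wordGenL κ (P.par s)).bind fun xw =>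
    (P.keys true true s xw.1).bind fun k =>
      PMF.pure (s, (xw.1, k, k.1.2), (xw.1, k, k.2.2))

theorem bhReal_fst : CompIndist (fun κ => (bhReal P κ).map fun x => (x.1, x.2.1))
    (fun κ => (bhIdeal P κ).map fun x => (x.1, x.2.1)) := by
  refine ((CompIndist.of_eq fun κ => ?_).trans (bhGen_indist P false)).trans
    (CompIndist.of_eq fun κ => ?_)
  · simp only [bhReal, PMF.map_bind, PMF.pure_map, PMF.bind_const]
  · simp only [bhIdeal, SPHFwG.crsFlow, SPHFwG.addKeys, addHash, PMF.map_bind, PMF.pure_map,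
      PMF.bind_bind, PMF.pure_bind]
    rfl

theorem bhReal_snd : CompIndist (fun κ => (bhReal P κ).map fun x => (x.1, x.2.2))
    (fun κ => (bhIdeal P κ).map fun x => (x.1, x.2.2)) := by
  refine ((CompIndist.of_eq fun κ => ?_).trans (bhGen_indist P true)).trans
    (CompIndist.of_eq fun κ => ?_)
  · simp only [bhReal, PMF.map_bind, PMF.pure_map, PMF.bind_const]
  · simp only [bhIdeal, SPHFwG.crsFlow, SPHFwG.addKeys, addHash, PMF.map_bind, PMF.pure_map,
      PMF.bind_bind, PMF.pure_bind]
    rfl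

end BothHonest

theorem realizes_bothHonest (P : SPHFwG) (hP : P.IsSPHFwG) {c : Party → Bool}
    (hr : c .receiver = false) (hs : c .sender = false) :
    UCEmulates (P.protocolOT c) (idealOT P.nV c) := by
  intro n A
  have : Fact P.IsSPHFwG := ⟨hP⟩
  refine ⟨simAdversary c A _ (effSim_bh P c), fun E => ?_⟩
  refine (choice_indist A E (effCore_bh P) (u₀ := fun κ s => (s, none))
    (EffD.id.mk (EffD.const fun _ => none)) (bhReal_fst P)
    (bhReal_snd P)).of_le (fun _ => abs_nonneg _) fun κ => le_of_eq ?_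
  rw [exec_simAdversary A E (effSim_bh P c) κ (SPHFwG.simulates_bh hr hs), P.exec_protocolOT]
  congr 3
  · simp only [bhReal, PMF.bind_bind, PMF.pure_bind]
    refine PMF.bind_congr fun s hs' => ?_
    obtain ⟨h₁, h₂⟩ := P.crs00_support hs'
    rw [(SPHFwG.protCore_intertwines_bh hP hr hs).bit (G := play A E κ) (SPHFwG.ProtState.init s)
      ⟨h₁, h₂, fun _ h => (by cases h), rfl, fun _ h => (by cases h), rfl,
        fun h => (Bool.false_ne_true h).elim⟩]
    simp only [SPHFwG.bhState, SPHFwG.ProtState.init, Option.elim_none, PMF.bind_bind,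
      PMF.pure_bind]
    rfl
  · simp only [bhIdeal, SPHFwG.simBH, SPHFwG.simState, SPHFwG.simKeys, PMF.bind_bind,
      PMF.pure_bind]
    rfl

end GreyOT

end

theorem mainTheorem1 (P : GreyOT.SPHFwG) (hP : P.IsSPHFwG) : P.RealizesOT := by
  intro c
  cases hr : c .receiver <;> cases hs : c .sender
  · exact GreyOT.realizes_bothHonest P hP hr hs
  · exact GreyOT.realizes_senderCorrupted P hP hr hs
  · exact GreyOT.realizes_receiverCorrupted P hP hr hs
  · exact GreyOT.realizes_bothCorrupted P hP hr hs
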